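/- **Setting.** Let $\tilde H$ be a connected Lie group acting smoothly, transitively and effectively on a manifold $\tilde M$ of dimension $n+m$. Let $o\in\tilde M$ have stabilizer $\tilde K$, suppose that $\tilde M=\tilde H/\tilde K$ as a manifold, and write $L_h$ for the action of $h\in\tilde H$. Put $V=\mathbb R^{n+m}$ and $W=\mathbb R^n\times\{0\}\subset V$. Let $u_o:V\to T_o\tilde M$ be a frame, let $\tilde P=\{(L_h)_*\circ u_o: h\in\tilde H\}$ be the associated homogeneous structure, and let $\tilde G=\{A\in GL(V): u_o\circ A\in\tilde P\}$, the image of the isotropy representation of $\tilde K$ in the frame $u_o$. Suppose that $\tilde P$ is *flat $2$-reductive*: the Lie algebra of $\tilde H$ is graded, $\tilde{\mathfrak h}=\tilde{\mathfrak h}^{-1}\oplus\tilde{\mathfrak h}^{0}\oplus\tilde{\mathfrak h}^{1}$ with $[\tilde{\mathfrak h}^i,\tilde{\mathfrak h}^j]\subset\tilde{\mathfrak h}^{i+j}$ (and $\tilde{\mathfrak h}^i=0$ for other $i$), and the Lie algebra of $\tilde K$ is $\tilde{\mathfrak h}^0\oplus\tilde{\mathfrak h}^1$. Identify $V\simeq\tilde{\mathfrak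 h}^{-1}$ through $u_o$ and $\tilde{\mathfrak h}^{-1}\simeq T_o\tilde M$. The group $\tilde K$ preserves the filtration of $\tilde{\mathfrak h}$ by the subspaces $\bigoplus_{j\ge i}\tilde{\mathfrak h}^j$ under $\mathrm{Ad}$. Its action on the associated graded algebra, which is identified with $\tilde{\mathfrak h}$, factors through $\tilde G$; this is the action of $\tilde G$ on $\tilde{\mathfrak h}$ used below, and on $V$ it is the standard one. Let $G_\sharp=\{A\in\tilde G: A W=W\}$, and let $G\subset GL(W)$ be the group of restrictions $A|_W$, $A\in G_\sharp$. Let $P\to M$ be a $G$-structure on an $n$-manifold $M$; $G_\sharp$ acts on $P$ on the right through $G_\sharp\to G$. **Cohomology.** Let $C^{p,q}=\tilde{\mathfrak h}^{p-1}\otimes\Lambda^qW^*$, and let $\partial:C^{p,q}\to C^{p-1,q+1}$ be $$\partial c(w_1,\dots,w_{q+1})=\sum_{i}(-1)^{i}\,[c(w_1,\dots,\widehat{w_i},\dots,w_{q+1}),w_i].$$ Let $H^{p,q}(\tilde{\mathfrak h},W)=\ker(\partial|_{C^{p,q}})/\partial C^{p+1,q-1}$. The group $G_\sharp$ acts on $C^{p,q}$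 and $H^{p,q}(\tilde{\mathfrak h},W)$ by $(A\cdot c)(w_1,\dots,w_q)=A\cdot c(A^{-1}w_1,\dots,A^{-1}w_q)$. **Curvature and immersibility.** Let $s$ be a smooth section of $P$ over an open set $U\subset M$. Put $\omega^{-1}_x=s_x^{-1}:T_xM\to W\subset\tilde{\mathfrak h}^{-1}$. For smooth $1$-forms $\omega^r$ on $U$ with values in $\tilde{\mathfrak h}^r$ ($0\le r\le p-1$) let $$\Omega^{p-1}=d\omega^{p-1}+\tfrac12\sum_{r=0}^{p-1}[\omega^r,\omega^{p-1-r}],\qquad [\alpha,\beta](v,w)=[\alpha(v),\beta(w)]-[\alpha(w),\beta(v)],$$ where for $p=0$ the sum is empty, so that $\Omega^{-1}=d\omega^{-1}$. The tuple $(s,\omega^0,\dots,\omega^{p-1})$ is *admissible* if $\Omega^{r-1}=-[\omega^{-1},\omega^r]$ on $U$ for $0\le r\le p-1$. The structure $P$ is *immersible to order $p$* if every point of $M$ has an open neighbourhood carrying an admissible tuple $(s,\omega^0,\dots,\omega^{p-1})$. By means of $s_x:W\to T_xM$, regard $\Omega^{p-1}|_x$ as an element of $C^{p,2}$. **Theorem.**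 Suppose that $H^{1,1}(\tilde{\mathfrak h},W)=H^{2,1}(\tilde{\mathfrak h},W)=0$, that $0\le p\le2$, and that $P$ is immersible to order $p$. Then: 1. Every $u\in P$ over $x\in M$ is the value $s_x$ of some admissible tuple $(s,\omega^0,\dots,\omega^{p-1})$ near $x$. For every such tuple $\Omega^{p-1}|_x$ is a cocycle, and its class $[\Omega^{p-1}|_x]$ (the essential curvature) depends only on the frame $u$. Hence there is a well-defined map $$R^{p+1}:P\to H^{p,2}(\tilde{\mathfrak h},W),\qquad R^{p+1}(s_x)=[\Omega^{p-1}|_x].$$ 2. $R^{p+1}$ is $G_\sharp$-equivariant: $R^{p+1}(u\cdot A^{-1})=A\cdot R^{p+1}(u)$ for all $u\in P$, $A\in G_\sharp$. 3. $R^{p+1}$ vanishes identically if and only if $P$ is immersible to order $p+1$. -/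

import Mathlib

open scoped Manifold ContDiff

noncomputable section

namespace Immersible

/-- `ℝⁿ`. -/
abbrev Euc (n : ℕ) := EuclideanSpace ℝ (Fin n)

/-- The inclusion `ℝⁿ → ℝⁿ⁺ᵐ` onto the vectors whose last `m` coordinates vanish; its range is the
subspace `W` of `V = ℝⁿ⁺ᵐ`. -/
def inclW (n m : ℕ) : Euc n →ₗ[ℝ] Euc (n + m) where
  toFun w := WithLp.toLp 2 (Fin.append w (0 : Fin m → ℝ))
  map_add' v w := by
    ext i
    refine Fin.addCases (fun j => ?_) (fun j => ?_) i <;> simp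
  map_smul' c w := by
    ext i
    refine Fin.addCases (fun j => ?_) (fun j => ?_) i <;> simp

/-! ### Graded Lie algebras and the generalized Spencer complex -/

section Algebra

variable {L : Type*} [LieRing L] [LieAlgebra ℝ L]

/-- `L = ∑_{i = -1}^{k-1} gr i` is a graded Lie algebra of depth `1` and height `k`. -/
structure IsGradedLieAlgebra (k : ℕ) (gr : ℤ → Submodule ℝ L) : Prop where
  internal : DirectSum.IsInternal gr
  eq_bot : ∀ i : ℤ, i < -1 ∨ (k : ℤ) ≤ i → gr i = ⊥
  bracket_mem : ∀ (i j : ℤ) (x y : L), x ∈ gr i → y ∈ gr j → ⁅x, y⁆ ∈ gr (i + j)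

theorem bijective_coeLinearMap {gr : ℤ → Submodule ℝ L} (h : DirectSum.IsInternal gr) :
    Function.Bijective (DirectSum.coeLinearMap gr) := h

/-- The projection of `L = ⨁ gr i` onto the summand `gr i`. -/
def gradedProj {gr : ℤ → Submodule ℝ L} (h : DirectSum.IsInternal gr) (i : ℤ) : L →ₗ[ℝ] L :=
  (gr i).subtype ∘ₗ DirectSum.component ℝ ℤ (fun i => gr i) i ∘ₗ
    (LinearEquiv.ofBijective (DirectSum.coeLinearMap gr) (bijective_coeLinearMap h)).symm.toLinearMap

theorem gradedProj_of_mem {gr : ℤ → Submodule ℝ L} (h : DirectSum.IsInternal gr) {i : ℤ} {x : L}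
    (hx : x ∈ gr i) : gradedProj h i x = x := by
  have : (LinearEquiv.ofBijective (DirectSum.coeLinearMap gr) (bijective_coeLinearMap h)).symm x
      = DirectSum.lof ℝ ℤ (fun i => gr i) i ⟨x, hx⟩ := by
    rw [LinearEquiv.symm_apply_eq, LinearEquiv.ofBijective_apply, DirectSum.coeLinearMap_lof]
  simp [gradedProj, this]

theorem gradedProj_of_mem_ne {gr : ℤ → Submodule ℝ L} (h : DirectSum.IsInternal gr) {i j : ℤ}
    (hij : i ≠ j) {x : L} (hx : x ∈ gr j) : gradedProj h i x = 0 := by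
  have : (LinearEquiv.ofBijective (DirectSum.coeLinearMap gr) (bijective_coeLinearMap h)).symm x
      = DirectSum.lof ℝ ℤ (fun i => gr i) j ⟨x, hx⟩ := by
    rw [LinearEquiv.symm_apply_eq, LinearEquiv.ofBijective_apply, DirectSum.coeLinearMap_lof]
  simp [gradedProj, this, DirectSum.component.of, hij.symm]

variable {W : Type*} [AddCommGroup W] [Module ℝ W] (ι : W →ₗ[ℝ] L) (gr : ℤ → Submodule ℝ L)

/-- The generalized Spencer operator on `L`-valued alternating `q`-forms on `W`, where `W` is
regarded as a subspace of `L` through `ι`. -/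
def spencer (q : ℕ) : (W [⋀^Fin q]→ₗ[ℝ] L) →ₗ[ℝ] (W [⋀^Fin (q + 1)]→ₗ[ℝ] L) where
  toFun c := AlternatingMap.alternatizeUncurryFin
    { toFun := fun w => (LieModule.toEnd ℝ L L (ι w)).compAlternatingMap c
      map_add' := fun v w => by ext; simp
      map_smul' := fun a w => by ext; simp }
  map_add' c d := by
    ext w
    simp [AlternatingMap.alternatizeUncurryFin_apply, Finset.sum_add_distrib]
  map_smul' a c := by
    ext w
    simp [AlternatingMap.alternatizeUncurryFin_apply, Finset.smul_sum, smul_comm a]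

/-- `∂c(w₁, …, w_{q+1}) = ∑ᵢ (-1)ⁱ [c(w₁, …, ŵᵢ, …, w_{q+1}), wᵢ]` (here `i` is counted from `0`,
whence the shift in the exponent). -/
theorem spencer_apply (q : ℕ) (c : W [⋀^Fin q]→ₗ[ℝ] L) (w : Fin (q + 1) → W) :
    spencer ι q c w
      = ∑ i : Fin (q + 1), (-1 : ℤ) ^ ((i : ℕ) + 1) • ⁅c (i.removeNth w), ι (w i)⁆ := by
  simp only [spencer, LinearMap.coe_mk, AddHom.coe_mk,
    AlternatingMap.alternatizeUncurryFin_apply, LinearMap.compAlternatingMap_apply,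
    LieModule.toEnd_apply_apply]
  refine Finset.sum_congr rfl fun i _ => ?_
  rw [← lie_skew, pow_succ, smul_neg]
  simp

/-- `C^{p,q} = gr (p-1) ⊗ Λ^q W*`. -/
def cochains (p : ℤ) (q : ℕ) : Submodule ℝ (W [⋀^Fin q]→ₗ[ℝ] L) where
  carrier := {c | ∀ w, c w ∈ gr (p - 1)}
  add_mem' hc hd w := (gr (p - 1)).add_mem (hc w) (hd w)
  zero_mem' _ := (gr (p - 1)).zero_mem
  smul_mem' a _ hc w := (gr (p - 1)).smul_mem a (hc w)

/-- The `(p,q)`-cocycles `Z^{p,q}`. -/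
def cocycles (p : ℤ) (q : ℕ) : Submodule ℝ (W [⋀^Fin q]→ₗ[ℝ] L) :=
  cochains gr p q ⊓ LinearMap.ker (spencer ι q)

/-- The `(p,q)`-coboundaries `B^{p,q} = ∂ C^{p+1,q-1}`. -/
def coboundaries (p : ℤ) : (q : ℕ) → Submodule ℝ (W [⋀^Fin q]→ₗ[ℝ] L)
  | 0 => ⊥
  | q + 1 => (cochains gr (p + 1) q).map (spencer ι q)

/-- `H^{p,q} = Z^{p,q} / B^{p,q}`. -/
abbrev Cohomology (p : ℤ) (q : ℕ) : Type _ :=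
  ↥(cocycles ι gr p q) ⧸ (coboundaries ι gr p q).submoduleOf (cocycles ι gr p q)

variable {ι gr} in
/-- `c` is a cocycle, and its class is `ξ`. -/
def IsClass {p : ℤ} {q : ℕ} (ξ : Cohomology ι gr p q) (c : W [⋀^Fin q]→ₗ[ℝ] L) : Prop :=
  ∃ hc : c ∈ cocycles ι gr p q, Submodule.Quotient.mk ⟨c, hc⟩ = ξ

end Algebra

/-! ### Vector valued `1`-forms and `2`-forms -/

section Forms

/-- The alternating form `(v, w) ↦ b v w - b w v`. -/
def skew {T F : Type*} [AddCommGroup T] [Module ℝ T] [AddCommGroup F] [Module ℝ F]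
    (b : T →ₗ[ℝ] T →ₗ[ℝ] F) : T [⋀^Fin 2]→ₗ[ℝ] F :=
  AlternatingMap.alternatizeUncurryFin
    { toFun := fun v => AlternatingMap.ofSubsingleton ℝ T F (0 : Fin 1) (b v)
      map_add' := fun v w => by ext; simp
      map_smul' := fun a v => by ext; simp }

theorem skew_apply {T F : Type*} [AddCommGroup T] [Module ℝ T] [AddCommGroup F] [Module ℝ F]
    (b : T →ₗ[ℝ] T →ₗ[ℝ] F) (v : Fin 2 → T) : skew b v = b (v 0) (v 1) - b (v 1) (v 0) := by
  simp [skew, AlternatingMap.alternatizeUncurryFin_apply, Fin.sum_univ_two, Fin.removeNth,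
    sub_eq_add_neg]

/-- The alternating form `(v, w) ↦ ⁅a v, b w⁆ - ⁅a w, b v⁆`. -/
def skewBracket {T L : Type*} [AddCommGroup T] [Module ℝ T] [LieRing L] [LieAlgebra ℝ L]
    (a b : T →ₗ[ℝ] L) : T [⋀^Fin 2]→ₗ[ℝ] L :=
  skew ((LieModule.toEnd ℝ L L : L →ₗ[ℝ] L →ₗ[ℝ] L).compl₁₂ a b)

theorem skewBracket_apply {T L : Type*} [AddCommGroup T] [Module ℝ T] [LieRing L]
    [LieAlgebra ℝ L] (a b : T →ₗ[ℝ] L) (v : Fin 2 → T) :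
    skewBracket a b v = ⁅a (v 0), b (v 1)⁆ - ⁅a (v 1), b (v 0)⁆ := by
  simp [skewBracket, skew_apply]

variable {W : Type*} [NormedAddCommGroup W] [NormedSpace ℝ W]
  {M : Type*} [TopologicalSpace M] [ChartedSpace W M]
  [IsManifold 𝓘(ℝ, W) ∞ M] {F : Type*} [NormedAddCommGroup F] [NormedSpace ℝ F]

/-- The tangent frames at `x`, as isomorphisms `W → T_x M`; here `W` is the model space of `M`,
which is `ℝⁿ` in the main statement. -/
abbrev Frame (W : Type*) [NormedAddCommGroup W] [NormedSpace ℝ W] {M : Type*} [TopologicalSpace M]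
    [ChartedSpace W M] (x : M) : Type _ :=
  W ≃L[ℝ] TangentSpace 𝓘(ℝ, W) x

/-- Smoothness on `U` of an `F`-valued `1`-form, as a section of the bundle `Hom(TM, F)`. -/
def IsSmoothForm (U : Set M) (θ : ∀ x : M, TangentSpace 𝓘(ℝ, W) x →L[ℝ] F) : Prop :=
  ContMDiffOn 𝓘(ℝ, W) (𝓘(ℝ, W).prod 𝓘(ℝ, W →L[ℝ] F)) ∞
    (fun x => (⟨x, θ x⟩ : Bundle.TotalSpace (W →L[ℝ] F)
      (fun x : M => TangentSpace 𝓘(ℝ, W) x →L[ℝ] Bundle.Trivial M F x))) U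

/-- The expression `(φ⁻¹)^* θ` of a `1`-form in the chart `φ` of `M` around `x`. -/
def coordForm (θ : ∀ x : M, TangentSpace 𝓘(ℝ, W) x →L[ℝ] F) (x : M) : W → (W →L[ℝ] F) :=
  fun y => (θ ((extChartAt 𝓘(ℝ, W) x).symm y)).comp
    (mfderiv 𝓘(ℝ, W) 𝓘(ℝ, W) (extChartAt 𝓘(ℝ, W) x).symm y)

/-- The exterior derivative of an `F`-valued `1`-form: in a chart `φ` around `x` it is
`(v, w) ↦ D_v θ (w) - D_w θ (v)`, transported to `T_x M` by `dφ`. -/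
def extDer (θ : ∀ x : M, TangentSpace 𝓘(ℝ, W) x →L[ℝ] F) (x : M) :
    TangentSpace 𝓘(ℝ, W) x [⋀^Fin 2]→ₗ[ℝ] F :=
  (skew (ContinuousLinearMap.coeLM ℝ ∘ₗ
    (fderiv ℝ (coordForm θ x) (extChartAt 𝓘(ℝ, W) x x)).toLinearMap)).compLinearMap
      (mfderiv 𝓘(ℝ, W) 𝓘(ℝ, W) (extChartAt 𝓘(ℝ, W) x) x).toLinearMap

end Forms

/-! ### Homogeneous structures -/

instance : ENat.LEInfty (minSmoothness ℝ 3) where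
  out := by
    rw [minSmoothness_of_isRCLikeNormedField]
    exact WithTop.coe_le_coe.2 (le_top : (3 : ℕ∞) ≤ ⊤)

section Homogeneous

variable (E : Type*) [NormedAddCommGroup E] [NormedSpace ℝ E] [CompleteSpace E]
  (V : Type*) [NormedAddCommGroup V] [NormedSpace ℝ V]
  (H : Type*) [TopologicalSpace H] [ChartedSpace E H] [Group H]
  (Mt : Type*) [TopologicalSpace Mt] [ChartedSpace V Mt] [MulAction H Mt]

/-- The Lie algebra `𝔥 = T_e H`. -/
abbrev LieAlg : Type _ := GroupLieAlgebra 𝓘(ℝ, E) H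

/-- `𝔥` as the model space of `H`. -/
def LieAlg.toModel : LieAlg E H ≃L[ℝ] E := ContinuousLinearEquiv.refl ℝ E

variable {E V H Mt}

/-- The differential at `e` of the orbit map `h ↦ h · o`. It is a linear map
`T_e H → T_{e · o} Mt = T_o Mt`. -/
def orbitDiff (o : Mt) : LieAlg E H →L[ℝ] TangentSpace 𝓘(ℝ, V) o :=
  mfderiv 𝓘(ℝ, E) 𝓘(ℝ, V) (fun h : H => h • o) 1

variable (E V H Mt)

/-- A homogeneous structure on the manifold `Mt = H / K`, which is `k`-reductive with graded Lie
algebra `𝔥`, i.e. which is flat `k`-reductive. The Lie group `H` acts on `Mt`, and `K` is the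
stabilizer of `base`. (Smoothness, transitivity and effectiveness of the action are assumed through
type classes.) -/
structure FlatReductive [LieGroup 𝓘(ℝ, E) ∞ H] (k : ℕ) where
  /-- the origin `o = eK` -/
  base : Mt
  /-- the frame `u_o` at `o` -/
  frame : Frame V base
  /-- the orbit map `h ↦ h · o` is a submersion (at `e`, hence everywhere), i.e. `Mt` carries the
  manifold structure of `H / K` -/
  submersion : Function.Surjective (orbitDiff (E := E) (V := V) (H := H) base)
  /-- the grading of the Lie algebra of `H` -/
  gr : ℤ → Submodule ℝ (LieAlg E H)
  graded : IsGradedLieAlgebra k gr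
  /-- the isotropy subalgebra `𝔨`, i.e. the kernel of `𝔥 → T_o Mt`, is `∑_{i ≥ 0} gr i` -/
  isotropy : LinearMap.ker (orbitDiff (E := E) (V := V) (H := H) base).toLinearMap
    = ⨆ i : ℕ, gr i

namespace FlatReductive

variable {E : Type*} [NormedAddCommGroup E] [NormedSpace ℝ E] [CompleteSpace E]
  {V : Type*} [NormedAddCommGroup V] [NormedSpace ℝ V]
  {H : Type*} [TopologicalSpace H] [ChartedSpace E H] [Group H]
  [LieGroup 𝓘(ℝ, E) ∞ H]
  {Mt : Type*} [TopologicalSpace Mt] [ChartedSpace V Mt] [MulAction H Mt] {k : ℕ}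
  (T : FlatReductive E V H Mt k)

/-- The projection `𝔥 → 𝔥 / 𝔨 ≃ T_o Mt`. -/
def proj : LieAlg E H →L[ℝ] TangentSpace 𝓘(ℝ, V) T.base := orbitDiff T.base

theorem bijective_proj_gr :
    Function.Bijective (T.proj.toLinearMap ∘ₗ (T.gr (-1)).subtype) := by
  have hp : ∀ i : ℤ, ∀ x ∈ T.gr i, gradedProj T.graded.internal i x = x :=
    fun i x hx => gradedProj_of_mem _ hx
  have hk : ∀ x ∈ (⨆ i : ℕ, T.gr i), gradedProj T.graded.internal (-1) x = 0 := by
    intro x hx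
    have : (⨆ i : ℕ, T.gr i) ≤ LinearMap.ker (gradedProj T.graded.internal (-1)) :=
      iSup_le fun i y hy => gradedProj_of_mem_ne _ (by omega) hy
    exact this hx
  constructor
  · rw [← LinearMap.ker_eq_bot, LinearMap.ker_eq_bot']
    intro x hx
    have h1 : (x : LieAlg E H) ∈ (⨆ i : ℕ, T.gr i) := by
      rw [← T.isotropy]
      exact hx
    have h2 := hk _ h1
    rw [hp _ _ x.2] at h2
    exact Subtype.ext h2
  · intro y
    obtain ⟨x, hx⟩ := T.submersion y
    have htop : x ∈ T.gr (-1) ⊔ ⨆ i : ℕ, T.gr i := by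
      have h1 : (⨆ i, T.gr i) = ⊤ := T.graded.internal.submodule_iSup_eq_top
      have h2 : (⨆ i, T.gr i) ≤ T.gr (-1) ⊔ ⨆ i : ℕ, T.gr i := by
        refine iSup_le fun i => ?_
        rcases lt_trichotomy i (-1) with h | h | h
        · rw [T.graded.eq_bot i (Or.inl h)]
          exact bot_le
        · rw [h]
          exact le_sup_left
        · lift i to ℕ using (by omega)
          exact le_sup_of_le_right (le_iSup (fun i : ℕ => T.gr i) i)
      exact h2 (h1 ▸ Submodule.mem_top)
    obtain ⟨a, ha, b, hb, rfl⟩ := Submodule.mem_sup.1 htop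
    refine ⟨⟨a, ha⟩, ?_⟩
    rw [← T.isotropy] at hb
    have hb' : T.proj b = 0 := hb
    have := T.proj.map_add a b
    rw [hb', add_zero, show T.proj (a + b) = y from hx] at this
    exact this.symm

/-- The identification of `V = ℝᵈ` with `gr (-1)`, through the frame `u_o : ℝᵈ ≃ T_o Mt` and
`gr (-1) ≃ 𝔥 / 𝔨 ≃ T_o Mt`. -/
def embV : V →ₗ[ℝ] LieAlg E H :=
  (T.gr (-1)).subtype ∘ₗ (LinearEquiv.ofBijective _ T.bijective_proj_gr).symm.toLinearMap ∘ₗ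
    T.frame.toLinearEquiv.toLinearMap

/-- The homogeneous structure `P̃ = H · u_o`: its fibre over `y` consists of the frames
`L_{h *} ∘ u_o` with `h · o = y`. -/
def frames (y : Mt) : Set (Frame V y) :=
  {u | ∃ h : H, h • T.base = y ∧
    ∀ v : V, (u v : V) = mfderiv 𝓘(ℝ, V) 𝓘(ℝ, V) (fun z : Mt => h • z) T.base (T.frame v)}

/-- `k ∈ K` and `A` is the matrix in the frame `u_o` of the differential of `L_k` at `o`. -/
def IsIsotropy (k : H) (A : V ≃L[ℝ] V) : Prop :=
  k • T.base = T.base ∧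
    ∀ v : V, (T.frame (A v) : V) =
      mfderiv 𝓘(ℝ, V) 𝓘(ℝ, V) (fun z : Mt => k • z) T.base (T.frame v)

theorem mem_frames_base {A : V ≃L[ℝ] V} :
    A.trans T.frame ∈ T.frames T.base ↔ ∃ k : H, T.IsIsotropy k A := Iff.rfl

theorem IsIsotropy.one : T.IsIsotropy (1 : H) (1 : V ≃L[ℝ] V) := by
  refine ⟨one_smul _ _, fun v => ?_⟩
  have hc : (fun z : Mt => (1 : H) • z) = id := by
    ext z
    simp
  rw [hc, mfderiv_id]
  rfl

variable [ContMDiffSMul 𝓘(ℝ, E) 𝓘(ℝ, V) ∞ H Mt]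

theorem mdifferentiableAt_smul (_T : FlatReductive E V H Mt k) (h : H) (z : Mt) :
    MDifferentiableAt 𝓘(ℝ, V) 𝓘(ℝ, V) (fun z : Mt => h • z) z := by
  have h1 : ContMDiff (𝓘(ℝ, E).prod 𝓘(ℝ, V)) 𝓘(ℝ, V) ∞ (fun p : H × Mt => p.1 • p.2) :=
    ContMDiffSMul.contMDiff_smul
  have h2 : ContMDiff 𝓘(ℝ, V) (𝓘(ℝ, E).prod 𝓘(ℝ, V)) ∞ (fun z : Mt => (h, z)) :=
    contMDiff_const.prodMk contMDiff_id
  exact (h1.comp h2).mdifferentiable (by simp) z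

theorem IsIsotropy.mul {T : FlatReductive E V H Mt k} {g h : H} {A B : V ≃L[ℝ] V}
    (hA : T.IsIsotropy g A) (hB : T.IsIsotropy h B) : T.IsIsotropy (g * h) (A * B) := by
  refine ⟨by rw [mul_smul, hB.1, hA.1], fun v => ?_⟩
  have hc : (fun z : Mt => (g * h) • z) = (fun z : Mt => g • z) ∘ (fun z : Mt => h • z) := by
    ext z
    simp [mul_smul]
  have hh : MDifferentiableAt 𝓘(ℝ, V) 𝓘(ℝ, V) (fun z : Mt => g • z) (h • T.base) :=
    T.mdifferentiableAt_smul g _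
  rw [hc, mfderiv_comp T.base hh (T.mdifferentiableAt_smul h _)]
  have key : ∀ z : Mt, z = T.base → ∀ w : V,
      (mfderiv 𝓘(ℝ, V) 𝓘(ℝ, V) (fun z : Mt => g • z) z w : V)
        = mfderiv 𝓘(ℝ, V) 𝓘(ℝ, V) (fun z : Mt => g • z) T.base w := by
    rintro z rfl w
    rfl
  refine (hA.2 (B v)).trans ?_
  refine ((key _ hB.1 _).symm).trans ?_
  exact congrArg (fun w : V =>
    (mfderiv 𝓘(ℝ, V) 𝓘(ℝ, V) (fun z : Mt => g • z) (h • T.base) w : V)) (hB.2 v)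

theorem IsIsotropy.inv {T : FlatReductive E V H Mt k} {g : H} {A : V ≃L[ℝ] V}
    (hA : T.IsIsotropy g A) : T.IsIsotropy g⁻¹ A⁻¹ := by
  have hb : g⁻¹ • T.base = T.base := by rw [inv_smul_eq_iff, hA.1]
  refine ⟨hb, fun v => ?_⟩
  have hc : (fun z : Mt => z) = (fun z : Mt => g⁻¹ • z) ∘ (fun z : Mt => g • z) := by
    ext z
    simp
  have h1 := mfderiv_comp T.base (T.mdifferentiableAt_smul g⁻¹ (g • T.base))
    (T.mdifferentiableAt_smul g T.base)
  rw [← hc] at h1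
  have key : ∀ z : Mt, z = T.base → ∀ w : V,
      (mfderiv 𝓘(ℝ, V) 𝓘(ℝ, V) (fun z : Mt => g⁻¹ • z) z w : V)
        = mfderiv 𝓘(ℝ, V) 𝓘(ℝ, V) (fun z : Mt => g⁻¹ • z) T.base w := by
    rintro z rfl w
    rfl
  have h2 : (T.frame (A⁻¹ v) : V) = mfderiv 𝓘(ℝ, V) 𝓘(ℝ, V) (fun z : Mt => g⁻¹ • z) (g • T.base)
      (mfderiv 𝓘(ℝ, V) 𝓘(ℝ, V) (fun z : Mt => g • z) T.base (T.frame (A⁻¹ v))) := by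
    have h3 := congrArg (fun f => (f (T.frame (A⁻¹ v)) : V)) h1
    rw [show mfderiv 𝓘(ℝ, V) 𝓘(ℝ, V) (fun z : Mt => z) T.base = ContinuousLinearMap.id ℝ _ from
      mfderiv_id] at h3
    exact h3
  have h4 : A (A⁻¹ v) = v := A.apply_symm_apply v
  have h5 := hA.2 (A⁻¹ v)
  rw [h4] at h5
  refine h2.trans ((key _ hA.1 _).trans ?_)
  exact congrArg (fun w : V =>
    (mfderiv 𝓘(ℝ, V) 𝓘(ℝ, V) (fun z : Mt => g⁻¹ • z) T.base w : V)) h5.symm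

/-- The structure group `G̃ ⊂ GL_d(ℝ)` of `P̃`, formed by the `A` with `u_o ∘ A ∈ P̃`. -/
def structureGroup : Subgroup (V ≃L[ℝ] V) where
  carrier := {A | A.trans T.frame ∈ T.frames T.base}
  mul_mem' := fun ⟨g, hg⟩ ⟨h, hh⟩ => ⟨g * h, IsIsotropy.mul hg hh⟩
  one_mem' := ⟨1, IsIsotropy.one T⟩
  inv_mem' := fun ⟨g, hg⟩ => ⟨g⁻¹, IsIsotropy.inv hg⟩

end FlatReductive

section UpperLeft

variable {V : Type*} [NormedAddCommGroup V] [NormedSpace ℝ V]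
  {W : Type*} [NormedAddCommGroup W] [NormedSpace ℝ W]

/-- `A = (B *; 0 *)`: the matrix `A` preserves `W`, and `B` is its upper left `n × n` block. -/
def IsUpperLeft (j : W →ₗ[ℝ] V) (A : V ≃L[ℝ] V) (B : W ≃L[ℝ] W) : Prop :=
  ∀ w, A (j w) = j (B w)

theorem IsUpperLeft.inv {j : W →ₗ[ℝ] V} {A : V ≃L[ℝ] V} {B : W ≃L[ℝ] W}
    (h : IsUpperLeft j A B) : IsUpperLeft j A⁻¹ B⁻¹ := by
  intro w
  have h1 := h (B⁻¹ w)
  rw [show B (B⁻¹ w) = w from B.apply_symm_apply w] at h1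
  rw [← h1]
  exact A.symm_apply_apply _

theorem IsUpperLeft.mul {j : W →ₗ[ℝ] V} {A A' : V ≃L[ℝ] V} {B B' : W ≃L[ℝ] W}
    (h : IsUpperLeft j A B) (h' : IsUpperLeft j A' B') : IsUpperLeft j (A * A') (B * B') := by
  intro w
  change A (A' (j w)) = j (B (B' w))
  rw [h' w, h]

end UpperLeft

namespace FlatReductive

variable {E : Type*} [NormedAddCommGroup E] [NormedSpace ℝ E] [CompleteSpace E]
  {V : Type*} [NormedAddCommGroup V] [NormedSpace ℝ V]
  {W : Type*} [NormedAddCommGroup W] [NormedSpace ℝ W]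
  {H : Type*} [TopologicalSpace H] [ChartedSpace E H] [Group H]
  [LieGroup 𝓘(ℝ, E) ∞ H]
  {Mt : Type*} [TopologicalSpace Mt] [ChartedSpace V Mt] [MulAction H Mt] {k : ℕ}

section

variable [ContMDiffSMul 𝓘(ℝ, E) 𝓘(ℝ, V) ∞ H Mt] (T : FlatReductive E V H Mt k)
  (j : W →ₗ[ℝ] V)

/-- The subgroup `G_♯ ⊂ G̃` of the matrices of `G̃` which preserve `W`. -/
def sharpGroup : Subgroup (V ≃L[ℝ] V) where
  carrier := {A | A ∈ T.structureGroup ∧ ∃ B, IsUpperLeft j A B}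
  mul_mem' := fun ⟨h, B, hB⟩ ⟨h', B', hB'⟩ => ⟨mul_mem h h', B * B', hB.mul hB'⟩
  one_mem' := ⟨one_mem _, 1, fun _ => rfl⟩
  inv_mem' := fun ⟨h, B, hB⟩ => ⟨inv_mem h, B⁻¹, hB.inv⟩

/-- The group `G ≃ G_♯ / N_♯` of the upper left blocks of the elements of `G_♯`. -/
def inducedGroup : Subgroup (W ≃L[ℝ] W) where
  carrier := {B | ∃ A ∈ T.sharpGroup j, IsUpperLeft j A B}
  mul_mem' := fun ⟨A, hA, h⟩ ⟨A', hA', h'⟩ => ⟨A * A', mul_mem hA hA', h.mul h'⟩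
  one_mem' := ⟨1, one_mem _, fun _ => rfl⟩
  inv_mem' := fun ⟨A, hA, h⟩ => ⟨A⁻¹, inv_mem hA, h.inv⟩

end

variable (T : FlatReductive E V H Mt k) (j : W →ₗ[ℝ] V)

/-- The inclusion of `W = ℝⁿ` into `V ≃ gr (-1) ⊂ 𝔥`. -/
def embW : W →ₗ[ℝ] LieAlg E H := T.embV ∘ₗ j

/-- The cohomology group `H^{p,q}(𝔥, W)`. -/
abbrev Coh (p : ℤ) (q : ℕ) : Type _ := Cohomology (T.embW j) T.gr p q

/-- The adjoint action `Ad_g = (d(x ↦ g x g⁻¹))_e` of `H` on `𝔥`. -/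
def adjoint (g : H) : LieAlg E H →ₗ[ℝ] LieAlg E H :=
  (show LieAlg E H →L[ℝ] LieAlg E H from
    mfderiv 𝓘(ℝ, E) 𝓘(ℝ, E) (fun x : H => g * x * g⁻¹) 1).toLinearMap

/-- The action of `g ∈ K` on the graded Lie algebra associated with the filtration of `𝔥` by the
subspaces `∑_{j ≥ i} gr j` (which `Ad_g` preserves). It depends only on the image of `g` in `G̃`,
and so it is an action of `G̃`; on `V ≃ gr (-1)` it is the standard one. -/
def gradedAd (g : H) : LieAlg E H →ₗ[ℝ] LieAlg E H :=
  ∑ i ∈ Finset.Icc (-1 : ℤ) (k - 1),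
    gradedProj T.graded.internal i ∘ₗ adjoint g ∘ₗ gradedProj T.graded.internal i

/-- The action on `𝔥`-valued alternating forms on `W` defined by the action of `g ∈ K` on `𝔥` and
by the action of `B` on `W`: `(g · c)(w₁, …) = g · c(B⁻¹ w₁, …)`. -/
def actCochain {q : ℕ} (g : H) (B : W ≃L[ℝ] W) (c : W [⋀^Fin q]→ₗ[ℝ] LieAlg E H) :
    W [⋀^Fin q]→ₗ[ℝ] LieAlg E H :=
  ((T.gradedAd g).compAlternatingMap c).compLinearMap B.symm.toLinearEquiv.toLinearMap

end FlatReductive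

end Homogeneous

/-! ### `G`-structures -/

section GStructures

/-- `s` is a smooth frame field on the open set `U`. -/
structure IsFrameField {W : Type*} [NormedAddCommGroup W] [NormedSpace ℝ W]
    {M : Type*} [TopologicalSpace M] [ChartedSpace W M]
    [IsManifold 𝓘(ℝ, W) ∞ M] (U : Set M) (s : ∀ x : M, Frame W x) : Prop where
  isOpen : IsOpen U
  smooth : ∀ v : W, ContMDiffOn 𝓘(ℝ, W) 𝓘(ℝ, W).tangent ∞
    (fun x => (⟨x, s x v⟩ : TangentBundle 𝓘(ℝ, W) M)) U

/-- A `G`-structure on `M`: a reduction of the frame bundle of `M` to the group `G ⊂ GL_n(ℝ)`. -/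
structure GStructure {W : Type*} [NormedAddCommGroup W] [NormedSpace ℝ W]
    (G : Subgroup (W ≃L[ℝ] W))
    (M : Type*) [TopologicalSpace M] [ChartedSpace W M] [IsManifold 𝓘(ℝ, W) ∞ M] where
  /-- the fibre over `x` -/
  frames : ∀ x : M, Set (Frame W x)
  /-- the fibre is an orbit of `G` -/
  mem_iff : ∀ (x : M) (u v : Frame W x), u ∈ frames x → (v ∈ frames x ↔ ∃ g ∈ G, v = g.trans u)
  /-- there are smooth local sections -/
  exists_section : ∀ x : M, ∃ (U : Set M) (s : ∀ x : M, Frame W x),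
    x ∈ U ∧ IsFrameField U s ∧ ∀ y ∈ U, s y ∈ frames y

variable {E : Type*} [NormedAddCommGroup E] [NormedSpace ℝ E] [CompleteSpace E]
  {V : Type*} [NormedAddCommGroup V] [NormedSpace ℝ V]
  {W : Type*} [NormedAddCommGroup W] [NormedSpace ℝ W] [FiniteDimensional ℝ W] {k : ℕ}
  {H : Type*} [TopologicalSpace H] [ChartedSpace E H] [Group H]
  [LieGroup 𝓘(ℝ, E) ∞ H]
  {Mt : Type*} [TopologicalSpace Mt] [ChartedSpace V Mt] [MulAction H Mt]
  {M : Type*} [TopologicalSpace M] [ChartedSpace W M] [IsManifold 𝓘(ℝ, W) ∞ M]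

/-- The right action `u ↦ u · g` of `G` on the frames of a `G`-structure. -/
def GStructure.act {G : Subgroup (W ≃L[ℝ] W)} (P : GStructure G M) {x : M}
    (u : P.frames x) (g : G) : P.frames x :=
  ⟨(g : W ≃L[ℝ] W).trans u.1, (P.mem_iff x u.1 _ u.2).2 ⟨g, g.2, rfl⟩⟩

/-- `𝔥`-valued `1`-forms on `M`. -/
abbrev LForm (E : Type*) [NormedAddCommGroup E] [NormedSpace ℝ E]
    (W : Type*) [NormedAddCommGroup W] [NormedSpace ℝ W] (H : Type*) [TopologicalSpace H] [ChartedSpace E H] [Group H]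
    (M : Type*) [TopologicalSpace M] [ChartedSpace W M] : Type _ :=
  ∀ x : M, TangentSpace 𝓘(ℝ, W) x →L[ℝ] LieAlg E H

/-- Smoothness of an `𝔥`-valued `1`-form on `U`. -/
def LForm.IsSmoothOn (θ : LForm E W H M) (U : Set M) : Prop :=
  IsSmoothForm U (fun x => (LieAlg.toModel E H).toContinuousLinearMap.comp (θ x))

/-- The exterior derivative of an `𝔥`-valued `1`-form. -/
def LForm.d (θ : LForm E W H M) (x : M) : TangentSpace 𝓘(ℝ, W) x [⋀^Fin 2]→ₗ[ℝ] LieAlg E H :=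
  (LieAlg.toModel E H).symm.toLinearEquiv.toLinearMap.compAlternatingMap
    (extDer (fun x => (LieAlg.toModel E H).toContinuousLinearMap.comp (θ x)) x)

/-- The bracket `[θ, θ'](v, w) = [θ v, θ' w] - [θ w, θ' v]` of `𝔥`-valued `1`-forms. -/
def LForm.bracket (θ θ' : LForm E W H M) (x : M) :
    TangentSpace 𝓘(ℝ, W) x [⋀^Fin 2]→ₗ[ℝ] LieAlg E H :=
  skewBracket (θ x).toLinearMap (θ' x).toLinearMap

namespace FlatReductive

variable (T : FlatReductive E V H Mt k) (j : W →ₗ[ℝ] V)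

/-- The form `ω^{-1} = (s^*ϑ^1, …, s^*ϑ^n, 0, …, 0)` of a frame field `s`, where `ϑ` is the
soldering form, so that `s^*ϑ` at `x` is the inverse `T_x M → ℝⁿ` of the frame `s x`. -/
def soldering (s : ∀ x : M, Frame W x) : LForm E W H M :=
  fun x => (LinearMap.toContinuousLinearMap (T.embW j)).comp (s x).symm.toContinuousLinearMap

/-- The forms of a tuple `(s, ω^0, ω^1, …)`, with the degree shifted by `1`: this is `ω^{j-1}`. -/
def form (s : ∀ x : M, Frame W x) (η : ℕ → LForm E W H M) : ℕ → LForm E W H M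
  | 0 => T.soldering j s
  | r + 1 => η r

/-- The total curvature of order `p + 1`,
`Ω^{p-1} = dω^{p-1} + ½ ∑_{r=0}^{p-1} [ω^r, ω^{p-1-r}] + ½ [ω^{-1}, ω^{-1}]^{gr (p-1)}`,
of a tuple `(s, ω^0, …, ω^{p-1})`, where `ω^r = η r`. -/
def curvature (s : ∀ x : M, Frame W x) (η : ℕ → LForm E W H M) (p : ℕ) (x : M) :
    TangentSpace 𝓘(ℝ, W) x [⋀^Fin 2]→ₗ[ℝ] LieAlg E H :=
  (T.form j s η p).d x
    + (1 / 2 : ℝ) • ∑ r ∈ Finset.range p, (η r).bracket (η (p - 1 - r)) x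
    + (1 / 2 : ℝ) • (gradedProj T.graded.internal ((p : ℤ) - 1)).compAlternatingMap
        ((T.soldering j s).bracket (T.soldering j s) x)

/-- The value at `x` of the total curvature as a `2`-form on `W`, by means of the frame `s x`. -/
def curvatureW (s : ∀ x : M, Frame W x) (η : ℕ → LForm E W H M) (p : ℕ) (x : M) :
    W [⋀^Fin 2]→ₗ[ℝ] LieAlg E H :=
  (T.curvature j s η p x).compLinearMap (s x).toLinearEquiv.toLinearMap

/-- `(s, ω^0, …, ω^{p-1})`, where `ω^r = η r`, is an admissible tuple on `U`. (The values of `s`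
outside `U` and the forms `η r` with `p ≤ r` play no role.) -/
structure IsAdmissible {G : Subgroup (W ≃L[ℝ] W)} (P : GStructure G M) (p : ℕ)
    (U : Set M) (s : ∀ x : M, Frame W x) (η : ℕ → LForm E W H M) : Prop where
  frameField : IsFrameField U s
  mem : ∀ x ∈ U, s x ∈ P.frames x
  smooth : ∀ r < p, (η r).IsSmoothOn U
  mem_gr : ∀ r < p, ∀ x ∈ U, ∀ v, η r x v ∈ T.gr r
  /-- `Ω^{r-1} = -[ω^{-1}, ω^r]` for `0 ≤ r ≤ p - 1` -/
  eqn : ∀ r < p, ∀ x ∈ U, T.curvature j s η r x = -((T.soldering j s).bracket (η r) x)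

/-- `P` is locally immersible to order `p`. -/
def ImmersibleToOrder {G : Subgroup (W ≃L[ℝ] W)} (P : GStructure G M) (p : ℕ) : Prop :=
  ∀ x : M, ∃ (U : Set M) (s : ∀ x : M, Frame W x) (η : ℕ → LForm E W H M),
    x ∈ U ∧ T.IsAdmissible j P p U s η

end FlatReductive

end GStructures

end Immersible

end

/-!
Write `𝔥^i` for the summand `gr i` of the Lie algebra `𝔥` of `H`. The sum
`ω = ω^{-1} + ω^0 + ω^1` of the forms of a tuple is a `1`-form with values in `𝔥`, and the
component of degree `r - 1` of its curvature `dω + ½[ω, ω]` is `Ω^{r-1} + [ω^{-1}, ω^r]`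
(`IsFormTuple.pr_curv`). So the tuple `(s, ω^0, …, ω^{p-1})` is admissible if and only if the
curvature vanishes in degrees `< p - 1`, and `Ω^{p-1}` is its lowest remaining component. The lowest
component of the Bianchi identity (`SpencerData.bianchi`) says that `Ω^{p-1}` is a cocycle
(`curvatureW_mem_cocycles`).

*Independence of the tuple.* The transition function `B` between two frame fields of `P` through the
same frame has values in `G`. Its logarithmic derivative takes values in the restrictions to `W` of
`ad X`, `X ∈ 𝔥^0` (`mem_inner_of_curve`). This needs an argument, as the elements of the isotropy
group over `B` need not depend continuously on the point, and `G` need not be closed. But `H` is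
second countable, so that an arbitrary choice of such elements along a curve has accumulation points
in any interval; at these, the derivative is the limit of difference quotients in the orbit of a
frame under `H`, an orbit map has constant rank, and such limits are therefore tangent to the orbit
(`mem_range_of_constant_rank`). It follows that `B` is the restriction to `W` of `exp (ad b)`, where
`b` is a smooth function with values in `𝔥^0` (`exists_gauge`), and the gauge transformation
`exp (-ad b)` reduces the problem to the case of two tuples with the same `ω^{-1}`. Gauge
transformations act on curvatures pointwise (`curv_gauge`).

If two forms agree in degrees `< p`, then the difference of their curvatures in degree `p - 1` is
the coboundary of the difference of their components of degree `p`. For `p = 0` this is the claim.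
For `p = 1`, the difference of the components of degree `0` is a cocycle, since both curvatures
vanish in degree `-1`; as `H^{1,1} = 0`, it is removed by a gauge transformation `exp (-ad b)` with
values of `b` in `𝔥^1` (`exists_gauge_one`). For `p = 2`, the components of degree `1` then differ
by a cocycle too, and agree because `H^{2,1} = 0` (`curv_class_zero`, `curv_class_one`,
`curv_class_two`).

The same vanishing conditions imply that `ad` is injective in degrees `≥ 0`, even after restriction
to `W` (`eq_zero_of_mem_zero`, `eq_zero_of_mem_one`), as soon as `W ≠ 0`. It is used for the
Maurer-Cartan form of a gauge transformation, and to show that the isotropy group acts on the graded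
algebra by automorphisms (`gradedAd_lie`), i.e. that the adjoint action of the isotropy group preserves
`𝔥^1`.

*Equivariance.* An element of the isotropy group over `A ∈ G_♯` maps admissible tuples to admissible
tuples, and transforms the curvature by its action on cochains (`IsAdmissible.trans`,
`curvatureW_trans`). This also moves a tuple to an arbitrary frame of `P` (`exists_isAdmissible`).

*The obstruction.* If `ω^p` extends an admissible tuple, then `Ω^{p-1} = -[ω^{-1}, ω^p]` is a
coboundary (`curvatureW_mem_coboundaries`). Conversely, the Spencer operator has a linear section
over its range, so that pointwise primitives of `Ω^{p-1}` may be chosen to be smooth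
(`IsAdmissible.exists_succ`).

If `W = 0`, then there are no nonzero `2`-forms, and the assertions are trivial.
-/

noncomputable section

open Filter Topology

namespace Immersible

/-! ### Smooth germs -/

/-- `f` is smooth on a neighbourhood of `x`. (`ContDiffAt ℝ ∞ f x` only provides, for each finite
order, a neighbourhood on which `f` is differentiable to that order.) -/
def SmoothNear {X Y : Type*} [NormedAddCommGroup X] [NormedSpace ℝ X] [NormedAddCommGroup Y]
    [NormedSpace ℝ Y] (f : X → Y) (x : X) : Prop :=
  ∀ᶠ z in 𝓝 x, ContDiffAt ℝ ∞ f z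

section SmoothNear

variable {X Y Z Y' : Type*} [NormedAddCommGroup X] [NormedSpace ℝ X] [NormedAddCommGroup Y]
    [NormedSpace ℝ Y] [NormedAddCommGroup Z] [NormedSpace ℝ Z] [NormedAddCommGroup Y']
    [NormedSpace ℝ Y'] {f g : X → Y} {x : X}

theorem SmoothNear.eventually (h : SmoothNear f x) : ∀ᶠ z in 𝓝 x, SmoothNear f z :=
  eventually_eventually_nhds.2 h

theorem SmoothNear.contDiffAt (h : SmoothNear f x) : ContDiffAt ℝ ∞ f x := h.self_of_nhds

theorem SmoothNear.differentiableAt (h : SmoothNear f x) : DifferentiableAt ℝ f x :=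
  h.contDiffAt.differentiableAt (by simp)

theorem smoothNear_const (c : Y) : SmoothNear (fun _ : X => c) x :=
  Eventually.of_forall fun _ => contDiffAt_const

theorem smoothNear_of_contDiff (h : ContDiff ℝ ∞ f) : SmoothNear f x :=
  Eventually.of_forall fun _ => h.contDiffAt

theorem SmoothNear.add (hf : SmoothNear f x) (hg : SmoothNear g x) :
    SmoothNear (fun z => f z + g z) x := by
  filter_upwards [hf, hg] with z h1 h2 using h1.add h2

theorem SmoothNear.sub (hf : SmoothNear f x) (hg : SmoothNear g x) :
    SmoothNear (fun z => f z - g z) x := by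
  filter_upwards [hf, hg] with z h1 h2 using h1.sub h2

theorem SmoothNear.neg (hf : SmoothNear f x) :
    SmoothNear (fun z => -f z) x := by
  filter_upwards [hf] with z h1 using h1.neg

theorem SmoothNear.prodMk {g : X → Z} (hf : SmoothNear f x) (hg : SmoothNear g x) :
    SmoothNear (fun z => (f z, g z)) x := by
  filter_upwards [hf, hg] with z h1 h2 using h1.prodMk h2

theorem SmoothNear.comp {g : Y → Z} (hg : SmoothNear g (f x)) (hf : SmoothNear f x) :
    SmoothNear (fun z => g (f z)) x := by
  have hc : ContinuousAt f x := hf.contDiffAt.continuousAt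
  filter_upwards [hf, hc.eventually hg] with z h1 h2 using h2.comp z h1

theorem SmoothNear.congr (hf : SmoothNear f x) (h : g =ᶠ[𝓝 x] f) : SmoothNear g x := by
  filter_upwards [hf, eventually_eventually_nhds.2 h] with z h1 h2
  exact h1.congr_of_eventuallyEq h2

theorem SmoothNear.fderiv (hf : SmoothNear f x) : SmoothNear (fderiv ℝ f) x := by
  filter_upwards [hf] with z h1 using h1.fderiv_right (by simp)

theorem SmoothNear.clm_apply {f : X → Y →L[ℝ] Z} {g : X → Y} (hf : SmoothNear f x)
    (hg : SmoothNear g x) : SmoothNear (fun z => f z (g z)) x := by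
  filter_upwards [hf, hg] with z h1 h2 using h1.clm_apply h2

theorem SmoothNear.clm_comp {f : X → Y →L[ℝ] Z} {g : X → Y' →L[ℝ] Y} (hf : SmoothNear f x)
    (hg : SmoothNear g x) : SmoothNear (fun z => (f z).comp (g z)) x := by
  filter_upwards [hf, hg] with z h1 h2 using h1.clm_comp h2

theorem SmoothNear.clm (L : Y →L[ℝ] Z) (hf : SmoothNear f x) :
    SmoothNear (fun z => L (f z)) x := by
  filter_upwards [hf] with z h1 using L.contDiff.contDiffAt.comp z h1

/-- A linear constraint on a function near `x` passes to its derivative. -/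
theorem clm_fderiv_eq_zero (L : Y →L[ℝ] Z) (hf : DifferentiableAt ℝ f x)
    (h : ∀ᶠ z in 𝓝 x, L (f z) = 0) (v : X) : L (_root_.fderiv ℝ f x v) = 0 := by
  have h1 : HasFDerivAt (fun z => L (f z)) (L.comp (_root_.fderiv ℝ f x)) x :=
    L.hasFDerivAt.comp x hf.hasFDerivAt
  have h2 : HasFDerivAt (fun z => L (f z)) (0 : X →L[ℝ] Z) x :=
    (hasFDerivAt_const (0 : Z) x).congr_of_eventuallyEq h
  exact DFunLike.congr_fun (h1.unique h2) v

theorem fderiv_fderiv_comm (hf : ContDiffAt ℝ ∞ f x) (u v : X) :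
    _root_.fderiv ℝ (_root_.fderiv ℝ f) x u v = _root_.fderiv ℝ (_root_.fderiv ℝ f) x v u :=
  (hf.isSymmSndFDerivAt (by
    rw [minSmoothness_of_isRCLikeNormedField]
    exact WithTop.coe_le_coe.2 (le_top : (2 : ℕ∞) ≤ ⊤))).eq u v

end SmoothNear

/-! ### Graded brackets on normed spaces -/

/-- A graded Lie algebra `E = gr (-1) ⊕ gr 0 ⊕ gr 1` in a normed space, with bracket `br` and
projections `pr`, together with a subspace `j : W → gr (-1)` for which the cohomology groups
`H^{1,1}` and `H^{2,1}` vanish. (As `gr 2 = 0`, there are no coboundaries in `C^{2,1}`.) -/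
structure SpencerData (E W : Type*) [NormedAddCommGroup E] [NormedSpace ℝ E]
    [NormedAddCommGroup W] [NormedSpace ℝ W] where
  br : E →L[ℝ] E →L[ℝ] E
  gr : ℤ → Submodule ℝ E
  pr : ℤ → E →L[ℝ] E
  j : W →L[ℝ] E
  br_self : ∀ x, br x x = 0
  jacobi : ∀ x y z, br x (br y z) = br (br x y) z + br y (br x z)
  pr_mem : ∀ i x, pr i x ∈ gr i
  pr_of_mem : ∀ i x, x ∈ gr i → pr i x = x
  pr_of_mem_ne : ∀ i k x, i ≠ k → x ∈ gr k → pr i x = 0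
  sum_pr : ∀ x, x = pr (-1) x + pr 0 x + pr 1 x
  br_mem : ∀ i k x y, x ∈ gr i → y ∈ gr k → br x y ∈ gr (i + k)
  gr_eq_bot : ∀ i, i < -1 ∨ 1 < i → gr i = ⊥
  j_mem : ∀ w, j w ∈ gr (-1)
  j_inj : Function.Injective j
  H11 : ∀ c : W →L[ℝ] E, (∀ w, c w ∈ gr 0) → (∀ v w, br (c v) (j w) = br (c w) (j v)) →
    ∃ X ∈ gr 1, ∀ w, c w = br X (j w)
  H21 : ∀ c : W →L[ℝ] E, (∀ w, c w ∈ gr 1) → (∀ v w, br (c v) (j w) = br (c w) (j v)) →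
    c = 0

namespace SpencerData

variable {E W : Type*} [NormedAddCommGroup E] [NormedSpace ℝ E]
    [NormedAddCommGroup W] [NormedSpace ℝ W] (S : SpencerData E W)

theorem br_comm (x y : E) : S.br x y = -S.br y x := by
  have h := S.br_self (x + y)
  simp only [map_add, _root_.add_apply, S.br_self, zero_add, add_zero] at h
  rw [eq_neg_iff_add_eq_zero, add_comm]
  exact h

theorem br_eq_zero {i k : ℤ} (h : i + k < -1 ∨ 1 < i + k) {x y : E} (hx : x ∈ S.gr i)
    (hy : y ∈ S.gr k) : S.br x y = 0 := by
  have := S.br_mem i k x y hx hy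
  rwa [S.gr_eq_bot _ h, Submodule.mem_bot] at this

theorem pr_br_pr (i k l : ℤ) (x y : E) :
    S.pr i (S.br (S.pr k x) (S.pr l y)) = if k + l = i then S.br (S.pr k x) (S.pr l y) else 0 := by
  have h := S.br_mem k l _ _ (S.pr_mem k x) (S.pr_mem l y)
  split_ifs with hi
  · exact S.pr_of_mem _ _ (hi ▸ h)
  · exact S.pr_of_mem_ne _ _ _ (Ne.symm hi) h

theorem br_eq_sum (x y : E) : S.br x y =
    S.br (S.pr (-1) x + S.pr 0 x + S.pr 1 x) (S.pr (-1) y + S.pr 0 y + S.pr 1 y) := by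
  rw [← S.sum_pr, ← S.sum_pr]

theorem pr_br_neg (x y : E) :
    S.pr (-1) (S.br x y) = S.br (S.pr (-1) x) (S.pr 0 y) + S.br (S.pr 0 x) (S.pr (-1) y) := by
  rw [S.br_eq_sum]
  simp only [map_add, _root_.add_apply, pr_br_pr]
  norm_num [add_comm]

theorem pr_br_zero (x y : E) :
    S.pr 0 (S.br x y) = S.br (S.pr (-1) x) (S.pr 1 y) + S.br (S.pr 0 x) (S.pr 0 y)
      + S.br (S.pr 1 x) (S.pr (-1) y) := by
  rw [S.br_eq_sum]
  simp only [map_add, _root_.add_apply, pr_br_pr]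
  norm_num
  abel

theorem pr_br_one (x y : E) :
    S.pr 1 (S.br x y) = S.br (S.pr 0 x) (S.pr 1 y) + S.br (S.pr 1 x) (S.pr 0 y) := by
  rw [S.br_eq_sum]
  simp only [map_add, _root_.add_apply, pr_br_pr]
  norm_num [add_comm]

theorem ext_pr {x y : E} (h1 : S.pr (-1) x = S.pr (-1) y) (h2 : S.pr 0 x = S.pr 0 y)
    (h3 : S.pr 1 x = S.pr 1 y) : x = y := by
  rw [S.sum_pr x, S.sum_pr y, h1, h2, h3]

/-- The value `dη(v, w) + [η(v), η(w)]` of the curvature `dη + ½[η, η]` of an `E`-valued form. -/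
def curv (η : W → W →L[ℝ] E) (y v w : W) : E :=
  fderiv ℝ η y v w - fderiv ℝ η y w v + S.br (η y v) (η y w)

theorem curv_congr {η η' : W → W →L[ℝ] E} {y : W} (h : η =ᶠ[𝓝 y] η') (v w : W) :
    S.curv η y v w = S.curv η' y v w := by
  simp only [curv, h.fderiv_eq, h.self_of_nhds]

theorem fderiv_br_apply {a b : W → W →L[ℝ] E} {y : W} (ha : DifferentiableAt ℝ a y)
    (hb : DifferentiableAt ℝ b y) (u v w : W) :
    fderiv ℝ (fun z => S.br (a z v) (b z w)) y u
      = S.br (fderiv ℝ a y u v) (b y w) + S.br (a y v) (fderiv ℝ b y u w) := by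
  have h1 : HasFDerivAt (fun z => a z v) ((fderiv ℝ a y).flip v) y := by
    simpa using ha.hasFDerivAt.clm_apply (hasFDerivAt_const v y)
  have h2 : HasFDerivAt (fun z => b z w) ((fderiv ℝ b y).flip w) y := by
    simpa using hb.hasFDerivAt.clm_apply (hasFDerivAt_const w y)
  have h3 := ((S.br.hasFDerivAt.comp y h1).clm_apply h2).fderiv
  simp only [Function.comp_def] at h3
  rw [h3]
  simp [add_comm]

theorem smoothNear_curv {η : W → W →L[ℝ] E} {y : W} (h : SmoothNear η y) (v w : W) :
    SmoothNear (fun z => S.curv η z v w) y := by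
  have h1 := h.fderiv
  refine ((((h1.clm_apply (smoothNear_const v)).clm_apply (smoothNear_const w))).sub
    (((h1.clm_apply (smoothNear_const w)).clm_apply (smoothNear_const v)))).add
    (((h.clm_apply (smoothNear_const v)).clm S.br).clm_apply (h.clm_apply (smoothNear_const w)))

/-- The Bianchi identity. -/
theorem bianchi {η : W → W →L[ℝ] E} {y : W} (h : SmoothNear η y) (u v w : W) :
    (fderiv ℝ (fun z => S.curv η z v w) y u + S.br (η y u) (S.curv η y v w))
    + (fderiv ℝ (fun z => S.curv η z w u) y v + S.br (η y v) (S.curv η y w u))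
    + (fderiv ℝ (fun z => S.curv η z u v) y w + S.br (η y w) (S.curv η y u v)) = 0 := by
  have key : ∀ u v w : W, fderiv ℝ (fun z => S.curv η z v w) y u
      = fderiv ℝ (fderiv ℝ η) y u v w - fderiv ℝ (fderiv ℝ η) y u w v
        + (S.br (fderiv ℝ η y u v) (η y w) + S.br (η y v) (fderiv ℝ η y u w)) := by
    intro u v w
    have hd : DifferentiableAt ℝ (fderiv ℝ η) y := h.fderiv.differentiableAt
    have hdd : ∀ v w : W, HasFDerivAt (fun z => fderiv ℝ η z v w)
        (((fderiv ℝ (fderiv ℝ η) y).flip v).flip w) y := fun v w => by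
      have h1 : HasFDerivAt (fun z => fderiv ℝ η z v) ((fderiv ℝ (fderiv ℝ η) y).flip v) y := by
        simpa using hd.hasFDerivAt.clm_apply (hasFDerivAt_const v y)
      simpa using h1.clm_apply (hasFDerivAt_const w y)
    have hbr : DifferentiableAt ℝ (fun z => S.br (η z v) (η z w)) y :=
      (((h.clm_apply (smoothNear_const v)).clm S.br).clm_apply
        (h.clm_apply (smoothNear_const w))).differentiableAt
    have := (((hdd v w).sub (hdd w v)).add hbr.hasFDerivAt).fderiv
    rw [show (fun z => S.curv η z v w) = (fun z => fderiv ℝ η z v w - fderiv ℝ η z w v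
      + S.br (η z v) (η z w)) from rfl]
    erw [this]
    rw [_root_.add_apply, S.fderiv_br_apply h.differentiableAt h.differentiableAt]
    simp
  rw [key, key, key]
  simp only [curv, map_add, map_sub]
  rw [fderiv_fderiv_comm h.contDiffAt v u, fderiv_fderiv_comm h.contDiffAt w u,
    fderiv_fderiv_comm h.contDiffAt w v, S.jacobi (η y u) (η y v) (η y w),
    S.br_comm (S.br (η y u) (η y v)) (η y w), S.br_comm (η y w) (η y u)]
  simp only [S.br_comm (fderiv ℝ η y _ _) (η y _), map_neg]
  abel

variable [Nontrivial W]

/-- An element of degree `1` which centralizes `W` vanishes: for `0 ≠ l ∈ W^*` the cochain `l ⊗ X`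
is a cocycle of `C^{2,1}`. -/
theorem eq_zero_of_mem_one {X : E} (hX : X ∈ S.gr 1) (h : ∀ w, S.br X (S.j w) = 0) : X = 0 := by
  obtain ⟨w, hw⟩ := exists_ne (0 : W)
  obtain ⟨l, -, hl⟩ := exists_dual_vector ℝ w (by simpa using hw)
  have := S.H21 (l.smulRight X) (fun v => (S.gr 1).smul_mem _ hX) (fun v w => by simp [h])
  have h2 := DFunLike.congr_fun this w
  simp only [ContinuousLinearMap.smulRight_apply, _root_.zero_apply, smul_eq_zero] at h2
  rcases h2 with h2 | h2
  · rw [hl] at h2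
    simp at h2
    exact absurd h2 hw
  · exact h2

/-- An element of degree `0` which centralizes `W` vanishes: for `0 ≠ l ∈ W^*` the cocycle `l ⊗ X`
of `C^{1,1}` is `w ↦ [Y, w]` for some `Y` of degree `1`, whence `l ⊗ Y` is a cocycle of
`C^{2,1}`. -/
theorem eq_zero_of_mem_zero {X : E} (hX : X ∈ S.gr 0) (h : ∀ w, S.br X (S.j w) = 0) : X = 0 := by
  obtain ⟨w, hw⟩ := exists_ne (0 : W)
  obtain ⟨l, -, hl⟩ := exists_dual_vector ℝ w (by simpa using hw)
  have hlw : l w ≠ 0 := by rw [hl]; simpa using hw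
  obtain ⟨Y, hY, hc⟩ := S.H11 (l.smulRight X) (fun v => (S.gr 0).smul_mem _ hX)
    (fun v w => by simp [h])
  have := S.H21 (l.smulRight Y) (fun v => (S.gr 1).smul_mem _ hY) (fun v w => by
    simp only [ContinuousLinearMap.smulRight_apply, map_smul, _root_.smul_apply,
      ← hc]
    rw [smul_comm])
  have h2 := DFunLike.congr_fun this w
  simp only [ContinuousLinearMap.smulRight_apply, _root_.zero_apply, smul_eq_zero,
    hlw, false_or] at h2
  have h3 := hc w
  simpa [h2, hlw] using h3

/-- The adjoint representation is faithful in degrees `≥ 0`. Hence a form `μ` with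
values in these degrees is determined by `ad μ`. -/
theorem ad_injective {X : E} (hX : S.pr (-1) X = 0) (h : ∀ x, S.br X x = 0) : X = 0 := by
  have h0 : S.pr 0 X = 0 := S.eq_zero_of_mem_zero (S.pr_mem _ _) fun w => by
    have := S.pr_br_neg X (S.j w)
    rw [h, hX, S.pr_of_mem _ _ (S.j_mem w)] at this
    simpa using this.symm
  have h1 : X = S.pr 1 X := by
    conv_lhs => rw [S.sum_pr X, hX, h0]
    simp
  exact S.eq_zero_of_mem_one (h1 ▸ S.pr_mem _ _) fun w => h _

/-- The effect of a gauge transformation on the curvature. The automorphism `Φ z` of the Lie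
algebra depends on the point `z`, and `μ` is its Maurer-Cartan form; the Maurer-Cartan equation
`dμ + ½[μ, μ] = 0` follows from the symmetry of the second derivative of `Φ`, since `ad` is
injective in degrees `≥ 0`. -/
theorem curv_gauge {η μ : W → W →L[ℝ] E} {Φ : W → E →L[ℝ] E} {y : W}
    (hη : DifferentiableAt ℝ η y) (hμ : DifferentiableAt ℝ μ y) (hΦ : SmoothNear Φ y)
    (hbr : ∀ a b, Φ y (S.br a b) = S.br (Φ y a) (Φ y b))
    (hsurj : Function.Surjective (Φ y))
    (hdeg : ∀ᶠ z in 𝓝 y, ∀ v, S.pr (-1) (μ z v) = 0)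
    (hd : ∀ᶠ z in 𝓝 y, ∀ v, fderiv ℝ Φ z v = -(S.br (μ z v)).comp (Φ z)) (v w : W) :
    S.curv (fun z => (Φ z).comp (η z) + μ z) y v w = Φ y (S.curv η y v w) := by
  have hΦd : DifferentiableAt ℝ Φ y := hΦ.differentiableAt
  have hdy := hd.self_of_nhds
  have hdegy := hdeg.self_of_nhds
  -- the Maurer-Cartan equation
  have hΦ2 : ∀ u v : W, fderiv ℝ (fderiv ℝ Φ) y u v
      = -((S.br (fderiv ℝ μ y u v)).comp (Φ y))
        + (S.br (μ y v)).comp ((S.br (μ y u)).comp (Φ y)) := by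
    intro u v
    have h1 : HasFDerivAt (fun z => fderiv ℝ Φ z v) ((fderiv ℝ (fderiv ℝ Φ) y).flip v) y := by
      simpa using hΦ.fderiv.differentiableAt.hasFDerivAt.clm_apply (hasFDerivAt_const v y)
    have h2 : HasFDerivAt (fun z => μ z v) ((fderiv ℝ μ y).flip v) y := by
      simpa using hμ.hasFDerivAt.clm_apply (hasFDerivAt_const v y)
    have h3 := (((S.br.hasFDerivAt.comp y h2).clm_comp hΦd.hasFDerivAt).neg).congr_of_eventuallyEq
      (show (fun z => fderiv ℝ Φ z v) =ᶠ[𝓝 y] _ from hd.mono fun z hz => hz v)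
    have h4 := DFunLike.congr_fun (h1.unique h3) u
    simp only [ContinuousLinearMap.flip_apply] at h4
    rw [h4]
    ext x
    simp [hdy]
  have hMC : fderiv ℝ μ y v w - fderiv ℝ μ y w v + S.br (μ y v) (μ y w) = 0 := by
    refine S.ad_injective ?_ fun x => ?_
    · have h5 : ∀ v w : W, S.pr (-1) (fderiv ℝ μ y v w) = 0 := fun v w => by
        have h2 : HasFDerivAt (fun z => μ z w) ((fderiv ℝ μ y).flip w) y := by
          simpa using hμ.hasFDerivAt.clm_apply (hasFDerivAt_const w y)
        have := clm_fderiv_eq_zero (S.pr (-1)) h2.differentiableAt (hdeg.mono fun z hz => hz w) v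
        rwa [h2.fderiv] at this
      rw [map_add, map_sub, h5, h5, S.pr_br_neg, hdegy, hdegy]
      simp
    · obtain ⟨x, rfl⟩ := hsurj x
      have h6 := fderiv_fderiv_comm hΦ.contDiffAt v w
      rw [hΦ2, hΦ2] at h6
      have h7 := DFunLike.congr_fun h6 x
      simp only [_root_.add_apply, _root_.neg_apply,
        ContinuousLinearMap.comp_apply] at h7
      simp only [map_add, map_sub, _root_.add_apply, _root_.sub_apply]
      rw [S.jacobi (μ y w)] at h7
      rw [S.br_comm (μ y w) (μ y v)] at h7
      simp only [map_neg, _root_.neg_apply] at h7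
      rw [← sub_eq_zero] at h7
      rw [← neg_eq_zero, ← h7]
      abel
  have hder : ∀ v w : W, fderiv ℝ (fun z => (Φ z).comp (η z) + μ z) y v w
      = -S.br (μ y v) (Φ y (η y w)) + Φ y (fderiv ℝ η y v w) + fderiv ℝ μ y v w := by
    intro v w
    have h8 : HasFDerivAt (fun z => (Φ z).comp (η z) + μ z) _ y :=
      (hΦd.hasFDerivAt.clm_comp hη.hasFDerivAt).add hμ.hasFDerivAt
    rw [h8.fderiv]
    simp [hdy, add_comm]
  simp only [curv, hder, map_add, map_sub, hbr, _root_.add_apply,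
    ContinuousLinearMap.comp_apply]
  rw [S.br_comm (Φ y (η y v)) (μ y w)]
  rw [← sub_eq_zero, ← hMC]
  abel

end SpencerData

/-! ### Exponentials of operators -/

section Exp

variable {E : Type*} [NormedAddCommGroup E] [NormedSpace ℝ E]

/-- The exponential of an operator. -/
def expOp (A : E →L[ℝ] E) : E →L[ℝ] E := NormedSpace.exp A

variable [CompleteSpace E]

theorem contDiff_expOp : ContDiff ℝ ω (expOp : (E →L[ℝ] E) → (E →L[ℝ] E)) :=
  contDiff_iff_contDiffAt.2 fun A => (NormedSpace.exp_analytic (𝕂 := ℝ) A).contDiffAt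

omit [CompleteSpace E] in
theorem expOp_zero : expOp (0 : E →L[ℝ] E) = 1 := NormedSpace.exp_zero

theorem expOp_neg_mul (A : E →L[ℝ] E) : expOp (-A) * expOp A = 1 := by
  let _ : NormedAlgebra ℚ (E →L[ℝ] E) := NormedAlgebra.restrictScalars ℚ ℝ _
  have h : Commute (-A) A := (Commute.refl A).neg_left
  have := NormedSpace.exp_add_of_commute h
  rw [neg_add_cancel, NormedSpace.exp_zero] at this
  exact this.symm

theorem expOp_mul_neg (A : E →L[ℝ] E) : expOp A * expOp (-A) = 1 := by
  simpa using expOp_neg_mul (-A)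

theorem expOp_neg_apply (A : E →L[ℝ] E) (x : E) : expOp (-A) (expOp A x) = x :=
  DFunLike.congr_fun (expOp_neg_mul A) x

theorem expOp_apply_neg (A : E →L[ℝ] E) (x : E) : expOp A (expOp (-A) x) = x :=
  DFunLike.congr_fun (expOp_mul_neg A) x

theorem hasDerivAt_expOp (A : E →L[ℝ] E) (t : ℝ) :
    HasDerivAt (fun u : ℝ => expOp (u • A)) (A * expOp (t • A)) t :=
  hasDerivAt_exp_smul_const' A t

theorem hasDerivAt_expOp' (A : E →L[ℝ] E) (t : ℝ) :
    HasDerivAt (fun u : ℝ => expOp (u • A)) (expOp (t • A) * A) t :=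
  hasDerivAt_exp_smul_const A t

theorem hasDerivAt_expOp_apply (A : E →L[ℝ] E) (x : E) (t : ℝ) :
    HasDerivAt (fun u : ℝ => expOp (u • A) x) (A (expOp (t • A) x)) t := by
  simpa using (hasDerivAt_expOp A t).clm_apply (hasDerivAt_const t x)

theorem hasDerivAt_expOp_neg_apply {A : E →L[ℝ] E} {f : ℝ → E} {f' : E} {t : ℝ}
    (hf : HasDerivAt f f' t) :
    HasDerivAt (fun u : ℝ => expOp (u • -A) (f u))
      (expOp (t • -A) (f' - A (f t))) t := by
  have := (hasDerivAt_expOp' (-A) t).clm_apply hf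
  convert! this using 1
  simp [sub_eq_add_neg, add_comm]

/-- A solution of `f' = A f` is `f t = exp (t A) (f 0)`. -/
theorem eq_expOp_of_hasDerivAt {A : E →L[ℝ] E} {f : ℝ → E}
    (hf : ∀ t, HasDerivAt f (A (f t)) t) : f 1 = expOp A (f 0) := by
  have h0 : ∀ t, HasDerivAt (fun u : ℝ => expOp (u • -A) (f u)) 0 t := fun t => by
    have := hasDerivAt_expOp_neg_apply (A := A) (hf t)
    rwa [sub_self, map_zero] at this
  have h1 := is_const_of_deriv_eq_zero (fun t => (h0 t).differentiableAt)
    (fun t => (h0 t).deriv) 1 0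
  simp only [one_smul, zero_smul, expOp_zero] at h1
  have h2 := congrArg (expOp A) h1
  rw [expOp_apply_neg] at h2
  exact h2

/-- Intertwining operators intertwine exponentials. -/
theorem expOp_intertwine {F : Type*} [NormedAddCommGroup F] [NormedSpace ℝ F] [CompleteSpace F]
    {A : E →L[ℝ] E} {B : F →L[ℝ] F} {T : F →L[ℝ] E} (h : ∀ x, A (T x) = T (B x)) (x : F) :
    expOp A (T x) = T (expOp B x) := by
  have := eq_expOp_of_hasDerivAt (A := A) (f := fun t => T (expOp (t • B) x)) fun t => by
    rw [h]
    exact T.hasFDerivAt.comp_hasDerivAt t (hasDerivAt_expOp_apply B x t)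
  simpa [expOp_zero] using this.symm

/-- The exponential of a derivation of a bilinear operation is an automorphism. -/
theorem expOp_bilin {A : E →L[ℝ] E} {b : E →L[ℝ] E →L[ℝ] E}
    (h : ∀ x y, A (b x y) = b (A x) y + b x (A y)) (x y : E) :
    expOp A (b x y) = b (expOp A x) (expOp A y) := by
  have := eq_expOp_of_hasDerivAt (A := A)
    (f := fun t => b (expOp (t • A) x) (expOp (t • A) y)) fun t => by
    rw [h]
    exact (b.hasFDerivAt.comp_hasDerivAt t (hasDerivAt_expOp_apply A x t)).clm_apply
      (hasDerivAt_expOp_apply A y t)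
  simpa [expOp_zero] using this.symm

theorem expOp_apply_of_eq_zero {A : E →L[ℝ] E} {x : E} (h : A x = 0) : expOp A x = x :=
  (eq_expOp_of_hasDerivAt (A := A) (f := fun _ => x) fun t => by
    simpa [h] using hasDerivAt_const t x).symm

/-- A closed subspace which is invariant under `A` is invariant under `exp A`. -/
theorem expOp_mem {A : E →L[ℝ] E} {p : Submodule ℝ E} (hp : IsClosed (p : Set E))
    (h : ∀ x ∈ p, A x ∈ p) {x : E} (hx : x ∈ p) : expOp A x ∈ p := by
  have h1 := (NormedSpace.exp_series_hasSum_exp' (𝕂 := ℝ) A).mapL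
    (ContinuousLinearMap.apply ℝ E x)
  refine hp.mem_of_tendsto h1.tendsto_sum_nat (Eventually.of_forall fun N => ?_)
  refine p.sum_mem fun n _ => ?_
  have h2 : ∀ n : ℕ, (A ^ n) x ∈ p := fun n => by
    induction n with
    | zero => simpa using hx
    | succ n ih =>
      rw [pow_succ', mul_apply_eq_comp]
      exact h _ ih
  simpa using p.smul_mem _ (h2 n)

/-- The derivative of the exponential map of an algebra of operators. -/
theorem fderiv_expOp (Z Y : E →L[ℝ] E) :
    fderiv ℝ expOp Z Y = expOp Z * ∫ s in (0 : ℝ)..1, expOp (s • -Z) * Y * expOp (s • Z) := by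
  have hc : Continuous (expOp : (E →L[ℝ] E) → (E →L[ℝ] E)) := contDiff_expOp.continuous
  set g : ℝ → (E →L[ℝ] E) :=
    fun τ => ∫ s in (0 : ℝ)..1, expOp (s • -Z) * Y * expOp (s • (Z + τ • Y)) with hg
  have hgc : Continuous g := by
    apply intervalIntegral.continuous_parametric_intervalIntegral_of_continuous'
    fun_prop
  have hkey : ∀ τ : ℝ, expOp (-Z) * expOp (Z + τ • Y) - 1 = τ • g τ := by
    intro τ
    have hd : ∀ s : ℝ, HasDerivAt (fun s : ℝ => expOp (s • -Z) * expOp (s • (Z + τ • Y)))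
        (τ • (expOp (s • -Z) * Y * expOp (s • (Z + τ • Y)))) s := by
      intro s
      convert! (hasDerivAt_expOp' (-Z) s).mul (hasDerivAt_expOp (Z + τ • Y) s) using 1
      simp only [mul_add, add_mul, mul_assoc, neg_mul, mul_neg, smul_mul_assoc, mul_smul_comm]
      abel
    have := intervalIntegral.integral_eq_sub_of_hasDerivAt (a := 0) (b := 1)
      (fun s _ => hd s) (Continuous.intervalIntegrable (by fun_prop) _ _)
    simp only [one_smul, zero_smul, expOp_zero, mul_one] at this
    rw [← this, intervalIntegral.integral_smul]
  have h1 : HasDerivAt (fun τ : ℝ => expOp (-Z) * expOp (Z + τ • Y)) (g 0) 0 := by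
    rw [hasDerivAt_iff_tendsto_slope]
    refine ((hgc.tendsto 0).mono_left nhdsWithin_le_nhds).congr' ?_
    filter_upwards [self_mem_nhdsWithin] with τ hτ
    rw [slope_def_module, sub_zero, zero_smul, add_zero, expOp_neg_mul, hkey, smul_smul,
      inv_mul_cancel₀ hτ, one_smul]
  have h2 : HasDerivAt (fun τ : ℝ => expOp (-Z) * expOp (Z + τ • Y))
      (expOp (-Z) * fderiv ℝ expOp Z Y) 0 := by
    have hl : HasDerivAt (fun τ : ℝ => Z + τ • Y) Y 0 := by
      simpa using ((hasDerivAt_id (0 : ℝ)).smul_const Y).const_add Z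
    have he : HasFDerivAt (expOp : (E →L[ℝ] E) → (E →L[ℝ] E)) (fderiv ℝ expOp Z)
        (Z + (0 : ℝ) • Y) := by
      rw [zero_smul, add_zero]
      exact (contDiff_expOp.differentiable (by simp)).differentiableAt.hasFDerivAt
    exact (he.comp_hasDerivAt 0 hl).const_mul _
  have h3 := h2.unique h1
  have h4 := congrArg (fun T => expOp Z * T) h3
  simp only [← mul_assoc, expOp_mul_neg, one_mul] at h4
  rw [h4, hg]
  simp

end Exp

namespace SpencerData

variable {E W : Type*} [NormedAddCommGroup E] [NormedSpace ℝ E] [CompleteSpace E]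
    [NormedAddCommGroup W] [NormedSpace ℝ W] (S : SpencerData E W)

/-! ### Inner automorphisms -/

theorem expOp_br_br (X x y : E) :
    expOp (S.br X) (S.br x y) = S.br (expOp (S.br X) x) (expOp (S.br X) y) :=
  expOp_bilin (fun x y => S.jacobi X x y) x y

theorem expOp_neg_br_br (X x y : E) :
    expOp (-S.br X) (S.br x y) = S.br (expOp (-S.br X) x) (expOp (-S.br X) y) := by
  simpa using S.expOp_br_br (-X) x y

/-- The Maurer-Cartan form of the exponential map. -/
def mc (X Y : E) : E := ∫ s in (0 : ℝ)..1, expOp (s • -S.br X) Y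

theorem continuous_mc_integrand (A : E →L[ℝ] E) (Y : E) :
    Continuous (fun s : ℝ => expOp (s • A) Y) := by
  have hc : Continuous (expOp : (E →L[ℝ] E) → (E →L[ℝ] E)) := contDiff_expOp.continuous
  fun_prop

theorem fderiv_expOp_br (X Y : E) :
    fderiv ℝ expOp (S.br X) (S.br Y) = expOp (S.br X) * S.br (S.mc X Y) := by
  rw [fderiv_expOp]
  congr 1
  rw [mc, ← S.br.intervalIntegral_comp_comm ((continuous_mc_integrand _ _).intervalIntegrable _ _)]
  refine intervalIntegral.integral_congr fun s _ => ?_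
  ext x
  have h1 : s • -S.br X = -S.br (s • X) := by simp
  have h2 : s • S.br X = S.br (s • X) := by simp
  simp only [mul_apply_eq_comp, h1, h2]
  rw [S.expOp_neg_br_br, expOp_neg_apply]

omit [CompleteSpace E] in
theorem isClosed_gr (i : ℤ) : IsClosed (S.gr i : Set E) := by
  have : (S.gr i : Set E) = {x | S.pr i x = x} :=
    Set.ext fun x => ⟨fun h => S.pr_of_mem i x h, fun h => by
      have h' : S.pr i x = x := h
      exact h' ▸ S.pr_mem i x⟩
  rw [this]
  exact isClosed_eq (S.pr i).continuous continuous_id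

omit [CompleteSpace E] in
/-- `ad X` preserves `gr k` for `X ∈ gr k` if `k ∈ {0, 1}` (for `k = 1` it vanishes there). -/
theorem br_mem_of_mem {k : ℤ} (hk : k = 0 ∨ k = 1) {X x : E} (hX : X ∈ S.gr k)
    (hx : x ∈ S.gr k) : S.br X x ∈ S.gr k := by
  rcases hk with rfl | rfl
  · simpa using S.br_mem 0 0 X x hX hx
  · rw [S.br_eq_zero (by norm_num) hX hx]
    exact Submodule.zero_mem _

theorem mc_mem {k : ℤ} (hk : k = 0 ∨ k = 1) {X Y : E} (hX : X ∈ S.gr k) (hY : Y ∈ S.gr k) :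
    S.mc X Y ∈ S.gr k := by
  have h1 : ∀ s : ℝ, expOp (s • -S.br X) Y ∈ S.gr k := fun s =>
    expOp_mem (S.isClosed_gr k) (fun x hx => by
      simpa using (S.gr k).smul_mem s (S.br_mem_of_mem hk hX hx)) hY
  have h2 : S.pr k (S.mc X Y) = S.mc X Y := by
    rw [mc, ← ContinuousLinearMap.intervalIntegral_comp_comm _
      ((continuous_mc_integrand _ _).intervalIntegrable _ _)]
    exact intervalIntegral.integral_congr fun s _ => S.pr_of_mem _ _ (h1 s)
  exact h2 ▸ S.pr_mem _ _

/-- The inner automorphism `exp (-ad X)`. -/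
def gauge (X : E) : E →L[ℝ] E := expOp (-S.br X)

omit [CompleteSpace E] in
theorem gauge_zero : S.gauge 0 = 1 := by simp [gauge, expOp_zero]

theorem gauge_br (X x y : E) : S.gauge X (S.br x y) = S.br (S.gauge X x) (S.gauge X y) :=
  S.expOp_neg_br_br X x y

theorem gauge_surjective (X : E) : Function.Surjective (S.gauge X) :=
  fun x => ⟨expOp (S.br X) x, expOp_neg_apply _ _⟩

theorem gauge_apply_of_br_eq_zero {X x : E} (h : S.br X x = 0) : S.gauge X x = x :=
  expOp_apply_of_eq_zero (by simp [h])

/-- Gauge transformations of degree `0` preserve the grading. -/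
theorem pr_gauge_of_mem_zero {X : E} (hX : X ∈ S.gr 0) (x : E) :
    S.pr (-1) (S.gauge X x) = S.gauge X (S.pr (-1) x) ∧ S.pr 0 (S.gauge X x) = S.gauge X (S.pr 0 x)
      ∧ S.pr 1 (S.gauge X x) = S.gauge X (S.pr 1 x) := by
  have h0 : S.pr 0 X = X := S.pr_of_mem _ _ hX
  have h1 : S.pr (-1) X = 0 := S.pr_of_mem_ne _ _ _ (by norm_num) hX
  have h2 : S.pr 1 X = 0 := S.pr_of_mem_ne _ _ _ (by norm_num) hX
  refine ⟨(expOp_intertwine (fun x => ?_) x).symm, (expOp_intertwine (fun x => ?_) x).symm,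
    (expOp_intertwine (fun x => ?_) x).symm⟩
  · simp [S.pr_br_neg, h0, h1]
  · simp [S.pr_br_zero, h0, h1, h2]
  · simp [S.pr_br_one, h0, h2]

/-- Gauge transformations of degree `1` fix the component of degree `-1`. -/
theorem pr_neg_gauge_of_mem_one {X : E} (hX : X ∈ S.gr 1) (x : E) :
    S.pr (-1) (S.gauge X x) = S.pr (-1) x := by
  have h0 : S.pr 0 X = 0 := S.pr_of_mem_ne _ _ _ (by norm_num) hX
  have h1 : S.pr (-1) X = 0 := S.pr_of_mem_ne _ _ _ (by norm_num) hX
  have := expOp_intertwine (A := (0 : E →L[ℝ] E)) (B := -S.br X) (T := S.pr (-1))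
    (fun x => by simp [S.pr_br_neg, h0, h1]) x
  rw [expOp_zero] at this
  exact this.symm

/-- Gauge transformations of degree `1` change the component of degree `0` by a bracket with the
component of degree `-1`, i.e. by a coboundary. -/
theorem pr_zero_gauge_of_mem_one {X : E} (hX : X ∈ S.gr 1) (x : E) :
    S.pr 0 (S.gauge X x) = S.pr 0 x - S.br X (S.pr (-1) x) := by
  have h0 : S.pr 0 X = 0 := S.pr_of_mem_ne _ _ _ (by norm_num) hX
  have h1 : S.pr (-1) X = 0 := S.pr_of_mem_ne _ _ _ (by norm_num) hX
  have h2 : S.pr 1 X = X := S.pr_of_mem _ _ hX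
  have hd : ∀ t : ℝ, HasDerivAt
      (fun t : ℝ => S.pr 0 (expOp (t • -S.br X) x) + t • S.br X (S.pr (-1) x)) 0 t := fun t => by
    have h3 := ((S.pr 0).hasFDerivAt.comp_hasDerivAt t
      (hasDerivAt_expOp_apply (-S.br X) x t)).add
      ((hasDerivAt_id t).smul_const (S.br X (S.pr (-1) x)))
    convert! h3 using 1
    have h4 : S.pr (-1) (expOp (t • -S.br X) x) = S.pr (-1) x := by
      have := S.pr_neg_gauge_of_mem_one ((S.gr 1).smul_mem t hX) x
      simpa [gauge] using this
    simp only [_root_.neg_apply, map_neg, S.pr_br_zero, h0, h1, h2, h4]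
    simp
  have h1 := is_const_of_deriv_eq_zero (fun t => (hd t).differentiableAt)
    (fun t => (hd t).deriv) 1 0
  simp only [one_smul, zero_smul, expOp_zero, add_zero] at h1
  exact eq_sub_of_add_eq h1

variable [FiniteDimensional ℝ E] [Nontrivial W]

/-- The gauge transformation defined by a smooth function `b` with values in `gr 0` or in `gr 1`
satisfies a linear differential equation, whose coefficient is the Maurer-Cartan form `μ`. -/
theorem exists_maurerCartan {b : W → E} {y : W} {k : ℤ} (hk : k = 0 ∨ k = 1) (hb : SmoothNear b y)
    (hmem : ∀ᶠ z in 𝓝 y, b z ∈ S.gr k) :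
    SmoothNear (fun z => S.gauge (b z)) y ∧ ∃ μ : W → W →L[ℝ] E, SmoothNear μ y ∧
      (∀ᶠ z in 𝓝 y, ∀ v, μ z v ∈ S.gr k) ∧
      ∀ᶠ z in 𝓝 y, ∀ v, fderiv ℝ (fun z => S.gauge (b z)) z v
        = -(S.br (μ z v)).comp (S.gauge (b z)) := by
  have hexp : ∀ x, SmoothNear (expOp : (E →L[ℝ] E) → (E →L[ℝ] E)) x := fun x =>
    smoothNear_of_contDiff (contDiff_expOp.of_le le_top)
  have hΦ : SmoothNear (fun z => S.gauge (b z)) y := (hexp _).comp (hb.clm S.br).neg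
  refine ⟨hΦ, ?_⟩
  -- a left inverse of `ad`; it shows that the form `μ`, which is determined by `ad μ`, is smooth
  obtain ⟨l, hl⟩ : ∃ l : (E →L[ℝ] E) →L[ℝ] E, ∀ X, S.pr (-1) X = 0 → l (S.br X) = X := by
    let f : LinearMap.ker (S.pr (-1)).toLinearMap →ₗ[ℝ] (E →L[ℝ] E) :=
      S.br.toLinearMap ∘ₗ (LinearMap.ker (S.pr (-1)).toLinearMap).subtype
    have hf : LinearMap.ker f = ⊥ := LinearMap.ker_eq_bot'.2 fun X hX =>
      Subtype.ext (S.ad_injective X.2 fun x => DFunLike.congr_fun hX x)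
    obtain ⟨g, hg⟩ := f.exists_leftInverse_of_injective hf
    refine ⟨LinearMap.toContinuousLinearMap ((Submodule.subtype _) ∘ₗ g), fun X hX => ?_⟩
    exact congrArg Subtype.val (DFunLike.congr_fun hg ⟨X, hX⟩)
  set ν : W → W → E := fun z v => -(S.gauge (b z) (S.mc (-(b z)) (-(fderiv ℝ b z v)))) with hν
  have hd : ∀ᶠ z in 𝓝 y, ∀ v, fderiv ℝ (fun z => S.gauge (b z)) z v
        = -(S.br (ν z v)).comp (S.gauge (b z)) := by
    filter_upwards [hb] with z hz v
    have h1 : HasFDerivAt (fun z => -(S.br (b z))) (-(S.br.comp (fderiv ℝ b z))) z :=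
      (S.br.hasFDerivAt.comp z (hz.differentiableAt (by simp)).hasFDerivAt).neg
    have h2 : HasFDerivAt (expOp : (E →L[ℝ] E) → (E →L[ℝ] E)) (fderiv ℝ expOp (-(S.br (b z))))
        (-(S.br (b z))) := (contDiff_expOp.differentiable (by simp)).differentiableAt.hasFDerivAt
    have h3 : HasFDerivAt (fun z => S.gauge (b z)) _ z := h2.comp z h1
    rw [h3.fderiv]
    have h4 := S.fderiv_expOp_br (-(b z)) (-(fderiv ℝ b z v))
    rw [map_neg, map_neg] at h4
    simp only [ContinuousLinearMap.comp_apply, _root_.neg_apply]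
    rw [h4]
    ext x
    simp only [hν, map_neg, ContinuousLinearMap.comp_apply, neg_neg,
      ContinuousLinearMap.neg_comp, ← S.gauge_br, mul_apply_eq_comp]
    rfl
  have hν_mem : ∀ᶠ z in 𝓝 y, ∀ v, ν z v ∈ S.gr k := by
    filter_upwards [hb, hmem, eventually_eventually_nhds.2 hmem] with z hz hbz hz2 v
    have h5 : fderiv ℝ b z v ∈ S.gr k := by
      have := clm_fderiv_eq_zero (ContinuousLinearMap.id ℝ E - S.pr k)
        (hz.differentiableAt (by simp)) (hz2.mono fun x hx => by
          simp [S.pr_of_mem _ _ hx]) v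
      have h6 : fderiv ℝ b z v = S.pr k (fderiv ℝ b z v) := by simpa [sub_eq_zero] using this
      exact h6 ▸ S.pr_mem _ _
    refine (S.gr k).neg_mem (expOp_mem (S.isClosed_gr k) (fun x hx => ?_)
      (S.mc_mem hk ((S.gr k).neg_mem hbz) ((S.gr k).neg_mem h5)))
    simpa using (S.br_mem_of_mem hk hbz hx)
  have hμ : ∀ᶠ z in 𝓝 y, ∀ v, (l.comp (((ContinuousLinearMap.compL ℝ E E E).flip
      (expOp (S.br (b z)))).comp (-(fderiv ℝ (fun z => S.gauge (b z)) z)))) v = ν z v := by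
    filter_upwards [hd, hν_mem] with z h1 h2 v
    simp only [ContinuousLinearMap.comp_apply, _root_.neg_apply, h1, neg_neg,
      ContinuousLinearMap.flip_apply, ContinuousLinearMap.compL_apply]
    have h3 : ((S.br (ν z v)).comp (S.gauge (b z))).comp (expOp (S.br (b z))) = S.br (ν z v) := by
      ext x
      simp [gauge, expOp_neg_apply]
    rw [h3]
    refine hl _ (S.pr_of_mem_ne _ _ _ ?_ (h2 v))
    rcases hk with rfl | rfl <;> norm_num
  refine ⟨fun z => l.comp (((ContinuousLinearMap.compL ℝ E E E).flip
      (expOp (S.br (b z)))).comp (-(fderiv ℝ (fun z => S.gauge (b z)) z))), ?_, ?_, ?_⟩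
  · exact (smoothNear_const l).clm_comp
      ((((hexp _).comp (hb.clm S.br)).clm _).clm_comp hΦ.fderiv.neg)
  · filter_upwards [hμ, hν_mem] with z h1 h2 v
    rw [h1]
    exact h2 v
  · filter_upwards [hμ, hd] with z h1 h2 v
    rw [h1]
    exact h2 v

end SpencerData

/-! ### Families of automorphisms as inner automorphisms -/

/-- The inverse function theorem; the analyticity of `f` provides one neighbourhood on which the
local inverse is differentiable to all orders. -/
theorem smoothNear_localInverse {X Y : Type*} [NormedAddCommGroup X] [NormedSpace ℝ X]
    [CompleteSpace X] [NormedAddCommGroup Y] [NormedSpace ℝ Y] {f : X → Y} {f' : X ≃L[ℝ] Y} {a : X}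
    (hf : ContDiffAt ℝ ω f a) (hf' : HasFDerivAt f (f' : X →L[ℝ] Y) a) :
    ∃ g : Y → X, SmoothNear g (f a) ∧ g (f a) = a ∧ ∀ᶠ y in 𝓝 (f a), f (g y) = y := by
  have hs : HasStrictFDerivAt f (f' : X →L[ℝ] Y) a := hf.hasStrictFDerivAt' hf' (by simp)
  refine ⟨hf.localInverse hf' (by simp), ?_, hf.localInverse_apply_image hf' (by simp), ?_⟩
  · exact ((hf.to_localInverse hf' (by simp)).eventually (by simp)).mono fun z hz => hz.of_le le_top
  · exact hs.eventually_right_inverse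

/-- A consequence of the Grönwall inequality along the rays from `x`. -/
theorem eventually_eq_zero_of_norm_fderiv_le {X Y : Type*} [NormedAddCommGroup X]
    [NormedSpace ℝ X] [NormedAddCommGroup Y] [NormedSpace ℝ Y] {c : X → Y} {x : X} {K : ℝ}
    (hd : ∀ᶠ y in 𝓝 x, DifferentiableAt ℝ c y) (h0 : c x = 0)
    (hb : ∀ᶠ y in 𝓝 x, ∀ v, ‖fderiv ℝ c y v‖ ≤ K * ‖c y‖ * ‖v‖) : ∀ᶠ y in 𝓝 x, c y = 0 := by
  obtain ⟨ε, hε, hball⟩ := Metric.eventually_nhds_iff_ball.1 (hd.and hb)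
  refine Metric.eventually_nhds_iff_ball.2 ⟨ε, hε, fun y hy => ?_⟩
  have hmem : ∀ t ∈ Set.Icc (0 : ℝ) 1, x + t • (y - x) ∈ Metric.ball x ε := by
    intro t ht
    rw [mem_ball_iff_norm, add_sub_cancel_left, norm_smul, Real.norm_of_nonneg ht.1]
    rw [mem_ball_iff_norm] at hy
    exact (mul_le_of_le_one_left (norm_nonneg _) ht.2).trans_lt hy
  have hder : ∀ t ∈ Set.Icc (0 : ℝ) 1, HasDerivAt (fun t : ℝ => c (x + t • (y - x)))
      (fderiv ℝ c (x + t • (y - x)) (y - x)) t := by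
    intro t ht
    have hl : HasDerivAt (fun t : ℝ => x + t • (y - x)) (y - x) t := by
      simpa using ((hasDerivAt_id t).smul_const (y - x)).const_add x
    exact (hball _ (hmem t ht)).1.hasFDerivAt.comp_hasDerivAt t hl
  have := eq_zero_of_abs_deriv_le_mul_abs_self_of_eq_zero_right (K := K * ‖y - x‖)
    (fun t ht => (hder t ht).continuousAt.continuousWithinAt)
    (fun t ht => (hder t (Set.Ico_subset_Icc_self ht)).hasDerivWithinAt) (by simp [h0])
    (fun t ht => ((hball _ (hmem t (Set.Ico_subset_Icc_self ht))).2 _).trans (by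
      rw [mul_right_comm])) 1 (by simp)
  simpa using this

/-- Near `1`, the elements of a finite-dimensional algebra are uniquely of the form
`exp (res X) (1 + c)`, where `res` is an injective linear map and `c` lies in a complement of its
image. -/
theorem exists_exp_decomposition {A X : Type*} [NormedRing A] [NormedAlgebra ℝ A]
    [FiniteDimensional ℝ A] [CompleteSpace A] [NormedAddCommGroup X] [NormedSpace ℝ X]
    [FiniteDimensional ℝ X] [CompleteSpace X] {res : X →L[ℝ] A} {C : Submodule ℝ A}
    (hinj : Function.Injective res) (hC : IsCompl (LinearMap.range res.toLinearMap) C) :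
    ∃ (b : A → X) (c : A → A), SmoothNear b 1 ∧ SmoothNear c 1 ∧ b 1 = 0 ∧ c 1 = 0 ∧
      (∀ y, c y ∈ C) ∧ ∀ᶠ y in 𝓝 1, y = NormedSpace.exp (res (b y)) * (1 + c y) := by
  have : CompleteSpace C := FiniteDimensional.complete ℝ C
  let Ψ : X × C → A := fun p => NormedSpace.exp (res p.1) * (1 + (p.2 : A))
  have hΨ : ContDiff ℝ ω Ψ := by
    have e1 : ContDiff ℝ ω (fun p : X × C => NormedSpace.exp (res p.1)) :=
      (contDiff_iff_contDiffAt.2 fun a => (NormedSpace.exp_analytic (𝕂 := ℝ) a).contDiffAt).comp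
        (res.contDiff.comp contDiff_fst)
    have e2 : ContDiff ℝ ω (fun p : X × C => (1 + (p.2 : A))) :=
      contDiff_const.add (C.subtypeL.contDiff.comp contDiff_snd)
    exact e1.mul e2
  let lin : (X × C) →ₗ[ℝ] A := res.toLinearMap.coprod C.subtype
  have hlin : Function.Bijective lin := by
    constructor
    · rw [← LinearMap.ker_eq_bot, LinearMap.ker_eq_bot']
      rintro ⟨x, c⟩ h
      have h' : res x + (c : A) = 0 := h
      have h2 : res x = 0 := by
        refine (Submodule.disjoint_def.1 hC.disjoint) _ ⟨x, rfl⟩ ?_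
        rw [eq_neg_of_add_eq_zero_left h']
        exact C.neg_mem c.2
      rw [h2, zero_add] at h'
      exact Prod.ext (hinj (by simpa using h2)) (Subtype.ext h')
    · intro r
      obtain ⟨a, ⟨x, rfl⟩, c, hc, rfl⟩ := Submodule.mem_sup.1
        ((hC.sup_eq_top ▸ Submodule.mem_top : r ∈ LinearMap.range res.toLinearMap ⊔ C))
      exact ⟨(x, ⟨c, hc⟩), rfl⟩
  let f' : (X × C) ≃L[ℝ] A := (LinearEquiv.ofBijective lin hlin).toContinuousLinearEquiv
  have hΨ0 : Ψ 0 = 1 := by simp [Ψ]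
  have hΨ' : HasFDerivAt Ψ (f' : (X × C) →L[ℝ] A) 0 := by
    have e0 : HasFDerivAt (NormedSpace.exp : A → A) (1 : A →L[ℝ] A)
        (res.comp (ContinuousLinearMap.fst ℝ X C) 0) := by
      rw [map_zero]
      exact hasFDerivAt_exp_zero
    have e1 := e0.comp (0 : X × C) (res.comp (ContinuousLinearMap.fst ℝ X C)).hasFDerivAt
    have e2 := ((C.subtypeL.comp (ContinuousLinearMap.snd ℝ X C)).hasFDerivAt
      (x := (0 : X × C))).const_add (1 : A)
    have e3 : HasFDerivAt Ψ _ 0 := e1.mul' e2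
    convert! e3 using 1
    refine ContinuousLinearMap.ext fun p => ?_
    simp [f', lin, add_comm]
  obtain ⟨g, hg, hg0, hgr⟩ := smoothNear_localInverse hΨ.contDiffAt hΨ'
  rw [hΨ0] at hg hg0 hgr
  refine ⟨fun y => (g y).1, fun y => ((g y).2 : A), ?_, ?_, by simp [hg0], by simp [hg0],
    fun y => (g y).2.2, hgr.mono fun y hy => hy.symm⟩
  · exact SmoothNear.clm (f := g) (ContinuousLinearMap.fst ℝ X C) hg
  · exact SmoothNear.clm (f := g) (C.subtypeL.comp (ContinuousLinearMap.snd ℝ X C)) hg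

namespace SpencerData

variable {E W : Type*} [NormedAddCommGroup E] [NormedSpace ℝ E] [CompleteSpace E]
    [NormedAddCommGroup W] [NormedSpace ℝ W] [CompleteSpace W] (S : SpencerData E W)
    [FiniteDimensional ℝ E] [FiniteDimensional ℝ W] [Nontrivial W]

/-- `r` is the restriction to `W` of `ad X` for some `X` of degree `0`. -/
def inner : Submodule ℝ (W →L[ℝ] W) where
  carrier := {r | ∃ X ∈ S.gr 0, ∀ w, S.j (r w) = S.br X (S.j w)}
  add_mem' := fun ⟨X, hX, h⟩ ⟨Y, hY, h'⟩ => ⟨X + Y, add_mem hX hY, fun w => by simp [h, h']⟩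
  zero_mem' := ⟨0, zero_mem _, fun w => by simp⟩
  smul_mem' := fun a _ ⟨X, hX, h⟩ => ⟨a • X, (S.gr 0).smul_mem a hX, fun w => by simp [h]⟩

omit [CompleteSpace W] [FiniteDimensional ℝ E] [FiniteDimensional ℝ W] [Nontrivial W] in
/-- If `ρ` is the restriction to `W` of `ad b`, where `b` has degree `0`, then the logarithmic
derivative of `exp ρ` takes values in `ad (gr 0)`. -/
theorem fderiv_exp_restrict [CompleteSpace W] {b : W → E} {ρ : W → W →L[ℝ] W} {y : W}
    (hb : DifferentiableAt ℝ b y) (hρ : DifferentiableAt ℝ ρ y) (hmem : ∀ z, b z ∈ S.gr 0)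
    (h : ∀ z w, S.br (b z) (S.j w) = S.j (ρ z w)) (v : W) :
    expOp (-(ρ y)) * fderiv ℝ (fun z => expOp (ρ z)) y v ∈ S.inner := by
  have hexpj : ∀ z w, expOp (S.br (b z)) (S.j w) = S.j (expOp (ρ z) w) := fun z w =>
    expOp_intertwine (fun w => h z w) w
  refine ⟨S.mc (b y) (fderiv ℝ b y v), S.mc_mem (Or.inl rfl) (hmem y) ?_, fun w => ?_⟩
  · have := clm_fderiv_eq_zero (ContinuousLinearMap.id ℝ E - S.pr 0)
      hb (Eventually.of_forall fun x => by simp [S.pr_of_mem _ _ (hmem x)]) v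
    have h6 : fderiv ℝ b y v = S.pr 0 (fderiv ℝ b y v) := by simpa [sub_eq_zero] using this
    exact h6 ▸ S.pr_mem _ _
  · -- differentiate `exp (ad b) ∘ j = j ∘ exp ρ`
    have hG : DifferentiableAt ℝ (fun z => expOp (ρ z)) y :=
      (contDiff_expOp.differentiable (by simp)).differentiableAt.comp y hρ
    have d1 : HasFDerivAt (fun z => expOp (S.br (b z)) (S.j w)) _ y :=
      ((contDiff_expOp.differentiable (by simp)).differentiableAt.hasFDerivAt.comp y
        (S.br.hasFDerivAt.comp y hb.hasFDerivAt)).clm_apply (hasFDerivAt_const (S.j w) y)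
    have d2 : HasFDerivAt (fun z => S.j (expOp (ρ z) w)) _ y :=
      S.j.hasFDerivAt.comp y (hG.hasFDerivAt.clm_apply (hasFDerivAt_const w y))
    rw [show (fun z => expOp (S.br (b z)) (S.j w)) = fun z => S.j (expOp (ρ z) w) from
      funext fun z => hexpj z w] at d1
    have d4 := DFunLike.congr_fun (d1.unique d2) v
    simp only [_root_.add_apply, ContinuousLinearMap.comp_apply, _root_.zero_apply,
      ContinuousLinearMap.flip_apply, map_zero, zero_add, Function.comp_apply,
      S.fderiv_expOp_br, mul_apply_eq_comp] at d4
    have d5 := congrArg (expOp (-(S.br (b y)))) d4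
    rw [expOp_neg_apply] at d5
    rw [d5, mul_apply_eq_comp]
    have d6 := hexpj y (expOp (-(ρ y)) (fderiv ℝ (fun z => expOp (ρ z)) y v w))
    rw [expOp_apply_neg] at d6
    rw [← d6, expOp_neg_apply]

omit [CompleteSpace E] [FiniteDimensional ℝ E] [FiniteDimensional ℝ W] [Nontrivial W] in
/-- If `B = exp ρ · (1 + c)`, where the logarithmic derivatives of `B` and of `exp ρ` take values in
`ad (gr 0)`, and where `c` takes values in a complement of `ad (gr 0)`, the kernel of the
complementary projection being `q`, then `c` satisfies a homogeneous linear equation. -/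
theorem fderiv_complement {B ρ c : W → W →L[ℝ] W} {q : (W →L[ℝ] W) →L[ℝ] (W →L[ℝ] W)} {y v : W}
    (hρ : DifferentiableAt ℝ ρ y) (hc : DifferentiableAt ℝ c y)
    (hq : ∀ r ∈ S.inner, q r = 0) (hqc : ∀ z, q (c z) = c z)
    (hB : ∀ᶠ z in 𝓝 y, B z = expOp (ρ z) * (1 + c z)) {r m : W →L[ℝ] W}
    (hr : r ∈ S.inner) (hm : m ∈ S.inner) (hr' : fderiv ℝ B y v = B y * r)
    (hm' : m = expOp (-(ρ y)) * fderiv ℝ (fun z => expOp (ρ z)) y v) :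
    fderiv ℝ c y v = q (c y * r - m * c y) := by
  have hG : DifferentiableAt ℝ (fun z => expOp (ρ z)) y :=
    (contDiff_expOp.differentiable (by simp)).differentiableAt.comp y hρ
  have hdc : q (fderiv ℝ c y v) = fderiv ℝ c y v := by
    have := clm_fderiv_eq_zero (ContinuousLinearMap.id ℝ (W →L[ℝ] W) - q)
      hc (Eventually.of_forall fun x => by simp [hqc]) v
    rw [_root_.sub_apply, ContinuousLinearMap.id_apply, sub_eq_zero] at this
    exact this.symm
  have hprod : fderiv ℝ B y v = expOp (ρ y) * fderiv ℝ c y v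
      + fderiv ℝ (fun z => expOp (ρ z)) y v * (1 + c y) := by
    have d1 : HasFDerivAt (fun z => expOp (ρ z) * (1 + c z)) _ y :=
      hG.hasFDerivAt.mul' (hc.hasFDerivAt.const_add 1)
    have d2 : B =ᶠ[𝓝 y] fun z => expOp (ρ z) * (1 + c z) := hB
    rw [d2.fderiv_eq, d1.fderiv]
    rfl
  have hdc2 : fderiv ℝ c y v = r - m + (c y * r - m * c y) := by
    have d1 := congrArg (fun T => expOp (-(ρ y)) * T) (hprod.symm.trans hr')
    simp only [mul_add, ← mul_assoc] at d1
    rw [hB.self_of_nhds, expOp_neg_mul, one_mul, ← mul_assoc, expOp_neg_mul,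
      one_mul, mul_one, ← hm', add_mul, one_mul] at d1
    rw [eq_sub_of_add_eq d1]
    abel
  rw [← hdc, hdc2, map_add, map_sub, hq r hr, hq m hm, sub_zero, zero_add]

/-- A smooth family of automorphisms of `W` whose logarithmic derivative takes values in
`ad (gr 0)` is the restriction of a smooth family of inner automorphisms of degree `0`. In
coordinates `(X, c) ↦ exp (ad X) (1 + c)` of `GL(W)`, where `c` runs over a complement of the Lie
algebra `ad (gr 0)|_W`, the component `c` satisfies a homogeneous linear differential inequality,
and so it vanishes. -/
theorem exists_gauge {B : W → W →L[ℝ] W} {y₀ : W} (hB : SmoothNear B y₀) (h1 : B y₀ = 1)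
    (hd : ∀ᶠ y in 𝓝 y₀, ∀ v, ∃ r ∈ S.inner, fderiv ℝ B y v = B y * r) :
    ∃ b : W → E, SmoothNear b y₀ ∧ b y₀ = 0 ∧
      ∀ᶠ y in 𝓝 y₀, b y ∈ S.gr 0 ∧ ∀ w, S.gauge (b y) (S.j (B y w)) = S.j w := by
  -- the elements `X` of degree `0` which preserve `W`, and their restrictions to `W`
  obtain ⟨jinv, hj⟩ : ∃ l : E →L[ℝ] W, ∀ w, l (S.j w) = w := by
    obtain ⟨g, hg⟩ := (S.j.toLinearMap).exists_leftInverse_of_injective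
      (LinearMap.ker_eq_bot.2 S.j_inj)
    exact ⟨LinearMap.toContinuousLinearMap g, fun w => DFunLike.congr_fun hg w⟩
  let gs : Submodule ℝ E :=
    { carrier := {X | X ∈ S.gr 0 ∧ ∀ w, S.br X (S.j w) = S.j (jinv (S.br X (S.j w)))}
      add_mem' := fun ⟨h, h'⟩ ⟨k, k'⟩ => ⟨add_mem h k, fun w => by simp [← h', ← k']⟩
      zero_mem' := ⟨zero_mem _, fun w => by simp⟩
      smul_mem' := fun a _ ⟨h, h'⟩ => ⟨(S.gr 0).smul_mem a h, fun w => by simp [← h']⟩ }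
  let res : E →L[ℝ] (W →L[ℝ] W) :=
    ((ContinuousLinearMap.compL ℝ W E W) jinv).comp
      (((ContinuousLinearMap.compL ℝ W E E).flip S.j).comp S.br)
  have hres : ∀ X w, res X w = jinv (S.br X (S.j w)) := fun X w => rfl
  have hresj : ∀ X ∈ gs, ∀ w, S.br X (S.j w) = S.j (res X w) := fun X hX w => hX.2 w
  have hres_inj : ∀ X ∈ gs, res X = 0 → X = 0 := fun X hX h =>
    S.eq_zero_of_mem_zero hX.1 fun w => by rw [hresj X hX, h]; simp
  have hres_mem : ∀ X ∈ gs, res X ∈ S.inner := fun X hX => ⟨X, hX.1, fun w => (hresj X hX w).symm⟩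
  have hres_surj : ∀ r ∈ S.inner, ∃ X ∈ gs, res X = r := by
    rintro r ⟨X, hX, h⟩
    refine ⟨X, ⟨hX, fun w => by rw [← h, hj]⟩, ?_⟩
    ext w
    rw [hres, ← h, hj]
  have hrange : LinearMap.range (res.comp gs.subtypeL).toLinearMap = S.inner := by
    refine le_antisymm ?_ fun r hr => ?_
    · rintro _ ⟨X, rfl⟩
      exact hres_mem X X.2
    · obtain ⟨X, hX, rfl⟩ := hres_surj r hr
      exact ⟨⟨X, hX⟩, rfl⟩
  obtain ⟨C, hC⟩ := Submodule.exists_isCompl S.inner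
  -- the projection onto the complement
  obtain ⟨q, hq0, hqC⟩ : ∃ q : (W →L[ℝ] W) →L[ℝ] (W →L[ℝ] W),
      (∀ r ∈ S.inner, q r = 0) ∧ ∀ c ∈ C, q c = c := by
    refine ⟨LinearMap.toContinuousLinearMap
      (C.subtype ∘ₗ Submodule.projectionOnto C S.inner hC.symm), fun r hr => ?_, fun c hc => ?_⟩
    · simpa using hr
    · simpa using congrArg Subtype.val (Submodule.projectionOnto_apply_left hC.symm ⟨c, hc⟩)
  have : CompleteSpace gs := FiniteDimensional.complete ℝ gs
  obtain ⟨bA, cA, hbA, hcA, hbA0, hcA0, hcAmem, hdec⟩ :=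
    exists_exp_decomposition (res := res.comp gs.subtypeL) (C := C)
      ((injective_iff_map_eq_zero _).2 fun X hX => Subtype.ext (hres_inj X X.2 hX))
      (hrange ▸ hC)
  have ht : Tendsto B (𝓝 y₀) (𝓝 1) := h1 ▸ hB.contDiffAt.continuousAt
  have hBeq0 := ht.eventually hdec
  rw [← h1] at hbA hcA hbA0 hcA0
  set b : W → E := fun y => (bA (B y) : E) with hb_def
  set c : W → (W →L[ℝ] W) := fun y => cA (B y) with hc_def
  have hb : SmoothNear b y₀ := (hbA.comp hB).clm gs.subtypeL
  have hc : SmoothNear c y₀ := hcA.comp hB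
  have hbmem : ∀ y, b y ∈ gs := fun y => (bA (B y)).2
  have hb0 : b y₀ = 0 := by simp [hb_def, hbA0]
  have hBeq : ∀ᶠ y in 𝓝 y₀, B y = expOp (res (b y)) * (1 + c y) :=
    hBeq0
  have hρ : SmoothNear (fun y => res (b y)) y₀ := hb.clm res
  -- `c` solves a homogeneous linear differential equation with `c y₀ = 0`
  have hc_zero : ∀ᶠ y in 𝓝 y₀, c y = 0 := by
    set G : W → (W →L[ℝ] W) := fun y => expOp (res (b y)) with hG_def
    have hG : SmoothNear G y₀ :=
      (smoothNear_of_contDiff (contDiff_expOp.of_le le_top)).comp (hb.clm res)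
    have hunit : ∀ᶠ y in 𝓝 y₀, IsUnit (B y) := by
      have : ∀ᶠ r in 𝓝 (B y₀), IsUnit r := by
        rw [h1]
        exact Units.isOpen.mem_nhds isUnit_one
      exact hB.contDiffAt.continuousAt.eventually this
    -- `‖dc‖ ≤ K ‖c‖` by the differential equation for `c`, and `K` is bounded near `y₀`
    let K : W → ℝ := fun y => ‖q‖ * (‖Ring.inverse (B y)‖ * ‖fderiv ℝ B y‖
      + ‖expOp (-(res (b y)))‖ * ‖fderiv ℝ G y‖)
    have hK : ContinuousAt K y₀ := by
      have k1 : ContinuousAt (fun y => Ring.inverse (B y)) y₀ := by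
        refine ContinuousAt.comp (g := Ring.inverse) ?_ hB.contDiffAt.continuousAt
        rw [h1]
        exact NormedRing.inverse_continuousAt (1 : (W →L[ℝ] W)ˣ)
      have k2 : ContinuousAt (fun y => expOp (-(res (b y)))) y₀ :=
        contDiff_expOp.continuous.continuousAt.comp (hb.clm res).neg.contDiffAt.continuousAt
      exact continuousAt_const.mul ((k1.norm.mul hB.fderiv.contDiffAt.continuousAt.norm).add
        (k2.norm.mul hG.fderiv.contDiffAt.continuousAt.norm))
    have hKle : ∀ᶠ y in 𝓝 y₀, K y ≤ K y₀ + 1 := hK.eventually (eventually_le_nhds (by simp))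
    refine eventually_eq_zero_of_norm_fderiv_le (K := K y₀ + 1)
      (hc.mono fun y hy => hy.differentiableAt (by simp)) hcA0 ?_
    filter_upwards [hKle, hunit, hd, hc, hb, hρ, eventually_eventually_nhds.2 hBeq]
      with y hKy hu hdy hcy hby hρy hBy' v
    obtain ⟨r, hr, hrB⟩ := hdy v
    have hr_eq : r = Ring.inverse (B y) * fderiv ℝ B y v := by
      rw [hrB, ← mul_assoc, Ring.inverse_mul_cancel _ hu, one_mul]
    have hm := S.fderiv_exp_restrict (hby.differentiableAt (by simp))
      (hρy.differentiableAt (by simp)) (fun z => (hbmem z).1) (fun z w => hresj _ (hbmem z) w) v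
    have hdc3 := S.fderiv_complement (hρy.differentiableAt (by simp))
      (hcy.differentiableAt (by simp)) hq0 (fun z => hqC _ (hcAmem _)) hBy' hr hm hrB rfl
    set m : W →L[ℝ] W := expOp (-(res (b y))) * fderiv ℝ G y v with hm_def
    have n1 : ‖r‖ ≤ ‖Ring.inverse (B y)‖ * (‖fderiv ℝ B y‖ * ‖v‖) := by
      rw [hr_eq]
      exact (norm_mul_le _ _).trans (by gcongr; exact ContinuousLinearMap.le_opNorm _ _)
    have n2 : ‖m‖ ≤ ‖expOp (-(res (b y)))‖ * (‖fderiv ℝ G y‖ * ‖v‖) :=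
      (norm_mul_le _ _).trans (by gcongr; exact ContinuousLinearMap.le_opNorm _ _)
    calc ‖fderiv ℝ c y v‖ ≤ ‖q‖ * ‖c y * r - m * c y‖ := by
          rw [hdc3]
          exact q.le_opNorm _
      _ ≤ ‖q‖ * (‖c y‖ * ‖r‖ + ‖m‖ * ‖c y‖) := by
          gcongr
          exact (norm_sub_le _ _).trans (add_le_add (norm_mul_le _ _) (norm_mul_le _ _))
      _ ≤ ‖q‖ * (‖c y‖ * (‖Ring.inverse (B y)‖ * (‖fderiv ℝ B y‖ * ‖v‖))
            + (‖expOp (-(res (b y)))‖ * (‖fderiv ℝ G y‖ * ‖v‖)) * ‖c y‖) := by gcongr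
      _ = K y * ‖c y‖ * ‖v‖ := by simp only [K]; ring
      _ ≤ (K y₀ + 1) * ‖c y‖ * ‖v‖ := by gcongr
  refine ⟨b, hb, hb0, ?_⟩
  filter_upwards [hBeq, hc_zero] with y h2 h3
  refine ⟨(hbmem y).1, fun w => ?_⟩
  rw [h2, h3, add_zero, mul_one, ← expOp_intertwine (fun w => hresj _ (hbmem y) w)]
  exact expOp_neg_apply _ _

end SpencerData

namespace SpencerData

/-! ### Comparison of the curvatures of two connections -/

section

variable {E W : Type*} [NormedAddCommGroup E] [NormedSpace ℝ E]
    [NormedAddCommGroup W] [NormedSpace ℝ W] (S : SpencerData E W)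

/-- If a linear function `L` takes the same values on two forms, then it does so on their
derivatives. -/
theorem clm_fderiv_congr {X Y : Type*} [NormedAddCommGroup X] [NormedSpace ℝ X]
    [NormedAddCommGroup Y] [NormedSpace ℝ Y] {η η' : X → W →L[ℝ] E} {y : X} (L : E →L[ℝ] Y)
    (hη : DifferentiableAt ℝ η y) (hη' : DifferentiableAt ℝ η' y)
    (h : ∀ᶠ z in 𝓝 y, ∀ v, L (η z v) = L (η' z v)) (v : X) (w : W) :
    L (fderiv ℝ η y v w) = L (fderiv ℝ η' y v w) := by
  have := clm_fderiv_eq_zero (L.comp (ContinuousLinearMap.apply ℝ E w)) (hη.sub hη')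
    (h.mono fun z hz => by simp [hz w]) v
  rw [fderiv_sub hη hη'] at this
  simpa [sub_eq_zero] using this

/-- The difference of the components of degree `-1` of the curvatures of two forms with the same
component of degree `-1`. -/
theorem pr_neg_curv_sub {η η' : W → W →L[ℝ] E} {y : W} (hη : DifferentiableAt ℝ η y)
    (hη' : DifferentiableAt ℝ η' y)
    (h : ∀ᶠ z in 𝓝 y, ∀ v, S.pr (-1) (η z v) = S.pr (-1) (η' z v)) (v w : W) :
    S.pr (-1) (S.curv η y v w) - S.pr (-1) (S.curv η' y v w)
      = S.br (S.pr 0 ((η y - η' y) v)) (S.pr (-1) (η y w))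
        - S.br (S.pr 0 ((η y - η' y) w)) (S.pr (-1) (η y v)) := by
  have h0 := h.self_of_nhds
  simp only [curv, map_add, map_sub, S.pr_br_neg, clm_fderiv_congr (S.pr (-1)) hη hη' h,
    ← h0, _root_.sub_apply]
  rw [S.br_comm (S.pr 0 (η y w)), S.br_comm (S.pr 0 (η' y w))]
  abel

/-- The difference of the components of degree `0` of the curvatures of two forms with the same
components of degrees `-1` and `0`. -/
theorem pr_zero_curv_sub {η η' : W → W →L[ℝ] E} {y : W} (hη : DifferentiableAt ℝ η y)
    (hη' : DifferentiableAt ℝ η' y)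
    (h : ∀ᶠ z in 𝓝 y, ∀ v, S.pr (-1) (η z v) = S.pr (-1) (η' z v))
    (h' : ∀ᶠ z in 𝓝 y, ∀ v, S.pr 0 (η z v) = S.pr 0 (η' z v)) (v w : W) :
    S.pr 0 (S.curv η y v w) - S.pr 0 (S.curv η' y v w)
      = S.br (S.pr 1 ((η y - η' y) v)) (S.pr (-1) (η y w))
        - S.br (S.pr 1 ((η y - η' y) w)) (S.pr (-1) (η y v)) := by
  have h0 := h.self_of_nhds
  have h1 := h'.self_of_nhds
  simp only [curv, map_add, map_sub, S.pr_br_zero, clm_fderiv_congr (S.pr 0) hη hη' h',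
    ← h0, ← h1, _root_.sub_apply]
  rw [S.br_comm (S.pr 1 (η y w)), S.br_comm (S.pr 1 (η' y w))]
  abel

end

variable {E W : Type*} [NormedAddCommGroup E] [NormedSpace ℝ E] [CompleteSpace E]
    [NormedAddCommGroup W] [NormedSpace ℝ W] [CompleteSpace W] (S : SpencerData E W)
    [FiniteDimensional ℝ E] [FiniteDimensional ℝ W] [Nontrivial W]

/-- A change of the frame field `τ` by `B` can be undone, as regards the component of degree `-1`,
by a gauge transformation of degree `0` which is trivial at `y₀`. -/
theorem exists_gauge_zero {B τ τ' : W → W →L[ℝ] W} {y₀ : W} (hB : SmoothNear B y₀) (h1 : B y₀ = 1)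
    (hd : ∀ᶠ y in 𝓝 y₀, ∀ v, ∃ r ∈ S.inner, fderiv ℝ B y v = B y * r)
    {η η' : W → W →L[ℝ] E} (hη : SmoothNear η y₀)
    (hτ : ∀ᶠ y in 𝓝 y₀, ∀ w, S.pr (-1) (η y (τ y w)) = S.j w)
    (hτ' : ∀ᶠ y in 𝓝 y₀, ∀ w, S.pr (-1) (η' y (τ' y w)) = S.j w)
    (hsurj : ∀ᶠ y in 𝓝 y₀, Function.Surjective (τ' y))
    (hττ' : ∀ᶠ y in 𝓝 y₀, ∀ w, τ' y w = τ y (B y w)) :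
    ∃ η₁ : W → W →L[ℝ] E, SmoothNear η₁ y₀ ∧
      (∀ᶠ y in 𝓝 y₀, ∀ v, S.pr (-1) (η' y v) = S.pr (-1) (η₁ y v)) ∧
      (∀ v w, S.curv η₁ y₀ v w = S.curv η y₀ v w) ∧
      ((∀ᶠ y in 𝓝 y₀, ∀ v w, S.pr (-1) (S.curv η y v w) = 0) →
        ∀ᶠ y in 𝓝 y₀, ∀ v w, S.pr (-1) (S.curv η₁ y v w) = 0) ∧
      ((∀ᶠ y in 𝓝 y₀, ∀ v w, S.pr 0 (S.curv η y v w) = 0) →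
        ∀ᶠ y in 𝓝 y₀, ∀ v w, S.pr 0 (S.curv η₁ y v w) = 0) := by
  obtain ⟨b, hb, hb0, hbB⟩ := S.exists_gauge hB h1 hd
  obtain ⟨hΦ, μ, hμ, hμ_mem, hμd⟩ := S.exists_maurerCartan (k := 0) (Or.inl rfl) hb
    (hbB.mono fun y hy => hy.1)
  have hμ_neg : ∀ᶠ y in 𝓝 y₀, ∀ v, S.pr (-1) (μ y v) = 0 := hμ_mem.mono fun y hy v =>
    S.pr_of_mem_ne _ _ _ (by norm_num) (hy v)
  have hcurv : ∀ᶠ y in 𝓝 y₀, ∀ v w,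
      S.curv (fun z => (S.gauge (b z)).comp (η z) + μ z) y v w
        = S.gauge (b y) (S.curv η y v w) := by
    filter_upwards [hη, hμ, hΦ.eventually, eventually_eventually_nhds.2 hμ_neg,
      eventually_eventually_nhds.2 hμd] with y a1 a2 a3 a4 a5 v w
    exact S.curv_gauge (a1.differentiableAt (by simp)) (a2.differentiableAt (by simp)) a3
      (S.gauge_br _) (S.gauge_surjective _) a4 a5 v w
  refine ⟨fun z => (S.gauge (b z)).comp (η z) + μ z, (hΦ.clm_comp hη).add hμ, ?_, ?_, ?_, ?_⟩
  · filter_upwards [hbB, hτ, hτ', hsurj, hττ', hμ_neg] with y a1 a2 a3 a4 a5 a6 v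
    obtain ⟨w, rfl⟩ := a4 v
    rw [a3, _root_.add_apply, map_add, a6, add_zero, ContinuousLinearMap.comp_apply,
      (S.pr_gauge_of_mem_zero a1.1 _).1, a5, a2, a1.2]
  · intro v w
    rw [hcurv.self_of_nhds, hb0, S.gauge_zero]
    rfl
  · intro h
    filter_upwards [hcurv, h, hbB] with y a1 a2 a3 v w
    rw [a1, (S.pr_gauge_of_mem_zero a3.1 _).1, a2, map_zero]
  · intro h
    filter_upwards [hcurv, h, hbB] with y a1 a2 a3 v w
    rw [a1, (S.pr_gauge_of_mem_zero a3.1 _).2.1, a2, map_zero]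

omit [CompleteSpace W] in
/-- Two forms with the same component of degree `-1`, whose curvatures vanish in degree `-1`, have
the same component of degree `0` up to a gauge transformation of degree `1`. -/
theorem exists_gauge_one {τ' : W → W →L[ℝ] W} {y₀ : W} (hτ's : SmoothNear τ' y₀)
    {η η' : W → W →L[ℝ] E} (hη : SmoothNear η y₀) (hη' : SmoothNear η' y₀)
    (hτ' : ∀ᶠ y in 𝓝 y₀, ∀ w, S.pr (-1) (η' y (τ' y w)) = S.j w)
    (hsurj : ∀ᶠ y in 𝓝 y₀, Function.Surjective (τ' y))
    (heq : ∀ᶠ y in 𝓝 y₀, ∀ v, S.pr (-1) (η' y v) = S.pr (-1) (η y v))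
    (hc : ∀ᶠ y in 𝓝 y₀, ∀ v w, S.pr (-1) (S.curv η y v w) = 0)
    (hc' : ∀ᶠ y in 𝓝 y₀, ∀ v w, S.pr (-1) (S.curv η' y v w) = 0) :
    ∃ η₁ : W → W →L[ℝ] E, SmoothNear η₁ y₀ ∧
      (∀ᶠ y in 𝓝 y₀, ∀ v, S.pr (-1) (η' y v) = S.pr (-1) (η₁ y v)) ∧
      (∀ᶠ y in 𝓝 y₀, ∀ v, S.pr 0 (η' y v) = S.pr 0 (η₁ y v)) ∧
      (∀ᶠ y in 𝓝 y₀, ∀ v w, S.pr 0 (S.curv η₁ y v w) = S.pr 0 (S.curv η y v w)) ∧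
      ((∀ v w, S.pr 0 (S.curv η y₀ v w) = 0) →
        ∀ v w, S.curv η₁ y₀ v w = S.curv η y₀ v w) := by
  -- a left inverse of `X ↦ ad X|_W` on `gr 1`, so that the element `X` provided by the vanishing of
  -- `H^{1,1}` depends smoothly on the point
  obtain ⟨l, hl, hlmem⟩ : ∃ l : (W →L[ℝ] E) →L[ℝ] E,
      (∀ X ∈ S.gr 1, l ((S.br X).comp S.j) = X) ∧ ∀ r, l r ∈ S.gr 1 := by
    let f : S.gr 1 →ₗ[ℝ] (W →L[ℝ] E) :=
      ((ContinuousLinearMap.compL ℝ W E E).flip S.j).toLinearMap ∘ₗ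
        S.br.toLinearMap ∘ₗ (S.gr 1).subtype
    have hf : LinearMap.ker f = ⊥ := LinearMap.ker_eq_bot'.2 fun X hX =>
      Subtype.ext (S.eq_zero_of_mem_one X.2 fun w => DFunLike.congr_fun hX w)
    obtain ⟨g, hg⟩ := f.exists_leftInverse_of_injective hf
    refine ⟨LinearMap.toContinuousLinearMap ((Submodule.subtype _) ∘ₗ g), fun X hX => ?_,
      fun r => (g r).2⟩
    exact congrArg Subtype.val (DFunLike.congr_fun hg ⟨X, hX⟩)
  -- by `H^{1,1} = 0`, the difference of the components of degree `0` is `ad X|_W` with `X = -b`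
  let b : W → E := fun y => -(l (((S.pr 0).comp (η' y - η y)).comp (τ' y)))
  have hb : SmoothNear b y₀ :=
    ((((smoothNear_const (S.pr 0)).clm_comp (hη'.sub hη)).clm_comp hτ's).clm l).neg
  have hbmem : ∀ y, b y ∈ S.gr 1 := fun y => (S.gr 1).neg_mem (hlmem _)
  have hbeq : ∀ᶠ y in 𝓝 y₀, ∀ v,
      S.pr 0 (η' y v) = S.pr 0 (η y v) - S.br (b y) (S.pr (-1) (η y v)) := by
    filter_upwards [hη, hη', hτ', hsurj, eventually_eventually_nhds.2 heq, hc, hc']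
      with y a1 a2 a3 a4 a5 a6 a7 v
    have a8 := S.pr_neg_curv_sub (a2.differentiableAt (by simp)) (a1.differentiableAt (by simp)) a5
    obtain ⟨X, hX, hX'⟩ := S.H11 (((S.pr 0).comp (η' y - η y)).comp (τ' y))
      (fun w => S.pr_mem _ _) (fun v w => by
        have := a8 (τ' y v) (τ' y w)
        rw [a6, a7, a3, a3, sub_zero, eq_comm, sub_eq_zero] at this
        exact this)
    have hXb : b y = -X := by
      simp only [b]
      congr 1
      rw [← hl X hX]
      congr 1
      exact ContinuousLinearMap.ext hX'
    obtain ⟨w, rfl⟩ := a4 v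
    have := hX' w
    rw [ContinuousLinearMap.comp_apply, ContinuousLinearMap.comp_apply, _root_.sub_apply,
      map_sub, sub_eq_iff_eq_add] at this
    rw [this, hXb, ← a5.self_of_nhds, a3]
    simp [add_comm]
  obtain ⟨hΦ, μ, hμ, hμ_mem, hμd⟩ := S.exists_maurerCartan (k := 1) (Or.inr rfl) hb
    (Eventually.of_forall hbmem)
  have hμ_neg : ∀ᶠ y in 𝓝 y₀, ∀ v, S.pr (-1) (μ y v) = 0 := hμ_mem.mono fun y hy v =>
    S.pr_of_mem_ne _ _ _ (by norm_num) (hy v)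
  have hμ_zero : ∀ᶠ y in 𝓝 y₀, ∀ v, S.pr 0 (μ y v) = 0 := hμ_mem.mono fun y hy v =>
    S.pr_of_mem_ne _ _ _ (by norm_num) (hy v)
  have hcurv : ∀ᶠ y in 𝓝 y₀, ∀ v w,
      S.curv (fun z => (S.gauge (b z)).comp (η z) + μ z) y v w
        = S.gauge (b y) (S.curv η y v w) := by
    filter_upwards [hη, hμ, hΦ.eventually, eventually_eventually_nhds.2 hμ_neg,
      eventually_eventually_nhds.2 hμd] with y a1 a2 a3 a4 a5 v w
    exact S.curv_gauge (a1.differentiableAt (by simp)) (a2.differentiableAt (by simp)) a3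
      (S.gauge_br _) (S.gauge_surjective _) a4 a5 v w
  refine ⟨fun z => (S.gauge (b z)).comp (η z) + μ z, (hΦ.clm_comp hη).add hμ, ?_, ?_, ?_, ?_⟩
  · filter_upwards [heq, hμ_neg] with y a1 a2 v
    rw [_root_.add_apply, map_add, a2, add_zero, ContinuousLinearMap.comp_apply,
      S.pr_neg_gauge_of_mem_one (hbmem y), a1]
  · filter_upwards [hbeq, hμ_zero] with y a1 a2 v
    rw [_root_.add_apply, map_add, a2, add_zero, ContinuousLinearMap.comp_apply,
      S.pr_zero_gauge_of_mem_one (hbmem y), a1]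
  · filter_upwards [hcurv, hc] with y a1 a2 v w
    rw [a1, S.pr_zero_gauge_of_mem_one (hbmem y), a2, map_zero, sub_zero]
  · intro h v w
    rw [hcurv.self_of_nhds]
    refine S.gauge_apply_of_br_eq_zero ?_
    have h2 : S.curv η y₀ v w = S.pr 1 (S.curv η y₀ v w) := by
      conv_lhs => rw [S.sum_pr (S.curv η y₀ v w), hc.self_of_nhds, h]
      simp
    rw [h2]
    exact S.br_eq_zero (by norm_num) (hbmem _) (S.pr_mem _ _)

section Invariance

variable {B τ τ' : W → W →L[ℝ] W} {y₀ : W} (hB : SmoothNear B y₀) (h1 : B y₀ = 1)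
    (hd : ∀ᶠ y in 𝓝 y₀, ∀ v, ∃ r ∈ S.inner, fderiv ℝ B y v = B y * r)
    {η η' : W → W →L[ℝ] E} (hη : SmoothNear η y₀) (hη' : SmoothNear η' y₀)
    (hτ's : SmoothNear τ' y₀)
    (hτ : ∀ᶠ y in 𝓝 y₀, ∀ w, S.pr (-1) (η y (τ y w)) = S.j w)
    (hτ' : ∀ᶠ y in 𝓝 y₀, ∀ w, S.pr (-1) (η' y (τ' y w)) = S.j w)
    (hsurj : ∀ᶠ y in 𝓝 y₀, Function.Surjective (τ' y))
    (hττ' : ∀ᶠ y in 𝓝 y₀, ∀ w, τ' y w = τ y (B y w))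

include hB h1 hd hη hη' hτ hτ' hsurj hττ'

/-- Invariance of the class in `H^{0,2}` of the curvature. -/
theorem curv_class_zero : ∃ c : W →L[ℝ] E, (∀ w, c w ∈ S.gr 0) ∧ ∀ v w,
    S.pr (-1) (S.curv η' y₀ (τ' y₀ v) (τ' y₀ w)) - S.pr (-1) (S.curv η y₀ (τ' y₀ v) (τ' y₀ w))
      = S.br (c v) (S.j w) - S.br (c w) (S.j v) := by
  obtain ⟨η₁, hη₁, e1, e2, -⟩ := S.exists_gauge_zero hB h1 hd hη hτ hτ' hsurj hττ'
  refine ⟨((S.pr 0).comp (η' y₀ - η₁ y₀)).comp (τ' y₀), fun w => S.pr_mem _ _, fun v w => ?_⟩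
  rw [← e2, S.pr_neg_curv_sub hη'.differentiableAt hη₁.differentiableAt e1, hτ'.self_of_nhds,
    hτ'.self_of_nhds]
  rfl

include hτ's

/-- Invariance of the class in `H^{1,2}` of the curvature. -/
theorem curv_class_one (hc : ∀ᶠ y in 𝓝 y₀, ∀ v w, S.pr (-1) (S.curv η y v w) = 0)
    (hc' : ∀ᶠ y in 𝓝 y₀, ∀ v w, S.pr (-1) (S.curv η' y v w) = 0) :
    ∃ c : W →L[ℝ] E, (∀ w, c w ∈ S.gr 1) ∧ ∀ v w,
    S.pr 0 (S.curv η' y₀ (τ' y₀ v) (τ' y₀ w)) - S.pr 0 (S.curv η y₀ (τ' y₀ v) (τ' y₀ w))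
      = S.br (c v) (S.j w) - S.br (c w) (S.j v) := by
  obtain ⟨η₁, hη₁, e1, e2, e3, -⟩ := S.exists_gauge_zero hB h1 hd hη hτ hτ' hsurj hττ'
  obtain ⟨η₂, hη₂, f1, f2, f3, -⟩ := S.exists_gauge_one hτ's hη₁ hη' hτ' hsurj e1 (e3 hc) hc'
  refine ⟨((S.pr 1).comp (η' y₀ - η₂ y₀)).comp (τ' y₀), fun w => S.pr_mem _ _, fun v w => ?_⟩
  rw [← e2, ← f3.self_of_nhds, S.pr_zero_curv_sub hη'.differentiableAt hη₂.differentiableAt f1 f2,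
    hτ'.self_of_nhds, hτ'.self_of_nhds]
  rfl

/-- Invariance of the class in `H^{2,2}` of the curvature, where there are no coboundaries. -/
theorem curv_class_two (hc : ∀ᶠ y in 𝓝 y₀, ∀ v w, S.pr (-1) (S.curv η y v w) = 0)
    (hc' : ∀ᶠ y in 𝓝 y₀, ∀ v w, S.pr (-1) (S.curv η' y v w) = 0)
    (hc0 : ∀ᶠ y in 𝓝 y₀, ∀ v w, S.pr 0 (S.curv η y v w) = 0)
    (hc0' : ∀ᶠ y in 𝓝 y₀, ∀ v w, S.pr 0 (S.curv η' y v w) = 0) (v w : W) :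
    S.curv η' y₀ v w = S.curv η y₀ v w := by
  obtain ⟨η₁, hη₁, e1, e2, e3, e4⟩ := S.exists_gauge_zero hB h1 hd hη hτ hτ' hsurj hττ'
  obtain ⟨η₂, hη₂, f1, f2, f3, f4⟩ := S.exists_gauge_one hτ's hη₁ hη' hτ' hsurj e1 (e3 hc) hc'
  -- the components of degree `1` agree since `H^{2,1} = 0`
  have hη₂' : η' =ᶠ[𝓝 y₀] η₂ := by
    filter_upwards [hη', hη₂, eventually_eventually_nhds.2 f1, eventually_eventually_nhds.2 f2, f3,
      e4 hc0, hc0', hτ', hsurj] with y a1 a2 a3 a4 a5 a6 a7 a8 a9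
    have a10 := S.pr_zero_curv_sub (a1.differentiableAt (by simp)) (a2.differentiableAt (by simp))
      a3 a4
    have a11 := S.H21 (((S.pr 1).comp (η' y - η₂ y)).comp (τ' y)) (fun w => S.pr_mem _ _)
      (fun v w => by
        have := a10 (τ' y v) (τ' y w)
        rw [a7, a5, a6, a8, a8, sub_zero, eq_comm, sub_eq_zero] at this
        exact this)
    ext v
    obtain ⟨w, rfl⟩ := a9 v
    refine S.ext_pr (a3.self_of_nhds _) (a4.self_of_nhds _) ?_
    have := DFunLike.congr_fun a11 w
    simpa [sub_eq_zero] using this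
  rw [S.curv_congr hη₂', f4 (e4 hc0).self_of_nhds, e2]

end Invariance

end SpencerData

/-! ### Maps of constant rank -/

section ConstantRank

variable {X Y : Type*} [NormedAddCommGroup X] [NormedSpace ℝ X] [FiniteDimensional ℝ X]
  [NormedAddCommGroup Y] [NormedSpace ℝ Y] [FiniteDimensional ℝ Y]

/-- If the rank of the differential of `F` is maximal at `x₀`, then near `x₀` the map `F` factors
through a submersion onto the range `R` of its differential at `x₀`, and through an immersion of
`R`. -/
theorem exists_factor_of_constant_rank {F : X → Y} {x₀ : X} (hF : ContDiffAt ℝ 1 F x₀)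
    (hrank : ∀ᶠ x in 𝓝 x₀, Module.finrank ℝ (LinearMap.range (fderiv ℝ F x).toLinearMap)
      ≤ Module.finrank ℝ (LinearMap.range (fderiv ℝ F x₀).toLinearMap)) :
    ∃ (π : Y →L[ℝ] LinearMap.range (fderiv ℝ F x₀).toLinearMap)
      (h : LinearMap.range (fderiv ℝ F x₀).toLinearMap → Y)
      (h' : LinearMap.range (fderiv ℝ F x₀).toLinearMap →L[ℝ] Y),
      (∀ᶠ x in 𝓝 x₀, F x = h (π (F x))) ∧ HasFDerivAt h h' (π (F x₀)) ∧
      ∀ r, h' r ∈ LinearMap.range (fderiv ℝ F x₀).toLinearMap := by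
  have : CompleteSpace X := FiniteDimensional.complete ℝ X
  set R := LinearMap.range (fderiv ℝ F x₀).toLinearMap with hR
  set K := LinearMap.ker (fderiv ℝ F x₀).toLinearMap with hK
  obtain ⟨π₀, hπ₀⟩ := LinearMap.exists_leftInverse_of_injective R.subtype R.ker_subtype
  obtain ⟨ρ₀, hρ₀⟩ := LinearMap.exists_leftInverse_of_injective K.subtype K.ker_subtype
  set π : Y →L[ℝ] R := LinearMap.toContinuousLinearMap π₀ with hπdef
  set ρ : X →L[ℝ] K := LinearMap.toContinuousLinearMap ρ₀ with hρdef
  have hπ : ∀ r : R, π r = r := fun r => LinearMap.congr_fun hπ₀ r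
  have hρ : ∀ r : K, ρ r = r := fun r => LinearMap.congr_fun hρ₀ r
  set Φ' : X →L[ℝ] R × K := (π.comp (fderiv ℝ F x₀)).prod ρ with hΦ'
  have hinj : Function.Injective Φ' := by
    refine (injective_iff_map_eq_zero Φ').2 fun x hx => ?_
    have h1 : π (fderiv ℝ F x₀ x) = 0 := congrArg Prod.fst hx
    have h2 : ρ x = 0 := congrArg Prod.snd hx
    have h3 : (⟨fderiv ℝ F x₀ x, ⟨x, rfl⟩⟩ : R) = 0 :=
      (hπ ⟨fderiv ℝ F x₀ x, ⟨x, rfl⟩⟩).symm.trans h1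
    have h4 : fderiv ℝ F x₀ x = 0 := congrArg Subtype.val h3
    have h5 := hρ ⟨x, h4⟩
    rw [h2] at h5
    exact (congrArg Subtype.val h5).symm
  have hdim : Module.finrank ℝ X = Module.finrank ℝ (R × K) := by
    rw [Module.finrank_prod]
    exact (LinearMap.finrank_range_add_finrank_ker (fderiv ℝ F x₀).toLinearMap).symm
  let e : X ≃L[ℝ] R × K :=
    (LinearEquiv.ofInjectiveOfFinrankEq Φ'.toLinearMap hinj hdim).toContinuousLinearEquiv
  have he : (e : X →L[ℝ] R × K) = Φ' := by ext x <;> rfl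
  -- coordinates of `X` in which `π ∘ F` is the projection onto `R`
  let Φ : X → R × K := fun x => (π (F x), ρ x)
  have hΦc : ContDiffAt ℝ 1 Φ x₀ :=
    (π.contDiff.contDiffAt.comp x₀ hF).prodMk ρ.contDiff.contDiffAt
  have hΦd : HasFDerivAt Φ (e : X →L[ℝ] R × K) x₀ := by
    rw [he]
    exact (π.hasFDerivAt.comp x₀ (hF.differentiableAt (by simp)).hasFDerivAt).prodMk ρ.hasFDerivAt
  have hs : HasStrictFDerivAt Φ (e : X →L[ℝ] R × K) x₀ := hΦc.hasStrictFDerivAt' hΦd (by simp)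
  obtain ⟨g, hg, hg0, hgl, hgr⟩ : ∃ g : R × K → X, ContDiffAt ℝ 1 g (Φ x₀) ∧ g (Φ x₀) = x₀ ∧
      (∀ᶠ x in 𝓝 x₀, g (Φ x) = x) ∧ ∀ᶠ z in 𝓝 (Φ x₀), Φ (g z) = z :=
    ⟨hΦc.localInverse hΦd (by simp), hΦc.to_localInverse hΦd (by simp),
      hΦc.localInverse_apply_image hΦd (by simp), hs.eventually_left_inverse,
      hs.eventually_right_inverse⟩
  have hgx : Tendsto g (𝓝 (Φ x₀)) (𝓝 x₀) := by
    have := hg.continuousAt.tendsto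
    rwa [hg0] at this
  have hall := ((hg.eventually (by simp)).and (hgx.eventually (hF.eventually (by simp)))).and
    ((hgx.eventually hrank).and hgr.eventually_nhds)
  obtain ⟨ε, hε, hball⟩ := Metric.eventually_nhds_iff_ball.1 hall
  let G : R × K → Y := fun z => F (g z)
  have hG : ∀ z ∈ Metric.ball (Φ x₀) ε,
      HasFDerivAt G ((fderiv ℝ F (g z)).comp (fderiv ℝ g z)) z := fun z hz =>
    ((hball z hz).1.2.differentiableAt (by simp)).hasFDerivAt.comp z
      ((hball z hz).1.1.differentiableAt (by simp)).hasFDerivAt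
  -- `π` maps the range of `dF` onto `R`; since the rank of `dF` is at most `dim R`, `π` is
  -- injective on this range, and so `F` does not vary along the fibres of `π ∘ F`
  have hGb : ∀ z ∈ Metric.ball (Φ x₀) ε, ∀ b : K,
      (fderiv ℝ F (g z)).comp (fderiv ℝ g z) (0, b) = 0 := by
    intro z hz b
    obtain ⟨-, hrz, hrr⟩ := hball z hz
    have h1 : π.comp ((fderiv ℝ F (g z)).comp (fderiv ℝ g z)) = ContinuousLinearMap.fst ℝ R K := by
      have h2 : HasFDerivAt (fun z => π (G z))
          (π.comp ((fderiv ℝ F (g z)).comp (fderiv ℝ g z))) z :=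
        π.hasFDerivAt.comp z (hG z hz)
      refine h2.unique (HasFDerivAt.congr_of_eventuallyEq
        (ContinuousLinearMap.fst ℝ R K).hasFDerivAt ?_)
      filter_upwards [hrr] with z' hz'
      exact congrArg Prod.fst hz'
    let πz : LinearMap.range (fderiv ℝ F (g z)).toLinearMap →ₗ[ℝ] R :=
      π.toLinearMap ∘ₗ (LinearMap.range (fderiv ℝ F (g z)).toLinearMap).subtype
    have hsurj : Function.Surjective πz := fun r =>
      ⟨⟨fderiv ℝ F (g z) (fderiv ℝ g z (r, 0)), ⟨_, rfl⟩⟩, congrArg (fun L => L (r, (0 : K))) h1⟩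
    have hfr := le_antisymm hrz (LinearMap.finrank_le_finrank_of_surjective hsurj)
    have hinjz := (LinearMap.injective_iff_surjective_of_finrank_eq_finrank hfr).2 hsurj
    have h3 : πz ⟨fderiv ℝ F (g z) (fderiv ℝ g z (0, b)), ⟨_, rfl⟩⟩ = 0 :=
      congrArg (fun L => L ((0 : R), b)) h1
    exact congrArg Subtype.val (hinjz (h3.trans (map_zero πz).symm))
  have hmem0 : Φ x₀ ∈ Metric.ball (Φ x₀) ε := Metric.mem_ball_self hε
  have hconst : ∀ a : R, ∀ b : K, (a, b) ∈ Metric.ball (Φ x₀) ε → G (a, b) = G (a, (Φ x₀).2) := by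
    intro a b hab
    rw [← ball_prod_same, Set.mem_prod] at hab
    have hin : ∀ b' ∈ Metric.ball (Φ x₀).2 ε, (a, b') ∈ Metric.ball (Φ x₀) ε := fun b' hb' => by
      rw [← ball_prod_same]
      exact ⟨hab.1, hb'⟩
    have hd : ∀ b' ∈ Metric.ball (Φ x₀).2 ε,
        HasFDerivAt (fun b' => G (a, b')) (0 : K →L[ℝ] Y) b' := by
      intro b' hb'
      have h1 := (hG _ (hin b' hb')).comp b' (hasFDerivAt_prodMk_right a b')
      convert! h1 using 1
      ext c
      exact (hGb _ (hin b' hb') c).symm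
    exact Metric.isOpen_ball.is_const_of_fderiv_eq_zero
      (convex_ball _ _).isPreconnected
      (fun b' hb' => (hd b' hb').differentiableAt.differentiableWithinAt)
      (fun b' hb' => (hd b' hb').fderiv) hab.2 (Metric.mem_ball_self hε)
  have hh : HasFDerivAt (fun a => G (a, (Φ x₀).2)) (((fderiv ℝ F (g (Φ x₀))).comp
      (fderiv ℝ g (Φ x₀))).comp (ContinuousLinearMap.inl ℝ R K)) (Φ x₀).1 :=
    HasFDerivAt.comp (g := G) (Φ x₀).1 (hG (Φ x₀) hmem0)
      (hasFDerivAt_prodMk_left (Φ x₀).1 (Φ x₀).2)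
  refine ⟨π, fun a => G (a, (Φ x₀).2), _, ?_, hh, ?_⟩
  · filter_upwards [hgl, hΦc.continuousAt.eventually (Metric.ball_mem_nhds _ hε)] with x hx hxb
    have h1 := hconst (Φ x).1 (Φ x).2 hxb
    rw [← h1]
    exact congrArg F hx.symm
  · intro r
    refine ⟨fderiv ℝ g (Φ x₀) (r, 0), ?_⟩
    simp [hg0]

/-- Limits of difference quotients of a map of constant rank are tangent to its image, even where
the points themselves do not have a direction of approach. -/
theorem mem_range_of_constant_rank {F : X → Y} {x₀ : X} (hF : ContDiffAt ℝ 1 F x₀)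
    (hrank : ∀ᶠ x in 𝓝 x₀, Module.finrank ℝ (LinearMap.range (fderiv ℝ F x).toLinearMap)
      ≤ Module.finrank ℝ (LinearMap.range (fderiv ℝ F x₀).toLinearMap))
    {ι : Type*} {l : Filter ι} [l.NeBot] {x : ι → X} {c : ι → ℝ} {y : Y}
    (hx : Tendsto x l (𝓝 x₀))
    (hy : Tendsto (fun i => c i • (F (x i) - F x₀)) l (𝓝 y)) :
    y ∈ LinearMap.range (fderiv ℝ F x₀).toLinearMap := by
  obtain ⟨π, h, h', h1, h2, h3⟩ := exists_factor_of_constant_rank hF hrank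
  have h4 : Tendsto (fun i => c i • (π (F (x i)) - π (F x₀))) l (𝓝 (π y)) := by
    refine ((π.continuous.tendsto y).comp hy).congr fun i => ?_
    simp
  have h0 : Tendsto (fun i => π (F (x i)) - π (F x₀)) l (𝓝 0) := by
    have h7 := ((π.continuous.continuousAt.comp hF.continuousAt).tendsto.comp hx).sub_const
      (π (F x₀))
    simpa using h7
  have h5 := (h2.hasFDerivWithinAt (s := Set.univ)).lim (l := l) (c := c)
    (d := fun i => π (F (x i)) - π (F x₀)) h0 (by simp) h4
  have h6 : Tendsto (fun i => c i • (F (x i) - F x₀)) l (𝓝 (h' (π y))) := by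
    refine h5.congr' ?_
    filter_upwards [hx.eventually h1] with i hi
    rw [add_sub_cancel, ← hi, ← h1.self_of_nhds]
  rw [tendsto_nhds_unique hy h6]
  exact h3 _

end ConstantRank

/-! ### Local group actions -/

section LocalAction

variable {E V W : Type*} [NormedAddCommGroup E] [NormedSpace ℝ E]
  [NormedAddCommGroup V] [NormedSpace ℝ V] [NormedAddCommGroup W] [NormedSpace ℝ W]

/-- A smooth local action `μ` at `y₀` of a local group with unit `a₀` and multiplication `m`. -/
structure IsLocalAction (m : E × E → E) (μ : E × V → V) (a₀ : E) (y₀ : V) : Prop where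
  smooth_mul : SmoothNear m (a₀, a₀)
  smooth_act : SmoothNear μ (a₀, y₀)
  mul_one : ∀ᶠ a in 𝓝 a₀, m (a, a₀) = a
  one_mul : ∀ᶠ b in 𝓝 a₀, m (a₀, b) = b
  one_act : ∀ᶠ y in 𝓝 y₀, μ (a₀, y) = y
  mul_act : ∀ᶠ q : (E × E) × V in 𝓝 ((a₀, a₀), y₀), μ (m q.1, q.2) = μ (q.1.1, μ (q.1.2, q.2))

/-- The derivative at `(a₀, a₀)` of a product of `a` and `b`, in `b` and then in `a`. -/
def mulSecond (m : E × E → E) (a₀ : E) (X Y : E) : E :=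
  fderiv ℝ (fun a => fderiv ℝ m (a, a₀) (0, Y)) a₀ X

namespace IsLocalAction

variable {m : E × E → E} {μ : E × V → V} {a₀ : E} {y₀ : V} (h : IsLocalAction m μ a₀ y₀)
include h

theorem act_one : μ (a₀, y₀) = y₀ := h.one_act.self_of_nhds

theorem fderiv_mul (b : E) : fderiv ℝ m (a₀, a₀) (0, b) = b := by
  have h1 : HasFDerivAt (fun b => m (a₀, b)) ((fderiv ℝ m (a₀, a₀)).comp
      (ContinuousLinearMap.inr ℝ E E)) a₀ :=
    HasFDerivAt.comp (g := m) a₀ h.smooth_mul.differentiableAt.hasFDerivAt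
      (hasFDerivAt_prodMk_right a₀ a₀)
  have h2 : HasFDerivAt (fun b => m (a₀, b)) (ContinuousLinearMap.id ℝ E) a₀ :=
    (hasFDerivAt_id a₀).congr_of_eventuallyEq h.one_mul
  exact congrArg (fun L => L b) (h1.unique h2)

theorem eventually_mul_act : ∀ᶠ p : E × E in 𝓝 (a₀, a₀),
    ∀ᶠ y in 𝓝 y₀, μ (m p, y) = μ (p.1, μ (p.2, y)) := by
  have h1 := h.mul_act
  rw [nhds_prod_eq] at h1
  exact h1.curry

theorem eventually_smooth_left : ∀ᶠ a in 𝓝 a₀, SmoothNear μ (a, y₀) :=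
  (show ContinuousAt (fun a : E => (a, y₀)) a₀ by fun_prop).eventually h.smooth_act.eventually

theorem tendsto_act : Tendsto (fun b => μ (b, y₀)) (𝓝 a₀) (𝓝 y₀) := by
  have h1 : ContinuousAt μ (a₀, y₀) := h.smooth_act.differentiableAt.continuousAt
  have h2 : ContinuousAt (fun b : E => (b, y₀)) a₀ := by fun_prop
  have h3 : Tendsto (fun b => μ (b, y₀)) (𝓝 a₀) (𝓝 (μ (a₀, y₀))) :=
    (ContinuousAt.comp (g := μ) (f := fun b : E => (b, y₀)) h1 h2).tendsto
  rwa [h.act_one] at h3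

/-- The induced local action on frames at `y₀`. -/
theorem fderiv_mul_act : ∀ᶠ p : E × E in 𝓝 (a₀, a₀),
    (fderiv ℝ μ (m p, y₀)).comp (ContinuousLinearMap.inr ℝ E V)
      = ((fderiv ℝ μ (p.1, μ (p.2, y₀))).comp (ContinuousLinearMap.inr ℝ E V)).comp
        ((fderiv ℝ μ (p.2, y₀)).comp (ContinuousLinearMap.inr ℝ E V)) := by
  have hm : Tendsto m (𝓝 (a₀, a₀)) (𝓝 a₀) := by
    have h1 := h.smooth_mul.differentiableAt.continuousAt.tendsto
    rwa [h.mul_one.self_of_nhds] at h1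
  have hq : Tendsto (fun p : E × E => (p.1, μ (p.2, y₀))) (𝓝 (a₀, a₀)) (𝓝 (a₀, y₀)) := by
    have h1 : Tendsto (fun p : E × E => μ (p.2, y₀)) (𝓝 (a₀, a₀)) (𝓝 y₀) :=
      h.tendsto_act.comp continuousAt_snd.tendsto
    exact ((continuousAt_fst (p := (a₀, a₀))).tendsto).prodMk_nhds h1
  filter_upwards [h.eventually_mul_act, hm.eventually h.eventually_smooth_left,
    hq.eventually h.smooth_act.eventually,
    (continuousAt_snd (p := (a₀, a₀))).tendsto.eventually h.eventually_smooth_left]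
    with p h1 h2 h3 h4
  have e1 : HasFDerivAt (fun y => μ (m p, y)) _ y₀ :=
    HasFDerivAt.comp (g := μ) y₀ h2.differentiableAt.hasFDerivAt (hasFDerivAt_prodMk_right (m p) y₀)
  have e2 : HasFDerivAt (fun y => μ (p.2, y)) _ y₀ :=
    HasFDerivAt.comp (g := μ) y₀ h4.differentiableAt.hasFDerivAt (hasFDerivAt_prodMk_right p.2 y₀)
  have e3 : HasFDerivAt (fun y => μ (p.1, y)) _ (μ (p.2, y₀)) :=
    HasFDerivAt.comp (g := μ) (μ (p.2, y₀)) h3.differentiableAt.hasFDerivAt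
      (hasFDerivAt_prodMk_right p.1 _)
  exact (e1.congr_of_eventuallyEq (h1.mono fun y hy => hy.symm)).unique
    (HasFDerivAt.comp (g := fun y => μ (p.1, y)) (f := fun y => μ (p.2, y)) y₀ e3 e2)

/-- The orbit map of a (possibly degenerate) frame `u` at `y₀`. -/
def _root_.Immersible.frameOrbit (μ : E × V → V) (y₀ : V) (u : W →L[ℝ] V) (a : E) :
    V × (W →L[ℝ] V) :=
  (μ (a, y₀), ((fderiv ℝ μ (a, y₀)).comp (ContinuousLinearMap.inr ℝ E V)).comp u)

theorem smoothNear_frameOrbit (u : W →L[ℝ] V) : SmoothNear (frameOrbit μ y₀ u) a₀ := by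
  have h0 : SmoothNear (fun a : E => (a, y₀)) a₀ :=
    smoothNear_of_contDiff (contDiff_id.prodMk contDiff_const)
  have h1 : SmoothNear (fun a => μ (a, y₀)) a₀ := SmoothNear.comp (g := μ) h.smooth_act h0
  have h2 : SmoothNear (fun a => fderiv ℝ μ (a, y₀)) a₀ :=
    SmoothNear.comp (g := fderiv ℝ μ) h.smooth_act.fderiv h0
  exact h1.prodMk ((h2.clm_comp (smoothNear_const _)).clm_comp (smoothNear_const _))

/-- The orbit map is equivariant, so that its rank is largest at the unit. -/
theorem finrank_range_frameOrbit_le [FiniteDimensional ℝ E] (u : W →L[ℝ] V) : ∀ᶠ a in 𝓝 a₀,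
    Module.finrank ℝ (LinearMap.range (fderiv ℝ (frameOrbit μ y₀ u) a).toLinearMap)
      ≤ Module.finrank ℝ (LinearMap.range (fderiv ℝ (frameOrbit μ y₀ u) a₀).toLinearMap) := by
  have hdiag : ContinuousAt (fun a : E => (a, a₀)) a₀ := by fun_prop
  have hinv : ∀ᶠ a in 𝓝 a₀, ((fderiv ℝ m (a, a₀)).comp (ContinuousLinearMap.inr ℝ E E)) ∈
      {L : E →L[ℝ] E | IsUnit L} := by
    have : CompleteSpace E := FiniteDimensional.complete ℝ E
    have h1 : ContinuousAt (fun a : E => (fderiv ℝ m (a, a₀)).comp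
        (ContinuousLinearMap.inr ℝ E E)) a₀ :=
      ((ContinuousAt.comp (g := fderiv ℝ m) (f := fun a : E => (a, a₀))
        h.smooth_mul.fderiv.differentiableAt.continuousAt hdiag)).clm_comp continuousAt_const
    refine h1.eventually (Units.isOpen.mem_nhds ?_)
    have h2 : (fderiv ℝ m (a₀, a₀)).comp (ContinuousLinearMap.inr ℝ E E) = 1 :=
      ContinuousLinearMap.ext fun b => h.fderiv_mul b
    simp [h2]
  have hev1 : ∀ᶠ a in 𝓝 a₀, ∀ᶠ b in 𝓝 a₀, μ (m (a, b), y₀) = μ (a, μ (b, y₀)) := by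
    have h1 := h.eventually_mul_act.mono fun p hp => hp.self_of_nhds
    rw [nhds_prod_eq] at h1
    exact h1.curry
  have hev2 := h.fderiv_mul_act
  rw [nhds_prod_eq] at hev2
  filter_upwards [hev1, hev2.curry, hinv, h.mul_one, h.eventually_smooth_left,
    hdiag.eventually h.smooth_mul.eventually, (h.smoothNear_frameOrbit u).eventually]
    with a h1 h2 h3 h4 h5 h6 h7
  -- the action of `a` on frames; the orbit map `F` satisfies `F (a b) = Λ (F b)`
  let Λ : V × (W →L[ℝ] V) → V × (W →L[ℝ] V) := fun q =>
    (μ (a, q.1), ((fderiv ℝ μ (a, q.1)).comp (ContinuousLinearMap.inr ℝ E V)).comp q.2)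
  have hΛ : DifferentiableAt ℝ Λ (frameOrbit μ y₀ u a₀) := by
    have e0 : SmoothNear (fun q : V × (W →L[ℝ] V) => (a, q.1)) (frameOrbit μ y₀ u a₀) :=
      smoothNear_of_contDiff (contDiff_const.prodMk contDiff_fst)
    have e5 : SmoothNear μ ((fun q : V × (W →L[ℝ] V) => (a, q.1)) (frameOrbit μ y₀ u a₀)) := by
      change SmoothNear μ (a, μ (a₀, y₀))
      rwa [h.act_one]
    have e1 : SmoothNear (fun q : V × (W →L[ℝ] V) => μ (a, q.1)) (frameOrbit μ y₀ u a₀) :=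
      SmoothNear.comp (g := μ) e5 e0
    have e2 : SmoothNear (fun q : V × (W →L[ℝ] V) => fderiv ℝ μ (a, q.1)) (frameOrbit μ y₀ u a₀) :=
      SmoothNear.comp (g := fderiv ℝ μ) e5.fderiv e0
    exact (e1.prodMk ((e2.clm_comp (smoothNear_const _)).clm_comp
      (smoothNear_of_contDiff contDiff_snd))).differentiableAt
  have hL : HasFDerivAt (fun b => frameOrbit μ y₀ u (m (a, b)))
      ((fderiv ℝ (frameOrbit μ y₀ u) a).comp ((fderiv ℝ m (a, a₀)).comp
        (ContinuousLinearMap.inr ℝ E E))) a₀ := by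
    refine HasFDerivAt.comp (g := frameOrbit μ y₀ u) (f := fun b => m (a, b)) a₀ ?_
      (HasFDerivAt.comp (g := m) a₀ h6.differentiableAt.hasFDerivAt (hasFDerivAt_prodMk_right a a₀))
    rw [h4]
    exact h7.differentiableAt.hasFDerivAt
  have hR : HasFDerivAt (fun b => Λ (frameOrbit μ y₀ u b))
      ((fderiv ℝ Λ (frameOrbit μ y₀ u a₀)).comp (fderiv ℝ (frameOrbit μ y₀ u) a₀)) a₀ :=
    hΛ.hasFDerivAt.comp a₀ (h.smoothNear_frameOrbit u).differentiableAt.hasFDerivAt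
  have hLR : (fun b => frameOrbit μ y₀ u (m (a, b))) =ᶠ[𝓝 a₀]
      fun b => Λ (frameOrbit μ y₀ u b) := by
    filter_upwards [h1, h2] with b hb1 hb2
    refine Prod.ext hb1 ?_
    change ((fderiv ℝ μ (m (a, b), y₀)).comp (ContinuousLinearMap.inr ℝ E V)).comp u = _
    rw [hb2]
    rfl
  have hEq := hL.unique (hR.congr_of_eventuallyEq hLR)
  have hsurj : Function.Surjective ((fderiv ℝ m (a, a₀)).comp (ContinuousLinearMap.inr ℝ E E)) := by
    obtain ⟨U, hU⟩ := h3
    intro y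
    refine ⟨(↑U⁻¹ : E →L[ℝ] E) y, ?_⟩
    rw [← hU, ← mul_apply_eq_comp, Units.mul_inv]
    rfl
  have hrange : LinearMap.range (fderiv ℝ (frameOrbit μ y₀ u) a).toLinearMap ≤
      (LinearMap.range (fderiv ℝ (frameOrbit μ y₀ u) a₀).toLinearMap).map
        (fderiv ℝ Λ (frameOrbit μ y₀ u a₀)).toLinearMap := by
    rintro _ ⟨x, rfl⟩
    obtain ⟨z, rfl⟩ := hsurj x
    exact ⟨_, ⟨z, rfl⟩, (congrArg (fun L => L z) hEq).symm⟩
  exact (Submodule.finrank_mono hrange).trans (Submodule.finrank_map_le _ _)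

/-- The differential at `y₀` of the field of a local one-parameter group that fixes `y₀` is given
by the bracket. -/
theorem fderiv_act_bracket {X : E} (hX : fderiv ℝ μ (a₀, y₀) (X, 0) = 0) (Y : E) :
    fderiv ℝ μ (a₀, y₀) (mulSecond m a₀ X Y - mulSecond m a₀ Y X, 0)
      = fderiv ℝ (fun a => fderiv ℝ μ (a, y₀)) a₀ X (0, fderiv ℝ μ (a₀, y₀) (Y, 0)) := by
  have h0 : SmoothNear (fun a : E => (a, y₀)) a₀ :=
    smoothNear_of_contDiff (contDiff_id.prodMk contDiff_const)
  have hdiag : SmoothNear (fun a : E => (a, a₀)) a₀ :=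
    smoothNear_of_contDiff (contDiff_id.prodMk contDiff_const)
  have hD : SmoothNear (fun a => fderiv ℝ μ (a, y₀)) a₀ :=
    SmoothNear.comp (g := fderiv ℝ μ) h.smooth_act.fderiv h0
  have hM : ∀ Y : E, SmoothNear (fun a => fderiv ℝ m (a, a₀) (0, Y)) a₀ := fun Y =>
    (SmoothNear.comp (f := fun a : E => (a, a₀)) (g := fderiv ℝ m) h.smooth_mul.fderiv
      hdiag).clm_apply (smoothNear_const _)
  have hev1 : ∀ᶠ a in 𝓝 a₀, ∀ᶠ b in 𝓝 a₀, μ (m (a, b), y₀) = μ (a, μ (b, y₀)) := by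
    have h1 := h.eventually_mul_act.mono fun p hp => hp.self_of_nhds
    rw [nhds_prod_eq] at h1
    exact h1.curry
  -- the derivative in `b` at the unit of the two sides of `(a b) y₀ = a (b y₀)`
  have key : ∀ Y : E, (fun a => fderiv ℝ μ (a, y₀) (fderiv ℝ m (a, a₀) (0, Y), 0)) =ᶠ[𝓝 a₀]
      fun a => fderiv ℝ μ (a, y₀) (0, fderiv ℝ μ (a₀, y₀) (Y, 0)) := by
    intro Y
    filter_upwards [hev1, h.mul_one, h.eventually_smooth_left,
      hdiag.differentiableAt.continuousAt.eventually h.smooth_mul.eventually] with a h1 h2 h3 h4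
    have e1 : HasFDerivAt (fun b => m (a, b)) _ a₀ :=
      HasFDerivAt.comp (g := m) a₀ h4.differentiableAt.hasFDerivAt (hasFDerivAt_prodMk_right a a₀)
    have e2 : HasFDerivAt (fun b => μ (b, y₀)) _ a₀ :=
      HasFDerivAt.comp (g := μ) a₀ h.smooth_act.differentiableAt.hasFDerivAt
        (hasFDerivAt_prodMk_left a₀ y₀)
    have e3 : HasFDerivAt (fun y => μ (a, y)) ((fderiv ℝ μ (a, y₀)).comp
        (ContinuousLinearMap.inr ℝ E V)) (μ (a₀, y₀)) := by
      rw [h.act_one]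
      exact HasFDerivAt.comp (g := μ) y₀ h3.differentiableAt.hasFDerivAt
        (hasFDerivAt_prodMk_right a y₀)
    have e4 : HasFDerivAt (fun x => μ (x, y₀)) ((fderiv ℝ μ (a, y₀)).comp
        (ContinuousLinearMap.inl ℝ E V)) (m (a, a₀)) := by
      rw [h2]
      exact HasFDerivAt.comp (g := μ) a h3.differentiableAt.hasFDerivAt
        (hasFDerivAt_prodMk_left a y₀)
    have e5 := (HasFDerivAt.comp (g := fun x => μ (x, y₀)) a₀ e4 e1).unique
      ((HasFDerivAt.comp (g := fun y => μ (a, y)) a₀ e3 e2).congr_of_eventuallyEq h1)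
    exact congrArg (fun L => L Y) e5
  have der : ∀ X Y : E, fderiv ℝ (fun a => fderiv ℝ μ (a, y₀)) a₀ X (Y, 0)
      + fderiv ℝ μ (a₀, y₀) (mulSecond m a₀ X Y, 0)
      = fderiv ℝ (fun a => fderiv ℝ μ (a, y₀)) a₀ X (0, fderiv ℝ μ (a₀, y₀) (Y, 0)) := by
    intro X Y
    have d1 : HasFDerivAt (fun a => ((fderiv ℝ m (a, a₀) (0, Y), 0) : E × V))
        ((ContinuousLinearMap.inl ℝ E V).comp (fderiv ℝ (fun a => fderiv ℝ m (a, a₀) (0, Y)) a₀))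
        a₀ :=
      (ContinuousLinearMap.inl ℝ E V).hasFDerivAt.comp a₀ (hM Y).differentiableAt.hasFDerivAt
    have d2 := hD.differentiableAt.hasFDerivAt.clm_apply d1
    have d3 := hD.differentiableAt.hasFDerivAt.clm_apply
      (hasFDerivAt_const ((0 : E), fderiv ℝ μ (a₀, y₀) (Y, 0)) a₀)
    have d4 := congrArg (fun L => L X) (d2.unique (d3.congr_of_eventuallyEq (key Y)))
    simp only [h.fderiv_mul] at d4
    simpa [mulSecond, add_comm] using d4
  have symm : ∀ X Y : E, fderiv ℝ (fun a => fderiv ℝ μ (a, y₀)) a₀ X (Y, 0)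
      = fderiv ℝ (fun a => fderiv ℝ μ (a, y₀)) a₀ Y (X, 0) := by
    intro X Y
    have d1 : HasFDerivAt (fun a => fderiv ℝ μ (a, y₀)) _ a₀ :=
      HasFDerivAt.comp (g := fderiv ℝ μ) a₀ h.smooth_act.fderiv.differentiableAt.hasFDerivAt
        (hasFDerivAt_prodMk_left a₀ y₀)
    rw [d1.fderiv]
    have d2 := fderiv_fderiv_comm h.smooth_act.contDiffAt ((X, 0) : E × V) (Y, 0)
    exact d2
  have hXY := der X Y
  have hYX := der Y X
  rw [hX, Prod.mk_zero_zero, map_zero, symm] at hYX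
  have hsub : ((mulSecond m a₀ X Y - mulSecond m a₀ Y X, 0) : E × V)
      = (mulSecond m a₀ X Y, 0) - (mulSecond m a₀ Y X, 0) := by simp
  rw [hsub, map_sub, ← hXY, eq_neg_of_add_eq_zero_left hYX]
  abel

/-- If elements that fix `y₀` approach the unit and transform the frame `u` by matrices `C i` whose
difference quotients converge to `b`, then `b` is the action on `u` of an element of the Lie algebra
of the stabilizer of `y₀`. -/
theorem exists_stabilizer_field [FiniteDimensional ℝ E] [FiniteDimensional ℝ V]
    [FiniteDimensional ℝ W] (u : W →L[ℝ] V) {ι : Type*} {l : Filter ι} [l.NeBot] {κ : ι → E}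
    {c : ι → ℝ} {C : ι → W →L[ℝ] W} {b : W →L[ℝ] W} (hκ : Tendsto κ l (𝓝 a₀))
    (hfix : ∀ᶠ i in l, μ (κ i, y₀) = y₀)
    (hC : ∀ᶠ i in l, ∀ w, fderiv ℝ μ (κ i, y₀) (0, u w) = u (C i w))
    (hb : Tendsto (fun i => c i • (C i - 1)) l (𝓝 b)) :
    ∃ X, fderiv ℝ μ (a₀, y₀) (X, 0) = 0 ∧ ∀ w Y, fderiv ℝ μ (a₀, y₀) (Y, 0) = u w →
      fderiv ℝ μ (a₀, y₀) (mulSecond m a₀ X Y - mulSecond m a₀ Y X, 0) = u (b w) := by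
  have h2 : ∀ v, fderiv ℝ μ (a₀, y₀) (0, v) = v := by
    have h1 : HasFDerivAt (fun y => μ (a₀, y)) ((fderiv ℝ μ (a₀, y₀)).comp
        (ContinuousLinearMap.inr ℝ E V)) y₀ :=
      HasFDerivAt.comp (g := μ) y₀ h.smooth_act.differentiableAt.hasFDerivAt
        (hasFDerivAt_prodMk_right a₀ y₀)
    have h2 : HasFDerivAt (fun y => μ (a₀, y)) (ContinuousLinearMap.id ℝ V) y₀ :=
      (hasFDerivAt_id y₀).congr_of_eventuallyEq h.one_act
    exact fun v => congrArg (fun L => L v) (h1.unique h2)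
  have hF0 : frameOrbit μ y₀ u a₀ = (y₀, u) :=
    Prod.ext h.act_one (ContinuousLinearMap.ext fun w => h2 (u w))
  have hlim : Tendsto (fun i => c i • (frameOrbit μ y₀ u (κ i) - frameOrbit μ y₀ u a₀)) l
      (𝓝 (0, u.comp b)) := by
    have h3 : Tendsto (fun i => ((0 : V), u.comp (c i • (C i - 1)))) l (𝓝 (0, u.comp b)) :=
      tendsto_const_nhds.prodMk_nhds
        (((ContinuousLinearMap.compL ℝ W W V u).continuous.tendsto b).comp hb)
    refine h3.congr' ?_
    filter_upwards [hfix, hC] with i hi hCi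
    rw [hF0]
    refine Prod.ext ?_ (ContinuousLinearMap.ext fun w => ?_)
    · simp [frameOrbit, hi]
    · simp [frameOrbit, hCi]
  obtain ⟨X, hX⟩ := mem_range_of_constant_rank
    ((h.smoothNear_frameOrbit u).contDiffAt.of_le (by simp)) (h.finrank_range_frameOrbit_le u) hκ
    hlim
  have h0 : SmoothNear (fun a : E => (a, y₀)) a₀ :=
    smoothNear_of_contDiff (contDiff_id.prodMk contDiff_const)
  have hD : SmoothNear (fun a => fderiv ℝ μ (a, y₀)) a₀ :=
    SmoothNear.comp (g := fderiv ℝ μ) h.smooth_act.fderiv h0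
  have e1 : HasFDerivAt (fun a => μ (a, y₀)) ((fderiv ℝ μ (a₀, y₀)).comp
      (ContinuousLinearMap.inl ℝ E V)) a₀ :=
    HasFDerivAt.comp (g := μ) a₀ h.smooth_act.differentiableAt.hasFDerivAt
      (hasFDerivAt_prodMk_left a₀ y₀)
  have e2 : HasFDerivAt
      (fun a => ((fderiv ℝ μ (a, y₀)).comp (ContinuousLinearMap.inr ℝ E V)).comp u) _ a₀ :=
    (hD.differentiableAt.hasFDerivAt.clm_comp (hasFDerivAt_const _ a₀)).clm_comp
        (hasFDerivAt_const u a₀)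
  have e3 : fderiv ℝ (frameOrbit μ y₀ u) a₀ = _ := (e1.prodMk e2).fderiv
  rw [ContinuousLinearMap.coe_coe, e3] at hX
  have hX1 : fderiv ℝ μ (a₀, y₀) (X, 0) = 0 := congrArg Prod.fst hX
  refine ⟨X, hX1, fun w Y hY => ?_⟩
  rw [h.fderiv_act_bracket hX1, hY]
  have hX2 := congrArg (fun q : V × (W →L[ℝ] V) => q.2 w) hX
  simpa using hX2

end IsLocalAction

end LocalAction

/-! ### Smooth maps between manifolds in charts -/

section Charts

variable {X : Type*} [NormedAddCommGroup X] [NormedSpace ℝ X]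
  {E : Type*} [NormedAddCommGroup E] [NormedSpace ℝ E]
  {M : Type*} [TopologicalSpace M] [ChartedSpace E M] [IsManifold 𝓘(ℝ, E) ∞ M]

theorem eventually_contMDiffAt_extChartAt_symm (x : M) :
    ∀ᶠ y in 𝓝 (extChartAt 𝓘(ℝ, E) x x),
      ContMDiffAt 𝓘(ℝ, E) 𝓘(ℝ, E) ∞ (extChartAt 𝓘(ℝ, E) x).symm y := by
  filter_upwards [extChartAt_target_mem_nhds x] with y hy
  exact (contMDiffOn_extChartAt_symm x).contMDiffAt ((isOpen_extChartAt_target x).mem_nhds hy)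

/-- A map into a manifold which is smooth near `z` is smooth in a chart. -/
theorem smoothNear_extChartAt {f : X → M} {z : X} {x : M}
    (hf : ∀ᶠ y in 𝓝 z, ContMDiffAt 𝓘(ℝ, X) 𝓘(ℝ, E) ∞ f y)
    (hx : f z ∈ (chartAt E x).source) : SmoothNear (fun y => extChartAt 𝓘(ℝ, E) x (f y)) z := by
  have h1 := hf.self_of_nhds.continuousAt.eventually ((chartAt E x).open_source.mem_nhds hx)
  filter_upwards [hf, h1] with y hy hy1
  exact contMDiffAt_iff_contDiffAt.1 ((contMDiffAt_extChartAt' hy1).comp y hy)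

end Charts

section Groups

variable (E : Type*) [NormedAddCommGroup E] [NormedSpace ℝ E]
  {V : Type*} [NormedAddCommGroup V] [NormedSpace ℝ V]
  (H : Type*) [TopologicalSpace H] [ChartedSpace E H] [Group H]
  {Mt : Type*} [TopologicalSpace Mt] [ChartedSpace V Mt] [MulAction H Mt]

/-- The multiplication of a Lie group in the chart around the unit. -/
def chartMul (p : E × E) : E :=
  extChartAt 𝓘(ℝ, E) (1 : H)
    ((extChartAt 𝓘(ℝ, E) (1 : H)).symm p.1 * (extChartAt 𝓘(ℝ, E) (1 : H)).symm p.2)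

/-- The unit of a Lie group in the chart around it. -/
def chartOne : E := extChartAt 𝓘(ℝ, E) (1 : H) 1

/-- An action of a Lie group in the charts around the unit and around the point `o`. -/
def chartAct (o : Mt) (p : E × V) : V :=
  extChartAt 𝓘(ℝ, V) o ((extChartAt 𝓘(ℝ, E) (1 : H)).symm p.1 • (extChartAt 𝓘(ℝ, V) o).symm p.2)

theorem chart_symm_one : (extChartAt 𝓘(ℝ, E) (1 : H)).symm (chartOne E H) = 1 :=
  extChartAt_to_inv (1 : H)

variable [LieGroup 𝓘(ℝ, E) ∞ H]

theorem eventually_contMDiffAt_chart_mul :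
    ∀ᶠ p in 𝓝 (chartOne E H, chartOne E H), ContMDiffAt 𝓘(ℝ, E × E) 𝓘(ℝ, E) ∞
      (fun p : E × E => (extChartAt 𝓘(ℝ, E) (1 : H)).symm p.1 *
        (extChartAt 𝓘(ℝ, E) (1 : H)).symm p.2) p := by
  have h := eventually_contMDiffAt_extChartAt_symm (E := E) (1 : H)
  filter_upwards [(continuousAt_fst (p := (chartOne E H, chartOne E H))).eventually h,
    (continuousAt_snd (p := (chartOne E H, chartOne E H))).eventually h] with p h1 h2
  exact ContMDiffAt.mul (I := 𝓘(ℝ, E)) (n := ∞) (h1.comp p contDiff_fst.contMDiff.contMDiffAt)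
    (h2.comp p contDiff_snd.contMDiff.contMDiffAt)

variable [ContMDiffSMul 𝓘(ℝ, E) 𝓘(ℝ, V) ∞ H Mt] [IsManifold 𝓘(ℝ, V) ∞ Mt]

theorem eventually_contMDiffAt_chart_act (o : Mt) :
    ∀ᶠ p in 𝓝 (chartOne E H, extChartAt 𝓘(ℝ, V) o o), ContMDiffAt 𝓘(ℝ, E × V) 𝓘(ℝ, V) ∞
      (fun p : E × V => (extChartAt 𝓘(ℝ, E) (1 : H)).symm p.1 •
        (extChartAt 𝓘(ℝ, V) o).symm p.2) p := by
  have h := eventually_contMDiffAt_extChartAt_symm (E := E) (1 : H)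
  have h' := eventually_contMDiffAt_extChartAt_symm (E := V) o
  filter_upwards [(continuousAt_fst (p := (chartOne E H, extChartAt 𝓘(ℝ, V) o o))).eventually h,
    (continuousAt_snd (p := (chartOne E H, extChartAt 𝓘(ℝ, V) o o))).eventually h'] with p h1 h2
  exact ContMDiffAt.smul (I := 𝓘(ℝ, E)) (n := ∞) (h1.comp p contDiff_fst.contMDiff.contMDiffAt)
    (h2.comp p contDiff_snd.contMDiff.contMDiffAt)

theorem isLocalAction_chart (o : Mt) : IsLocalAction (chartMul E H) (chartAct E H o)
    (chartOne E H) (extChartAt 𝓘(ℝ, V) o o) := by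
  have hm := eventually_contMDiffAt_chart_mul E H
  have ha := eventually_contMDiffAt_chart_act (V := V) E H o
  have h1 : ∀ᶠ a in 𝓝 (chartOne E H), a ∈ (extChartAt 𝓘(ℝ, E) (1 : H)).target :=
    extChartAt_target_mem_nhds (1 : H)
  have h2 : ∀ᶠ y in 𝓝 (extChartAt 𝓘(ℝ, V) o o), y ∈ (extChartAt 𝓘(ℝ, V) o).target :=
    extChartAt_target_mem_nhds o
  have s1 := chart_symm_one E H
  have s2 := extChartAt_to_inv (I := 𝓘(ℝ, V)) o
  refine ⟨smoothNear_extChartAt hm (by simpa only [s1, mul_one] using mem_chart_source E (1 : H)),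
    smoothNear_extChartAt ha (by simpa only [s1, s2, one_smul] using mem_chart_source V o),
    ?_, ?_, ?_, ?_⟩
  · filter_upwards [h1] with a ha
    simp only [chartMul, s1, mul_one, (extChartAt 𝓘(ℝ, E) (1 : H)).right_inv ha]
  · filter_upwards [h1] with a ha
    simp only [chartMul, s1, one_mul, (extChartAt 𝓘(ℝ, E) (1 : H)).right_inv ha]
  · filter_upwards [h2] with a ha
    simp only [chartAct, s1, one_smul, (extChartAt 𝓘(ℝ, V) o).right_inv ha]
  · have c1 : ContinuousAt (fun q : (E × E) × V => q.1)
        ((chartOne E H, chartOne E H), extChartAt 𝓘(ℝ, V) o o) := continuousAt_fst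
    have c2 : ContinuousAt (fun q : (E × E) × V => (q.1.2, q.2))
        ((chartOne E H, chartOne E H), extChartAt 𝓘(ℝ, V) o o) := by fun_prop
    have m1 := hm.self_of_nhds.continuousAt.eventually
      ((isOpen_extChartAt_source (I := 𝓘(ℝ, E)) (1 : H)).mem_nhds
        (by simpa only [s1, mul_one] using mem_extChartAt_source (1 : H)))
    have m2 := ha.self_of_nhds.continuousAt.eventually
      ((isOpen_extChartAt_source (I := 𝓘(ℝ, V)) o).mem_nhds
        (by simpa only [s1, s2, one_smul] using mem_extChartAt_source o))
    filter_upwards [c1.eventually m1, c2.eventually m2] with q hq1 hq2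
    simp only [chartAct, chartMul]
    rw [(extChartAt 𝓘(ℝ, E) (1 : H)).left_inv hq1, (extChartAt 𝓘(ℝ, V) o).left_inv hq2, mul_smul]

end Groups

section Derivatives

variable {E : Type*} [NormedAddCommGroup E] [NormedSpace ℝ E]
  {V : Type*} [NormedAddCommGroup V] [NormedSpace ℝ V]
  {H : Type*} [TopologicalSpace H] [ChartedSpace E H] [Group H]
  {Mt : Type*} [TopologicalSpace Mt] [ChartedSpace V Mt] [MulAction H Mt]
  [ContMDiffSMul 𝓘(ℝ, E) 𝓘(ℝ, V) ∞ H Mt]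

theorem orbitDiff_eq_fderiv [LieGroup 𝓘(ℝ, E) ∞ H] [IsManifold 𝓘(ℝ, V) ∞ Mt] (o : Mt)
    (X : LieAlg E H) :
    (orbitDiff (V := V) o X : V)
      = fderiv ℝ (chartAct E H o) (chartOne E H, extChartAt 𝓘(ℝ, V) o o) (X, 0) := by
  have hd : MDifferentiableAt 𝓘(ℝ, E) 𝓘(ℝ, V) (fun h : H => h • o) 1 :=
    ((ContMDiffSMul.contMDiff_smul (I := 𝓘(ℝ, E)) (I' := 𝓘(ℝ, V)) (n := ∞) (G := H) (M := Mt)).comp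
      (contMDiff_id.prodMk contMDiff_const)).mdifferentiable (by simp) 1
  have h1 : HasFDerivAt (fun a => chartAct E H o (a, extChartAt 𝓘(ℝ, V) o o)) _ (chartOne E H) :=
    HasFDerivAt.comp (g := chartAct E H o) (chartOne E H)
      (isLocalAction_chart E H o).smooth_act.differentiableAt.hasFDerivAt
      (hasFDerivAt_prodMk_left (chartOne E H) (extChartAt 𝓘(ℝ, V) o o))
  have h2 : writtenInExtChartAt 𝓘(ℝ, E) 𝓘(ℝ, V) (1 : H) (fun h : H => h • o)
      = fun a => chartAct E H o (a, extChartAt 𝓘(ℝ, V) o o) := by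
    ext a
    simp only [writtenInExtChartAt, chartAct, one_smul, Function.comp, extChartAt_to_inv]
  have h3 : (mfderiv 𝓘(ℝ, E) 𝓘(ℝ, V) (fun h : H => h • o) 1 : E →L[ℝ] V)
      = fderivWithin ℝ (writtenInExtChartAt 𝓘(ℝ, E) 𝓘(ℝ, V) (1 : H) (fun h : H => h • o))
        (Set.range 𝓘(ℝ, E)) (extChartAt 𝓘(ℝ, E) (1 : H) 1) := hd.mfderiv
  rw [h2, modelWithCornersSelf_coe, Set.range_id, fderivWithin_univ] at h3
  exact congrArg (fun L : E →L[ℝ] V => L X) (h3.trans h1.fderiv)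

theorem mfderiv_smul_eq_fderiv {o : Mt} {g : H} (hg : g • o = o)
    (hs : g ∈ (chartAt E (1 : H)).source)
    (hsm : DifferentiableAt ℝ (chartAct E H o)
      (extChartAt 𝓘(ℝ, E) (1 : H) g, extChartAt 𝓘(ℝ, V) o o))
    (v : V) : (mfderiv 𝓘(ℝ, V) 𝓘(ℝ, V) (fun z : Mt => g • z) o v : V)
      = fderiv ℝ (chartAct E H o)
        (extChartAt 𝓘(ℝ, E) (1 : H) g, extChartAt 𝓘(ℝ, V) o o) (0, v) := by
  have hd : MDifferentiableAt 𝓘(ℝ, V) 𝓘(ℝ, V) (fun z : Mt => g • z) o :=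
    ((ContMDiffSMul.contMDiff_smul (I := 𝓘(ℝ, E)) (I' := 𝓘(ℝ, V)) (n := ∞) (G := H) (M := Mt)).comp
      (contMDiff_const.prodMk contMDiff_id)).mdifferentiable (by simp) o
  have h1 : HasFDerivAt (fun y => chartAct E H o (extChartAt 𝓘(ℝ, E) (1 : H) g, y)) _
      (extChartAt 𝓘(ℝ, V) o o) :=
    HasFDerivAt.comp (g := chartAct E H o) (extChartAt 𝓘(ℝ, V) o o) hsm.hasFDerivAt
      (hasFDerivAt_prodMk_right (extChartAt 𝓘(ℝ, E) (1 : H) g) (extChartAt 𝓘(ℝ, V) o o))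
  have hgs : (extChartAt 𝓘(ℝ, E) (1 : H)).symm (extChartAt 𝓘(ℝ, E) (1 : H) g) = g :=
    (extChartAt 𝓘(ℝ, E) (1 : H)).left_inv (by rwa [extChartAt_source])
  have h2 : writtenInExtChartAt 𝓘(ℝ, V) 𝓘(ℝ, V) o (fun z : Mt => g • z)
      = fun y => chartAct E H o (extChartAt 𝓘(ℝ, E) (1 : H) g, y) := by
    ext y
    simp only [writtenInExtChartAt, chartAct, hgs, hg, Function.comp]
  have h3 : (mfderiv 𝓘(ℝ, V) 𝓘(ℝ, V) (fun z : Mt => g • z) o : V →L[ℝ] V)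
      = fderivWithin ℝ (writtenInExtChartAt 𝓘(ℝ, V) 𝓘(ℝ, V) o (fun z : Mt => g • z))
        (Set.range 𝓘(ℝ, V)) (extChartAt 𝓘(ℝ, V) o o) := hd.mfderiv
  rw [h2, modelWithCornersSelf_coe, Set.range_id, fderivWithin_univ] at h3
  exact congrArg (fun L : V →L[ℝ] V => L v) (h3.trans h1.fderiv)

variable [LieGroup 𝓘(ℝ, E) ∞ H]

/-- The left invariant vector field with value `Z` at the unit, in the chart around the unit. -/
theorem mulInvariantVectorField_chart (Z : LieAlg E H) : ∀ᶠ a in 𝓝 (chartOne E H),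
    (VectorField.mpullbackWithin 𝓘(ℝ, E) 𝓘(ℝ, E) (extChartAt 𝓘(ℝ, E) (1 : H)).symm
      (mulInvariantVectorField Z) (Set.range 𝓘(ℝ, E)) a : E)
      = fderiv ℝ (chartMul E H) (a, chartOne E H) (0, Z) := by
  have : IsManifold 𝓘(ℝ, E) 1 H := IsManifold.of_le (n := ∞) (by simp)
  have h1 : ∀ᶠ a in 𝓝 (chartOne E H), a ∈ (extChartAt 𝓘(ℝ, E) (1 : H)).target :=
    extChartAt_target_mem_nhds (1 : H)
  have hm := (smoothNear_extChartAt (x := (1 : H)) (eventually_contMDiffAt_chart_mul E H)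
    (by simpa only [chart_symm_one, mul_one] using mem_chart_source E (1 : H))).eventually
  have hc : ContinuousAt (fun a : E => (a, chartOne E H)) (chartOne E H) := by fun_prop
  filter_upwards [h1, hc.eventually hm] with a ha hma
  have hgs : (extChartAt 𝓘(ℝ, E) (1 : H)).symm a ∈ (chartAt E (1 : H)).source := by
    rw [← extChartAt_source (I := 𝓘(ℝ, E))]
    exact (extChartAt 𝓘(ℝ, E) (1 : H)).map_target ha
  have hinv := ContinuousLinearMap.inverse_eq
    (mfderivWithin_extChartAt_symm_comp_mfderiv_extChartAt ha)
    (mfderiv_extChartAt_comp_mfderivWithin_extChartAt_symm ha)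
  rw [VectorField.mpullbackWithin_apply, hinv]
  set g : H := (extChartAt 𝓘(ℝ, E) (1 : H)).symm a with hg
  have d1 : MDifferentiableAt 𝓘(ℝ, E) 𝓘(ℝ, E) (fun b : H => g * b) 1 :=
    (contMDiff_mul_left (I := 𝓘(ℝ, E)) (n := ∞)).mdifferentiable (by simp) 1
  have d2 : MDifferentiableAt 𝓘(ℝ, E) 𝓘(ℝ, E) (extChartAt 𝓘(ℝ, E) (1 : H)) (g * 1) := by
    rw [mul_one]
    exact mdifferentiableAt_extChartAt hgs
  have h4 := mfderiv_comp (1 : H) d2 d1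
  have h5 : (mfderiv 𝓘(ℝ, E) 𝓘(ℝ, E) (fun b : H => extChartAt 𝓘(ℝ, E) (1 : H) (g * b)) 1 :
        E →L[ℝ] E)
      = fderivWithin ℝ (writtenInExtChartAt 𝓘(ℝ, E) 𝓘(ℝ, E) (1 : H)
          (fun b : H => extChartAt 𝓘(ℝ, E) (1 : H) (g * b)))
        (Set.range 𝓘(ℝ, E)) (extChartAt 𝓘(ℝ, E) (1 : H) 1) := (d2.comp (1 : H) d1).mfderiv
  have h6 : writtenInExtChartAt 𝓘(ℝ, E) 𝓘(ℝ, E) (1 : H)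
      (fun b : H => extChartAt 𝓘(ℝ, E) (1 : H) (g * b)) = fun b => chartMul E H (a, b) := rfl
  have h7 : HasFDerivAt (fun b => chartMul E H (a, b)) _ (chartOne E H) :=
    HasFDerivAt.comp (g := chartMul E H) (chartOne E H) hma.differentiableAt.hasFDerivAt
      (hasFDerivAt_prodMk_right a (chartOne E H))
  rw [h6, modelWithCornersSelf_coe, Set.range_id, fderivWithin_univ] at h5
  have h8 : (mfderiv 𝓘(ℝ, E) 𝓘(ℝ, E) (fun b : H => extChartAt 𝓘(ℝ, E) (1 : H) (g * b)) 1 :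
      E →L[ℝ] E) Z = fderiv ℝ (chartMul E H) (a, chartOne E H) (0, Z) :=
    congrArg (fun L : E →L[ℝ] E => L Z) (h5.trans h7.fderiv)
  rw [← h8]
  have h9 := congrArg (fun L => (L Z : E)) h4
  refine Eq.trans ?_ h9.symm
  -- the tangent spaces at `g * 1` and at `g` are identified through the model space
  have key : ∀ g' : H, g' = g → ∀ w : E,
      (mfderiv 𝓘(ℝ, E) 𝓘(ℝ, E) (extChartAt 𝓘(ℝ, E) (1 : H)) g w : E)
      = (mfderiv 𝓘(ℝ, E) 𝓘(ℝ, E) (extChartAt 𝓘(ℝ, E) (1 : H)) g' w : E) := by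
    rintro g' rfl w
    rfl
  exact key _ (mul_one g) _

variable (H) in
theorem fderiv_chartMul_one (Z : E) :
    fderiv ℝ (chartMul E H) (chartOne E H, chartOne E H) (0, Z) = Z := by
  have hm := smoothNear_extChartAt (x := (1 : H)) (eventually_contMDiffAt_chart_mul E H)
    (by simpa only [chart_symm_one, mul_one] using mem_chart_source E (1 : H))
  have h1 : HasFDerivAt (fun b => chartMul E H (chartOne E H, b)) _ (chartOne E H) :=
    HasFDerivAt.comp (g := chartMul E H) (chartOne E H) hm.differentiableAt.hasFDerivAt
      (hasFDerivAt_prodMk_right (chartOne E H) (chartOne E H))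
  have h2 : HasFDerivAt (fun b => chartMul E H (chartOne E H, b)) (ContinuousLinearMap.id ℝ E)
      (chartOne E H) := by
    refine (hasFDerivAt_id _).congr_of_eventuallyEq ?_
    filter_upwards [extChartAt_target_mem_nhds (I := 𝓘(ℝ, E)) (1 : H)] with b hb
    simp only [chartMul, chart_symm_one, one_mul, (extChartAt 𝓘(ℝ, E) (1 : H)).right_inv hb, id]
  exact congrArg (fun L => L Z) (h1.unique h2)

/-- The bracket of the Lie algebra of a Lie group, in terms of the second derivative of the
multiplication in a chart. -/
theorem lie_eq_mulSecond [CompleteSpace E] (X Y : LieAlg E H) :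
    (⁅X, Y⁆ : LieAlg E H) = (mulSecond (chartMul E H) (chartOne E H) X Y
      - mulSecond (chartMul E H) (chartOne E H) Y X : E) := by
  have : IsManifold 𝓘(ℝ, E) 1 H := IsManifold.of_le (n := ∞) (by simp)
  have h0 := VectorField.mlieBracketWithin_apply (I := 𝓘(ℝ, E)) (x₀ := (1 : H)) (s := Set.univ)
    (V := mulInvariantVectorField X) (W := mulInvariantVectorField Y)
  have hid : (mfderiv 𝓘(ℝ, E) 𝓘(ℝ, E) (extChartAt 𝓘(ℝ, E) (1 : H)) (1 : H) : E →L[ℝ] E)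
      = ContinuousLinearMap.id ℝ E := mfderiv_extChartAt_self
  have hinv : (mfderiv 𝓘(ℝ, E) 𝓘(ℝ, E) (extChartAt 𝓘(ℝ, E) (1 : H)) (1 : H) : E →L[ℝ] E).inverse
      = ContinuousLinearMap.id ℝ E :=
    (congrArg (fun L : E →L[ℝ] E => L.inverse) hid).trans ContinuousLinearMap.inverse_id
  refine h0.trans ((congrArg (fun L : E →L[ℝ] E => L _) hinv).trans ?_)
  have e3 : ((extChartAt 𝓘(ℝ, E) (1 : H)).symm ⁻¹' Set.univ ∩ Set.range 𝓘(ℝ, E)) = Set.univ := by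
    simp
  have gen : ∀ (V₁ V₂ W₁ W₂ : E → E) (s : Set E), s = Set.univ → V₁ =ᶠ[𝓝 (chartOne E H)] W₁ →
      V₂ =ᶠ[𝓝 (chartOne E H)] W₂ → VectorField.lieBracketWithin ℝ V₁ V₂ s (chartOne E H)
        = VectorField.lieBracket ℝ W₁ W₂ (chartOne E H) := by
    rintro V₁ V₂ W₁ W₂ _ rfl h1 h2
    rw [VectorField.lieBracketWithin_univ]
    exact h1.lieBracket_vectorField_eq h2
  refine (gen _ _ _ _ _ e3 (mulInvariantVectorField_chart (H := H) X)
    (mulInvariantVectorField_chart (H := H) Y)).trans ?_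
  exact congrArg₂ (fun x y : E =>
    fderiv ℝ (fun a => fderiv ℝ (chartMul E H) (a, chartOne E H) (0, (Y : E))) (chartOne E H) x
    - fderiv ℝ (fun a => fderiv ℝ (chartMul E H) (a, chartOne E H) (0, (X : E))) (chartOne E H) y)
    (fderiv_chartMul_one (E := E) H X) (fderiv_chartMul_one (E := E) H Y)

end Derivatives

/-- A connected Lie group is second countable. -/
theorem secondCountable_of_connected {E : Type*} [NormedAddCommGroup E] [NormedSpace ℝ E]
    [FiniteDimensional ℝ E] {H : Type*} [TopologicalSpace H] [ChartedSpace E H] [Group H]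
    [LieGroup 𝓘(ℝ, E) ∞ H] [ConnectedSpace H] : SecondCountableTopology H := by
  have : ProperSpace E := FiniteDimensional.proper ℝ E
  have : IsTopologicalGroup H := topologicalGroup_of_lieGroup 𝓘(ℝ, E) ∞
  have : LocallyCompactSpace H := ChartedSpace.locallyCompactSpace E H
  have : SecondCountableTopology (chartAt E (1 : H)).source :=
    (chartAt E (1 : H)).secondCountableTopology_source
  obtain ⟨c, hc, hcs⟩ := TopologicalSpace.IsSeparable.of_subtype (chartAt E (1 : H)).source
  -- the closure of the subgroup generated by `c` is open
  have h1 : (Subgroup.closure c).topologicalClosure = ⊤ := by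
    have h2 : ((Subgroup.closure c).topologicalClosure : Set H) ∈ 𝓝 (1 : H) := by
      refine Filter.mem_of_superset (chart_source_mem_nhds E (1 : H)) (hcs.trans ?_)
      exact closure_mono Subgroup.subset_closure
    have h3 := Subgroup.isOpen_of_mem_nhds _ h2
    have h4 : IsClopen ((Subgroup.closure c).topologicalClosure : Set H) :=
      ⟨Subgroup.isClosed_topologicalClosure _, h3⟩
    exact SetLike.coe_injective ((h4.eq_univ ⟨1, one_mem _⟩).trans Subgroup.coe_top.symm)
  have : TopologicalSpace.SeparableSpace H := by
    have hcc : Countable c := hc.to_subtype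
    refine ⟨(Subgroup.closure c : Set H), ?_, ?_⟩
    · have h6 : Countable (FreeGroup c) := inferInstanceAs (Countable (Quot _))
      have h7 := FreeGroup.range_lift_eq_closure (f := ((↑) : c → H))
      rw [Subtype.range_coe] at h7
      rw [← h7, MonoidHom.coe_range]
      exact Set.countable_range _
    · have h5 := congrArg (fun G : Subgroup H => (G : Set H)) h1
      exact dense_iff_closure_eq.2 h5
  exact ChartedSpace.secondCountable_of_sigmaCompact E H

/-- For an arbitrary map from an uncountable set of parameters into a second countable space,
some point of the graph is an accumulation point of the graph. -/
theorem exists_accumulation {X Y : Type*} [TopologicalSpace X] [SecondCountableTopology X]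
    [TopologicalSpace Y] [SecondCountableTopology Y] (G : X → Y) {I : Set X} (hI : ¬ I.Countable) :
    ∃ t ∈ I, (comap (fun s => (s, G s)) (𝓝 (t, G t)) ⊓ 𝓟 (I \ {t})).NeBot := by
  by_contra! hcon
  have hB := TopologicalSpace.isBasis_countableBasis (X × Y)
  have h1 : ∀ t : I, ∃ B ∈ TopologicalSpace.countableBasis (X × Y), ((t : X), G t) ∈ B ∧
      ∀ s ∈ I, (s, G s) ∈ B → s = t := by
    intro t
    have h2 := hcon t t.2
    rw [← Filter.empty_mem_iff_bot, Filter.mem_inf_principal, Filter.mem_comap] at h2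
    obtain ⟨O, hO, hOs⟩ := h2
    obtain ⟨B, hB1, hB2, hB3⟩ := hB.mem_nhds_iff.1 hO
    refine ⟨B, hB1, hB2, fun s hs hsB => ?_⟩
    by_contra hne
    exact hOs (show s ∈ _ from hB3 hsB) ⟨hs, hne⟩
  choose B hB1 hB2 hB3 using h1
  refine hI ?_
  have hinj : Function.Injective
      (fun t : I => (⟨B t, hB1 t⟩ : TopologicalSpace.countableBasis (X × Y))) := by
    intro t s hts
    have h3 : B t = B s := congrArg Subtype.val hts
    exact Subtype.ext (hB3 s t t.2 (h3 ▸ hB2 t))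
  have : Countable (TopologicalSpace.countableBasis (X × Y)) :=
    (TopologicalSpace.countable_countableBasis (X × Y)).to_subtype
  exact (Set.countable_coe_iff).1 hinj.countable

/-! ### The adjoint representation -/

section Adjoint

/-- The derivative at the unit of an automorphism of a local group is an automorphism of its Lie
algebra. -/
theorem fderiv_mulSecond {E : Type*} [NormedAddCommGroup E] [NormedSpace ℝ E] {m : E × E → E}
    {a₀ : E} {f : E → E} (hm : SmoothNear m (a₀, a₀)) (hm1 : ∀ᶠ a in 𝓝 a₀, m (a, a₀) = a)
    (hf : SmoothNear f a₀) (hf0 : f a₀ = a₀)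
    (hu : ∀ b, fderiv ℝ m (a₀, a₀) (0, b) = b)
    (hfm : ∀ᶠ q in 𝓝 (a₀, a₀), f (m q) = m (f q.1, f q.2)) (X Y : E) :
    fderiv ℝ f a₀ (mulSecond m a₀ X Y - mulSecond m a₀ Y X)
      = mulSecond m a₀ (fderiv ℝ f a₀ X) (fderiv ℝ f a₀ Y)
        - mulSecond m a₀ (fderiv ℝ f a₀ Y) (fderiv ℝ f a₀ X) := by
  have hdiag : SmoothNear (fun a : E => (a, a₀)) a₀ :=
    smoothNear_of_contDiff (contDiff_id.prodMk contDiff_const)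
  have hM : ∀ Y : E, SmoothNear (fun a => fderiv ℝ m (a, a₀) (0, Y)) a₀ := fun Y =>
    (SmoothNear.comp (f := fun a : E => (a, a₀)) (g := fderiv ℝ m) hm.fderiv
      hdiag).clm_apply (smoothNear_const _)
  have hfc : Tendsto f (𝓝 a₀) (𝓝 a₀) := by
    have := hf.differentiableAt.continuousAt.tendsto
    rwa [hf0] at this
  rw [nhds_prod_eq] at hfm
  have key : ∀ Y : E, (fun a => fderiv ℝ f a (fderiv ℝ m (a, a₀) (0, Y))) =ᶠ[𝓝 a₀]
      fun a => fderiv ℝ m (f a, a₀) (0, fderiv ℝ f a₀ Y) := by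
    intro Y
    have hmd := hdiag.differentiableAt.continuousAt.eventually hm.eventually
    filter_upwards [hfm.curry, hm1, hf, hmd, hfc.eventually hmd] with a h1 h2 h3 h4 h5
    have e1 : HasFDerivAt (fun b => m (a, b)) _ a₀ :=
      HasFDerivAt.comp (g := m) a₀ h4.differentiableAt.hasFDerivAt (hasFDerivAt_prodMk_right a a₀)
    have e2 : HasFDerivAt f (fderiv ℝ f a) (m (a, a₀)) := by
      rw [h2]
      exact (h3.differentiableAt (by simp)).hasFDerivAt
    have e3 : HasFDerivAt (fun b => m (f a, b)) ((fderiv ℝ m (f a, a₀)).comp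
        (ContinuousLinearMap.inr ℝ E E)) (f a₀) := by
      rw [hf0]
      exact HasFDerivAt.comp (g := m) a₀ h5.differentiableAt.hasFDerivAt
        (hasFDerivAt_prodMk_right (f a) a₀)
    have e4 := (HasFDerivAt.comp (g := f) a₀ e2 e1).unique ((HasFDerivAt.comp
      (g := fun b => m (f a, b)) a₀ e3 hf.differentiableAt.hasFDerivAt).congr_of_eventuallyEq h1)
    have e5 := congrArg (fun L : E →L[ℝ] E => L Y) e4
    simpa only [ContinuousLinearMap.comp_apply, ContinuousLinearMap.inr_apply] using e5
  have der : ∀ X Y : E, (fderiv ℝ (fun a => fderiv ℝ f a) a₀ : E →L[ℝ] E →L[ℝ] E) X Y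
      + fderiv ℝ f a₀ (mulSecond m a₀ X Y)
      = mulSecond m a₀ (fderiv ℝ f a₀ X) (fderiv ℝ f a₀ Y) := by
    intro X Y
    have d1 := hf.fderiv.differentiableAt.hasFDerivAt.clm_apply (hM Y).differentiableAt.hasFDerivAt
    have d2 : HasFDerivAt (fun a => fderiv ℝ m (a, a₀) (0, fderiv ℝ f a₀ Y))
        (fderiv ℝ (fun a => fderiv ℝ m (a, a₀) (0, fderiv ℝ f a₀ Y)) a₀) (f a₀) := by
      rw [hf0]
      exact (hM (fderiv ℝ f a₀ Y)).differentiableAt.hasFDerivAt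
    have d3 := congrArg (fun L : E →L[ℝ] E => L X) (d1.unique ((HasFDerivAt.comp
      (g := fun a => fderiv ℝ m (a, a₀) (0, fderiv ℝ f a₀ Y)) a₀ d2
      hf.differentiableAt.hasFDerivAt).congr_of_eventuallyEq (key Y)))
    simpa [mulSecond, hu, add_comm] using d3
  rw [← der, ← der, map_sub, fderiv_fderiv_comm hf.contDiffAt X Y]
  abel

variable {E : Type*} [NormedAddCommGroup E] [NormedSpace ℝ E]
  {V : Type*} [NormedAddCommGroup V] [NormedSpace ℝ V]
  {H : Type*} [TopologicalSpace H] [ChartedSpace E H] [Group H] [LieGroup 𝓘(ℝ, E) ∞ H]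

theorem contMDiff_conj (g : H) :
    ContMDiff 𝓘(ℝ, E) 𝓘(ℝ, E) ∞ (fun x : H => g * x * g⁻¹) :=
  ContMDiff.mul (I := 𝓘(ℝ, E)) (n := ∞) (contMDiff_mul_left (I := 𝓘(ℝ, E)) (n := ∞)) contMDiff_const

variable (E) in
/-- The conjugation by `g` in the chart around the unit. -/
def chartConj (g : H) (a : E) : E :=
  extChartAt 𝓘(ℝ, E) (1 : H) (g * (extChartAt 𝓘(ℝ, E) (1 : H)).symm a * g⁻¹)

theorem eventually_contMDiffAt_conj (g : H) : ∀ᶠ a in 𝓝 (chartOne E H),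
    ContMDiffAt 𝓘(ℝ, E) 𝓘(ℝ, E) ∞
      (fun a : E => g * (extChartAt 𝓘(ℝ, E) (1 : H)).symm a * g⁻¹) a :=
  (eventually_contMDiffAt_extChartAt_symm (E := E) (1 : H)).mono fun a ha =>
    (contMDiff_conj g).contMDiffAt.comp a ha

theorem smoothNear_chartConj (g : H) : SmoothNear (chartConj E g) (chartOne E H) :=
  smoothNear_extChartAt (eventually_contMDiffAt_conj g)
    (by simpa only [chart_symm_one, mul_one, mul_inv_cancel] using mem_chart_source E (1 : H))

theorem adjoint_eq_fderiv [CompleteSpace E] (g : H) (X : LieAlg E H) :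
    (FlatReductive.adjoint g X : E) = fderiv ℝ (chartConj E g) (chartOne E H) X := by
  have hd := (contMDiff_conj (E := E) g).mdifferentiable (by simp) 1
  have h2 : writtenInExtChartAt 𝓘(ℝ, E) 𝓘(ℝ, E) (1 : H) (fun x : H => g * x * g⁻¹)
      = chartConj E g := by
    ext a
    simp only [writtenInExtChartAt, chartConj, mul_one, mul_inv_cancel, Function.comp]
  have h3 : (mfderiv 𝓘(ℝ, E) 𝓘(ℝ, E) (fun x : H => g * x * g⁻¹) 1 : E →L[ℝ] E)
      = fderivWithin ℝ (writtenInExtChartAt 𝓘(ℝ, E) 𝓘(ℝ, E) (1 : H) (fun x : H => g * x * g⁻¹))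
        (Set.range 𝓘(ℝ, E)) (extChartAt 𝓘(ℝ, E) (1 : H) 1) := hd.mfderiv
  rw [h2, modelWithCornersSelf_coe, Set.range_id, fderivWithin_univ] at h3
  exact congrArg (fun L : E →L[ℝ] E => L X) h3

/-- `Ad_g` is a homomorphism of Lie algebras. -/
theorem adjoint_lie [CompleteSpace E] (g : H) (X Y : LieAlg E H) :
    FlatReductive.adjoint (E := E) g ⁅X, Y⁆
      = ⁅FlatReductive.adjoint (E := E) g X, FlatReductive.adjoint (E := E) g Y⁆ := by
  have hm := smoothNear_extChartAt (x := (1 : H)) (eventually_contMDiffAt_chart_mul E H)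
    (by simpa only [chart_symm_one, mul_one] using mem_chart_source E (1 : H))
  have hs1 := chart_symm_one E H
  have hmul : ∀ᶠ a in 𝓝 (chartOne E H), chartMul E H (a, chartOne E H) = a := by
    filter_upwards [extChartAt_target_mem_nhds (I := 𝓘(ℝ, E)) (1 : H)] with a ha
    simp only [chartMul, hs1, mul_one, (extChartAt 𝓘(ℝ, E) (1 : H)).right_inv ha]
  have hcm : ∀ᶠ q in 𝓝 (chartOne E H, chartOne E H),
      chartConj E g (chartMul E H q) = chartMul E H (chartConj E g q.1, chartConj E g q.2) := by
    have hsrc := isOpen_extChartAt_source (I := 𝓘(ℝ, E)) (1 : H)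
    have m1 := (eventually_contMDiffAt_chart_mul E H).self_of_nhds.continuousAt.eventually
      (hsrc.mem_nhds (by simpa only [hs1, mul_one] using mem_extChartAt_source (1 : H)))
    have m2 := (eventually_contMDiffAt_conj (E := E) g).self_of_nhds.continuousAt.eventually
      (hsrc.mem_nhds (by
        simpa only [hs1, mul_one, mul_inv_cancel] using mem_extChartAt_source (1 : H)))
    filter_upwards [m1, (continuousAt_fst (p := (chartOne E H, chartOne E H))).eventually m2,
      (continuousAt_snd (p := (chartOne E H, chartOne E H))).eventually m2] with q h1 h2 h3
    simp only [chartConj, chartMul]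
    rw [(extChartAt 𝓘(ℝ, E) (1 : H)).left_inv h1, (extChartAt 𝓘(ℝ, E) (1 : H)).left_inv h2,
      (extChartAt 𝓘(ℝ, E) (1 : H)).left_inv h3]
    congr 1
    group
  have h0 : chartConj E g (chartOne E H) = chartOne E H := by
    rw [chartConj, hs1, mul_one, mul_inv_cancel, chartOne]
  have key := fderiv_mulSecond hm hmul (smoothNear_chartConj g) h0 (fderiv_chartMul_one H) hcm X Y
  have e : ∀ A B : E, A = B → (fderiv ℝ (chartConj E g) (chartOne E H) A)
    = fderiv ℝ (chartConj E g) (chartOne E H) B := fun A B h => by rw [h]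
  refine (adjoint_eq_fderiv g _).trans ((e _ _ (lie_eq_mulSecond X Y)).trans (key.trans ?_))
  rw [lie_eq_mulSecond]
  exact congrArg₂ (fun A B : E => mulSecond (chartMul E H) (chartOne E H) A B
    - mulSecond (chartMul E H) (chartOne E H) B A) (adjoint_eq_fderiv g X).symm
    (adjoint_eq_fderiv g Y).symm

end Adjoint

/-! ### The graded Lie algebra of a flat homogeneous structure -/

section SpencerFormulas

variable {L : Type*} [LieRing L] [LieAlgebra ℝ L] {W : Type*} [AddCommGroup W] [Module ℝ W]
  (ι : W →ₗ[ℝ] L)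

theorem spencer_zero_apply (c : W [⋀^Fin 0]→ₗ[ℝ] L) (w : Fin 1 → W) :
    spencer ι 0 c w = -⁅c ![], ι (w 0)⁆ := by
  rw [spencer_apply]
  simp [Subsingleton.elim (Fin.removeNth 0 w) ![]]

theorem spencer_one_apply (c : W [⋀^Fin 1]→ₗ[ℝ] L) (w : Fin 2 → W) :
    spencer ι 1 c w = ⁅c ![w 0], ι (w 1)⁆ - ⁅c ![w 1], ι (w 0)⁆ := by
  have h0 : Fin.removeNth 0 w = ![w 1] := by ext i; fin_cases i; rfl
  have h1 : Fin.removeNth 1 w = ![w 0] := by ext i; fin_cases i; rfl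
  rw [spencer_apply, Fin.sum_univ_two, h0, h1]
  simp [sub_eq_add_neg, add_comm]

theorem spencer_two_apply (c : W [⋀^Fin 2]→ₗ[ℝ] L) (w : Fin 3 → W) :
    spencer ι 2 c w = -⁅c ![w 1, w 2], ι (w 0)⁆ + ⁅c ![w 0, w 2], ι (w 1)⁆
      - ⁅c ![w 0, w 1], ι (w 2)⁆ := by
  have h0 : Fin.removeNth 0 w = ![w 1, w 2] := by ext i; fin_cases i <;> rfl
  have h1 : Fin.removeNth 1 w = ![w 0, w 2] := by ext i; fin_cases i <;> rfl
  have h2 : Fin.removeNth 2 w = ![w 0, w 1] := by ext i; fin_cases i <;> rfl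
  rw [spencer_apply, Fin.sum_univ_three, h0, h1, h2]
  simp [sub_eq_add_neg]

end SpencerFormulas

theorem gradedProj_mem {L : Type*} [LieRing L] [LieAlgebra ℝ L] {gr : ℤ → Submodule ℝ L}
    (h : DirectSum.IsInternal gr) (i : ℤ) (x : L) : gradedProj h i x ∈ gr i :=
  Subtype.property _

theorem sum_gradedProj {L : Type*} [LieRing L] [LieAlgebra ℝ L] {gr : ℤ → Submodule ℝ L}
    (h : IsGradedLieAlgebra 2 gr) (x : L) : x = gradedProj h.internal (-1) x
      + gradedProj h.internal 0 x + gradedProj h.internal 1 x := by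
  have h1 : (⨆ i, gr i) ≤ LinearMap.eqLocus LinearMap.id (gradedProj h.internal (-1)
      + gradedProj h.internal 0 + gradedProj h.internal 1) := by
    refine iSup_le fun i y hy => ?_
    rw [LinearMap.mem_eqLocus]
    by_cases hi : i < -1 ∨ ((2 : ℕ) : ℤ) ≤ i
    · rw [h.eq_bot i hi, Submodule.mem_bot] at hy
      simp [hy]
    · have : i = -1 ∨ i = 0 ∨ i = 1 := by push_cast at hi; omega
      rcases this with rfl | rfl | rfl <;>
        simp (discharger := norm_num) [gradedProj_of_mem h.internal hy,
          gradedProj_of_mem_ne h.internal _ hy]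
  have h2 : x ∈ ⨆ i, gr i := by
    rw [h.internal.submodule_iSup_eq_top]
    trivial
  exact h1 h2

namespace FlatReductive

variable {E : Type*} [NormedAddCommGroup E] [NormedSpace ℝ E] [CompleteSpace E]
  {V : Type*} [NormedAddCommGroup V] [NormedSpace ℝ V]
  {W : Type*} [NormedAddCommGroup W] [NormedSpace ℝ W]
  {H : Type*} [TopologicalSpace H] [ChartedSpace E H] [Group H]
  [LieGroup 𝓘(ℝ, E) ∞ H]
  {Mt : Type*} [TopologicalSpace Mt] [ChartedSpace V Mt] [MulAction H Mt]

section

variable {k : ℕ} (T : FlatReductive E V H Mt k)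

theorem embV_mem (v : V) : T.embV v ∈ T.gr (-1) := Subtype.property _

theorem proj_embV (v : V) : T.proj (T.embV v) = T.frame v :=
  (LinearEquiv.ofBijective _ T.bijective_proj_gr).apply_symm_apply (T.frame v)

theorem embV_injective : Function.Injective T.embV := fun v w h => by
  have := congrArg T.proj h
  rwa [proj_embV, proj_embV, T.frame.injective.eq_iff] at this

end

variable (T : FlatReductive E V H Mt 2)

/-- The differential of the orbit map only depends on the component of degree `-1`. -/
theorem proj_gradedProj (x : LieAlg E H) :
    T.proj (gradedProj T.graded.internal (-1) x) = T.proj x := by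
  have hk : ∀ i : ℕ, ∀ y ∈ T.gr i, T.proj y = 0 := fun i y hy => by
    have h1 : y ∈ ⨆ i : ℕ, T.gr i := Submodule.mem_iSup_of_mem i hy
    rw [← T.isotropy] at h1
    exact h1
  conv_rhs => rw [sum_gradedProj T.graded x]
  have h0 : T.proj (gradedProj T.graded.internal 0 x) = 0 := hk 0 _ (gradedProj_mem _ _ _)
  have h1 : T.proj (gradedProj T.graded.internal 1 x) = 0 := hk 1 _ (gradedProj_mem _ _ _)
  rw [map_add, map_add, h0, h1, add_zero, add_zero]

theorem gradedProj_eq_of_proj_eq {x y : LieAlg E H} (h : T.proj x = T.proj y) :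
    gradedProj T.graded.internal (-1) x = gradedProj T.graded.internal (-1) y := by
  rw [← proj_gradedProj, ← T.proj_gradedProj y] at h
  exact congrArg Subtype.val (T.bijective_proj_gr.1
    (a₁ := ⟨_, gradedProj_mem T.graded.internal (-1) x⟩)
    (a₂ := ⟨_, gradedProj_mem T.graded.internal (-1) y⟩) h)

/-- The graded Lie algebra of a flat `2`-reductive structure, as a bracket on the model space of
the Lie group. -/
def spencerData [FiniteDimensional ℝ E] [FiniteDimensional ℝ W] (j : W →ₗ[ℝ] V)
    (hj : Function.Injective j) (h11 : Subsingleton (T.Coh j 1 1))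
    (h21 : Subsingleton (T.Coh j 2 1)) : SpencerData E W where
  br := LinearMap.toContinuousLinearMap
    ((LinearMap.toContinuousLinearMap : (E →ₗ[ℝ] E) ≃ₗ[ℝ] (E →L[ℝ] E)).toLinearMap ∘ₗ
      (((LieModule.toEnd ℝ (LieAlg E H) (LieAlg E H) :
        LieAlg E H →ₗ[ℝ] LieAlg E H →ₗ[ℝ] LieAlg E H).compl₁₂
          (LieAlg.toModel E H).symm.toLinearEquiv.toLinearMap
          (LieAlg.toModel E H).symm.toLinearEquiv.toLinearMap).compr₂
            (LieAlg.toModel E H).toLinearEquiv.toLinearMap))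
  gr i := (T.gr i).comap (LieAlg.toModel E H).symm.toLinearEquiv.toLinearMap
  pr i := LinearMap.toContinuousLinearMap ((LieAlg.toModel E H).toLinearEquiv.toLinearMap ∘ₗ
    gradedProj T.graded.internal i ∘ₗ (LieAlg.toModel E H).symm.toLinearEquiv.toLinearMap)
  j := LinearMap.toContinuousLinearMap
    ((LieAlg.toModel E H).toLinearEquiv.toLinearMap ∘ₗ T.embW j)
  br_self x := lie_self (L := LieAlg E H) (x : LieAlg E H)
  jacobi := by
    have h : ∀ x y z : LieAlg E H, ⁅x, ⁅y, z⁆⁆ = ⁅⁅x, y⁆, z⁆ + ⁅y, ⁅x, z⁆⁆ :=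
      fun x y z => leibniz_lie x y z
    exact h
  pr_mem i x := gradedProj_mem T.graded.internal i x
  pr_of_mem i x hx := gradedProj_of_mem T.graded.internal hx
  pr_of_mem_ne i k x hik hx := gradedProj_of_mem_ne T.graded.internal hik hx
  sum_pr x := sum_gradedProj T.graded (x : LieAlg E H)
  br_mem i k x y hx hy := T.graded.bracket_mem i k x y hx hy
  gr_eq_bot i hi := by
    have h1 := T.graded.eq_bot i (by push_cast; omega)
    ext x
    exact (SetLike.ext_iff.1 h1 x)
  j_mem w := T.embV_mem (j w)
  j_inj := T.embV_injective.comp hj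
  H11 c hc hcc := by
    let c1 : W [⋀^Fin 1]→ₗ[ℝ] LieAlg E H :=
      AlternatingMap.ofSubsingleton ℝ W (LieAlg E H) (0 : Fin 1)
        ((LieAlg.toModel E H).symm.toLinearEquiv.toLinearMap ∘ₗ c.toLinearMap)
    have hcoc : c1 ∈ cocycles (T.embW j) T.gr 1 1 := by
      refine ⟨fun w => hc (w 0), ?_⟩
      refine LinearMap.mem_ker.2 ?_
      ext w
      rw [spencer_one_apply]
      exact sub_eq_zero.2 (hcc (w 0) (w 1))
    have h1 := (Submodule.Quotient.mk_eq_zero _).1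
      (Subsingleton.elim (Submodule.Quotient.mk ⟨c1, hcoc⟩ : T.Coh j 1 1) 0)
    obtain ⟨b, hb, hbc⟩ := h1
    refine ⟨-(b ![] : LieAlg E H), neg_mem (hb ![]), fun w => ?_⟩
    have h2 : spencer (T.embW j) 0 b ![w] = c1 ![w] := congrArg (fun f => f ![w]) hbc
    rw [spencer_zero_apply, ← neg_lie] at h2
    exact h2.symm
  H21 c hc hcc := by
    let c1 : W [⋀^Fin 1]→ₗ[ℝ] LieAlg E H :=
      AlternatingMap.ofSubsingleton ℝ W (LieAlg E H) (0 : Fin 1)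
        ((LieAlg.toModel E H).symm.toLinearEquiv.toLinearMap ∘ₗ c.toLinearMap)
    have hcoc : c1 ∈ cocycles (T.embW j) T.gr 2 1 := by
      refine ⟨fun w => hc (w 0), ?_⟩
      refine LinearMap.mem_ker.2 ?_
      ext w
      rw [spencer_one_apply]
      exact sub_eq_zero.2 (hcc (w 0) (w 1))
    have h1 := (Submodule.Quotient.mk_eq_zero _).1
      (Subsingleton.elim (Submodule.Quotient.mk ⟨c1, hcoc⟩ : T.Coh j 2 1) 0)
    obtain ⟨b, hb, hbc⟩ := h1
    have hb0 : b ![] = 0 := by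
      have h3 := hb ![]
      rwa [T.graded.eq_bot _ (by norm_num), Submodule.mem_bot] at h3
    ext w
    have h2 : spencer (T.embW j) 0 b ![w] = c1 ![w] := congrArg (fun f => f ![w]) hbc
    rw [spencer_zero_apply, hb0, zero_lie, neg_zero] at h2
    exact h2.symm

/-- The differential of the orbit map intertwines the adjoint action of the isotropy group with the
isotropy representation. -/
theorem proj_adjoint [ContMDiffSMul 𝓘(ℝ, E) 𝓘(ℝ, V) ∞ H Mt] {g : H} (hg : g • T.base = T.base)
    (X : LieAlg E H) : (T.proj (adjoint g X) : V)
      = mfderiv 𝓘(ℝ, V) 𝓘(ℝ, V) (fun z : Mt => g • z) T.base (T.proj X) := by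
  have hinv : g⁻¹ • T.base = T.base := by rw [inv_smul_eq_iff, hg]
  have hd : MDifferentiable 𝓘(ℝ, E) 𝓘(ℝ, V) (fun h : H => h • T.base) :=
    ((ContMDiffSMul.contMDiff_smul (I := 𝓘(ℝ, E)) (I' := 𝓘(ℝ, V)) (n := ∞) (G := H) (M := Mt)).comp
      (contMDiff_id.prodMk contMDiff_const)).mdifferentiable (by simp)
  have hc := (contMDiff_conj (E := E) g).mdifferentiable (by simp) 1
  have h1 := mfderiv_comp (1 : H) (hd (g * 1 * g⁻¹)) hc
  have h2 := mfderiv_comp (1 : H) (T.mdifferentiableAt_smul g ((1 : H) • T.base)) (hd 1)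
  have h3 : (fun h : H => h • T.base) ∘ (fun x : H => g * x * g⁻¹)
      = (fun z : Mt => g • z) ∘ (fun h : H => h • T.base) := by
    ext x
    simp [mul_smul, hinv]
  rw [h3] at h1
  have k1 : ∀ h : H, h = 1 → ∀ Y : E,
      (mfderiv 𝓘(ℝ, E) 𝓘(ℝ, V) (fun h : H => h • T.base) h Y : V)
        = mfderiv 𝓘(ℝ, E) 𝓘(ℝ, V) (fun h : H => h • T.base) 1 Y := by
    rintro h rfl Y
    rfl
  have k2 : ∀ z : Mt, z = T.base → ∀ Y : V,
      (mfderiv 𝓘(ℝ, V) 𝓘(ℝ, V) (fun z : Mt => g • z) z Y : V)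
        = mfderiv 𝓘(ℝ, V) 𝓘(ℝ, V) (fun z : Mt => g • z) T.base Y := by
    rintro z rfl Y
    rfl
  have h4 := congrArg (fun L => (L X : V)) h1
  have h5 := congrArg (fun L => (L X : V)) h2
  exact ((k1 (g * 1 * g⁻¹) (by simp) _).symm.trans (h4.symm.trans h5)).trans (k2 _ (one_smul _ _) _)

end FlatReductive

namespace SpencerData

variable {E W : Type*} [NormedAddCommGroup E] [NormedSpace ℝ E]
  [NormedAddCommGroup W] [NormedSpace ℝ W] (S : SpencerData E W)

/-- The endomorphism of the associated graded space defined by an endomorphism that preserves the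
filtration. -/
def assocGraded (α : E → E) (x : E) : E :=
  S.pr (-1) (α (S.pr (-1) x)) + S.pr 0 (α (S.pr 0 x)) + S.pr 1 (α (S.pr 1 x))

theorem pr_pr (i k : ℤ) (x : E) : S.pr i (S.pr k x) = if i = k then S.pr i x else 0 := by
  split_ifs with h
  · subst h
    exact S.pr_of_mem _ _ (S.pr_mem _ _)
  · exact S.pr_of_mem_ne _ _ _ h (S.pr_mem _ _)

variable {α : E →ₗ[ℝ] E}

theorem pr_assocGraded (x : E) : S.pr (-1) (S.assocGraded α x) = S.pr (-1) (α (S.pr (-1) x)) ∧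
    S.pr 0 (S.assocGraded α x) = S.pr 0 (α (S.pr 0 x)) ∧
    S.pr 1 (S.assocGraded α x) = S.pr 1 (α (S.pr 1 x)) := by
  refine ⟨?_, ?_, ?_⟩ <;> simp [assocGraded, pr_pr]

/-- An automorphism that preserves the filtration induces an automorphism of the associated graded
algebra. That it maps `gr 1` to itself follows from the fact that elements of degree `0` which
commute with `W` vanish. -/
theorem assocGraded_br [FiniteDimensional ℝ W] [Nontrivial W]
    (hα : ∀ x y, α (S.br x y) = S.br (α x) (α y))
    (h0 : ∀ x, S.pr (-1) x = 0 → S.pr (-1) (α x) = 0)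
    (hj : ∀ w, ∃ z ∈ S.gr (-1), S.pr (-1) (α z) = S.j w) (x y : E) :
    S.assocGraded α (S.br x y) = S.br (S.assocGraded α x) (S.assocGraded α y) := by
  have n0 : ∀ x, S.pr (-1) (α (S.pr 0 x)) = 0 := fun x => h0 _ (by simp [pr_pr])
  have n1 : ∀ x, S.pr (-1) (α (S.pr 1 x)) = 0 := fun x => h0 _ (by simp [pr_pr])
  have z1 : ∀ x, S.pr 0 (α (S.pr 1 x)) = 0 := by
    intro x
    refine S.eq_zero_of_mem_zero (S.pr_mem _ _) fun w => ?_
    obtain ⟨z, hz, hzw⟩ := hj w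
    have e1 : S.pr (-1) (α (S.br (S.pr 1 x) z)) = 0 := by
      refine h0 _ (S.pr_of_mem_ne _ _ _ (by norm_num) (S.br_mem 1 (-1) _ _ (S.pr_mem _ _) hz))
    rw [hα, S.pr_br_neg, n1, hzw] at e1
    simpa using e1
  refine S.ext_pr ?_ ?_ ?_
  · rw [(S.pr_assocGraded _).1, S.pr_br_neg, S.pr_br_neg, (S.pr_assocGraded x).1,
      (S.pr_assocGraded x).2.1, (S.pr_assocGraded y).1, (S.pr_assocGraded y).2.1]
    simp [hα, S.pr_br_neg, n0]
  · rw [(S.pr_assocGraded _).2.1, S.pr_br_zero, S.pr_br_zero, (S.pr_assocGraded x).1,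
      (S.pr_assocGraded x).2.1, (S.pr_assocGraded y).1, (S.pr_assocGraded y).2.1,
      (S.pr_assocGraded x).2.2, (S.pr_assocGraded y).2.2]
    simp [hα, S.pr_br_zero, n0, n1, z1]
  · rw [(S.pr_assocGraded _).2.2, S.pr_br_one, S.pr_br_one,
      (S.pr_assocGraded x).2.1, (S.pr_assocGraded y).2.1,
      (S.pr_assocGraded x).2.2, (S.pr_assocGraded y).2.2]
    simp [hα, S.pr_br_one, z1]

end SpencerData

namespace FlatReductive

variable {E : Type*} [NormedAddCommGroup E] [NormedSpace ℝ E] [CompleteSpace E]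
  {V : Type*} [NormedAddCommGroup V] [NormedSpace ℝ V]
  {W : Type*} [NormedAddCommGroup W] [NormedSpace ℝ W]
  {H : Type*} [TopologicalSpace H] [ChartedSpace E H] [Group H]
  [LieGroup 𝓘(ℝ, E) ∞ H]
  {Mt : Type*} [TopologicalSpace Mt] [ChartedSpace V Mt] [MulAction H Mt]
  (T : FlatReductive E V H Mt 2) {j : W →ₗ[ℝ] V}

theorem gradedAd_mem (g : H) (i : ℤ) {x : LieAlg E H} (hx : x ∈ T.gr i) :
    T.gradedAd g x ∈ T.gr i := by
  rw [gradedAd, LinearMap.sum_apply]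
  refine Submodule.sum_mem _ fun k _ => ?_
  by_cases hk : k = i
  · subst hk
    exact gradedProj_mem T.graded.internal _ _
  · simp [gradedProj_of_mem_ne T.graded.internal hk hx]

/-- The action of the isotropy group on `𝔥` as the associated graded of the adjoint action. -/
theorem gradedAd_eq [FiniteDimensional ℝ E] [FiniteDimensional ℝ W] (hj : Function.Injective j)
    (h11 : Subsingleton (T.Coh j 1 1)) (h21 : Subsingleton (T.Coh j 2 1)) (g : H) (x : LieAlg E H) :
    (T.gradedAd g x : E) = (T.spencerData j hj h11 h21).assocGraded
      (adjoint (E := E) g : LieAlg E H → LieAlg E H) x := by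
  have h : Finset.Icc (-1 : ℤ) (((2 : ℕ) : ℤ) - 1) = {-1, 0, 1} := by decide
  rw [gradedAd, h]
  simp only [LinearMap.sum_apply]
  rw [Finset.sum_insert (by decide), Finset.sum_insert (by decide), Finset.sum_singleton,
    ← add_assoc]
  rfl

variable [ContMDiffSMul 𝓘(ℝ, E) 𝓘(ℝ, V) ∞ H Mt]

theorem proj_adjoint_embV {g : H} {A : V ≃L[ℝ] V} (h : T.IsIsotropy g A) (v : V) :
    gradedProj T.graded.internal (-1) (adjoint g (T.embV v)) = T.embV (A v) := by
  have h1 : T.proj (adjoint g (T.embV v)) = T.proj (T.embV (A v)) := by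
    rw [proj_embV]
    refine (T.proj_adjoint h.1 _).trans ?_
    rw [proj_embV]
    exact (h.2 v).symm
  rw [T.gradedProj_eq_of_proj_eq h1, gradedProj_of_mem _ (T.embV_mem _)]

theorem gradedAd_embV {g : H} {A : V ≃L[ℝ] V} (h : T.IsIsotropy g A) (v : V) :
    T.gradedAd g (T.embV v) = T.embV (A v) := by
  have hI : Finset.Icc (-1 : ℤ) (((2 : ℕ) : ℤ) - 1) = {-1, 0, 1} := by decide
  rw [gradedAd, hI]
  simp only [LinearMap.sum_apply]
  rw [Finset.sum_insert (by decide), Finset.sum_insert (by decide), Finset.sum_singleton]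
  simp only [LinearMap.comp_apply]
  rw [gradedProj_of_mem _ (T.embV_mem v), gradedProj_of_mem_ne _ (by norm_num) (T.embV_mem v),
    gradedProj_of_mem_ne _ (by norm_num) (T.embV_mem v), T.proj_adjoint_embV h]
  simp

theorem gradedAd_embW {g : H} {A : V ≃L[ℝ] V} {B : W ≃L[ℝ] W} (h : T.IsIsotropy g A)
    (hB : IsUpperLeft j A B) (w : W) : T.gradedAd g (T.embW j w) = T.embW j (B w) := by
  rw [embW, LinearMap.comp_apply, T.gradedAd_embV h, hB]
  rfl

/-- The isotropy group acts on the graded algebra `𝔥` by automorphisms. -/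
theorem gradedAd_lie [FiniteDimensional ℝ E] [FiniteDimensional ℝ W] [Nontrivial W]
    (hj : Function.Injective j) (h11 : Subsingleton (T.Coh j 1 1))
    (h21 : Subsingleton (T.Coh j 2 1)) {g : H} {A : V ≃L[ℝ] V} (h : T.IsIsotropy g A)
    (x y : LieAlg E H) : T.gradedAd g ⁅x, y⁆ = ⁅T.gradedAd g x, T.gradedAd g y⁆ := by
  let α : E →ₗ[ℝ] E := (LieAlg.toModel E H).toLinearEquiv.toLinearMap ∘ₗ adjoint (E := E) g ∘ₗ
    (LieAlg.toModel E H).symm.toLinearEquiv.toLinearMap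
  have key := (T.spencerData j hj h11 h21).assocGraded_br (α := α)
    (fun x y => adjoint_lie g (x : LieAlg E H) (y : LieAlg E H)) (fun x hx => ?_) (fun w => ?_) x y
  · refine (T.gradedAd_eq hj h11 h21 g _).trans (key.trans ?_)
    exact congrArg₂ (fun a b : E => (T.spencerData j hj h11 h21).br a b)
      (T.gradedAd_eq hj h11 h21 g x).symm (T.gradedAd_eq hj h11 h21 g y).symm
  · have h1 : T.proj x = T.proj 0 := by
      rw [← T.proj_gradedProj x, map_zero]
      exact (congrArg T.proj hx).trans (map_zero _)
    have h2 : T.proj (adjoint g (x : LieAlg E H)) = T.proj 0 := by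
      rw [map_zero]
      refine (T.proj_adjoint h.1 _).trans ?_
      rw [h1, map_zero]
      exact map_zero _
    exact (T.gradedProj_eq_of_proj_eq h2).trans (map_zero _)
  · refine ⟨T.embV (A.symm (j w)), T.embV_mem _, (T.proj_adjoint_embV h _).trans ?_⟩
    rw [A.apply_symm_apply]
    rfl

end FlatReductive

/-! ### Derivatives of maps with values in the structure group -/

namespace FlatReductive

variable {E : Type*} [NormedAddCommGroup E] [NormedSpace ℝ E] [CompleteSpace E]
  [FiniteDimensional ℝ E]
  {V : Type*} [NormedAddCommGroup V] [NormedSpace ℝ V] [FiniteDimensional ℝ V]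
  {W : Type*} [NormedAddCommGroup W] [NormedSpace ℝ W] [FiniteDimensional ℝ W]
  {H : Type*} [TopologicalSpace H] [ChartedSpace E H] [Group H]
  [LieGroup 𝓘(ℝ, E) ∞ H]
  {Mt : Type*} [TopologicalSpace Mt] [ChartedSpace V Mt] [IsManifold 𝓘(ℝ, V) ∞ Mt]
  [MulAction H Mt] [ContMDiffSMul 𝓘(ℝ, E) 𝓘(ℝ, V) ∞ H Mt]
  (T : FlatReductive E V H Mt 2) {j : W →ₗ[ℝ] V}

/-- If isotropic elements approach the unit of the group, then the limits of the difference
quotients of their upper left blocks lie in the image of `gr 0`. -/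
theorem exists_bracket_of_tendsto {ι : Type*} {l : Filter ι} [l.NeBot] {κ : ι → H}
    {A : ι → V ≃L[ℝ] V} {C : ι → W ≃L[ℝ] W} {c : ι → ℝ} {b : W →L[ℝ] W}
    (hκ : Tendsto κ l (𝓝 1)) (hA : ∀ᶠ i in l, T.IsIsotropy (κ i) (A i))
    (hC : ∀ᶠ i in l, IsUpperLeft j (A i) (C i))
    (hb : Tendsto (fun i => c i • ((C i : W →L[ℝ] W) - 1)) l (𝓝 b)) :
    ∃ X ∈ T.gr 0, ∀ w, T.embW j (b w) = ⁅X, T.embW j w⁆ := by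
  set o := T.base with ho
  have hloc := isLocalAction_chart (V := V) E H o
  let e := extChartAt 𝓘(ℝ, E) (1 : H)
  let u : W →L[ℝ] V := LinearMap.toContinuousLinearMap (T.frame.toLinearEquiv.toLinearMap ∘ₗ j)
  have hκs : ∀ᶠ i in l, κ i ∈ (chartAt E (1 : H)).source :=
    hκ.eventually (chart_source_mem_nhds E (1 : H))
  have hκe : Tendsto (fun i => e (κ i)) l (𝓝 (chartOne E H)) :=
    (continuousAt_extChartAt (I := 𝓘(ℝ, E)) (1 : H)).tendsto.comp hκ
  have hfix : ∀ᶠ i in l, chartAct E H o (e (κ i), extChartAt 𝓘(ℝ, V) o o)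
      = extChartAt 𝓘(ℝ, V) o o := by
    filter_upwards [hκs, hA] with i h1 h2
    have h3 : e.symm (e (κ i)) = κ i := e.left_inv (by rwa [extChartAt_source])
    change extChartAt 𝓘(ℝ, V) o (e.symm (e (κ i)) •
      (extChartAt 𝓘(ℝ, V) o).symm (extChartAt 𝓘(ℝ, V) o o)) = _
    rw [h3, extChartAt_to_inv, h2.1]
  have hact : ∀ᶠ i in l, ∀ w,
      fderiv ℝ (chartAct E H o) (e (κ i), extChartAt 𝓘(ℝ, V) o o) (0, u w)
      = u ((C i : W →L[ℝ] W) w) := by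
    have h5 : ContinuousAt (fun a : E => (a, extChartAt 𝓘(ℝ, V) o o)) (chartOne E H) := by fun_prop
    filter_upwards [hκs, hA, hC, hκe.eventually (h5.eventually hloc.smooth_act.eventually)]
      with i h1 h2 h3 h4 w
    refine (mfderiv_smul_eq_fderiv h2.1 h1 h4.differentiableAt (u w)).symm.trans ?_
    refine (h2.2 (j w)).symm.trans ?_
    rw [h3 w]
    rfl
  obtain ⟨X, hX, hXw⟩ := hloc.exists_stabilizer_field u hκe hfix hact hb
  let X' : LieAlg E H := (LieAlg.toModel E H).symm X
  have hX0 : T.proj X' = T.proj 0 := by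
    rw [map_zero]
    exact (orbitDiff_eq_fderiv o X').trans hX
  have hp : gradedProj T.graded.internal (-1) X' = 0 := by
    rw [T.gradedProj_eq_of_proj_eq hX0, map_zero]
  -- the component of degree `1` of `X'` has no influence, as its bracket with `W` has degree `0`
  refine ⟨gradedProj T.graded.internal 0 X', gradedProj_mem _ _ _, fun w => ?_⟩
  have h1 : T.proj ⁅X', T.embW j w⁆ = T.proj (T.embW j (b w)) := by
    have h2 : (T.proj (T.embW j w) : V) = u w := T.proj_embV (j w)
    have h3 := hXw w (T.embW j w) ((orbitDiff_eq_fderiv o _).symm.trans h2)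
    have h4 : (T.proj (T.embW j (b w)) : V) = u (b w) := T.proj_embV (j (b w))
    refine ((orbitDiff_eq_fderiv o _).trans (Eq.trans ?_ h3)).trans h4.symm
    exact congrArg (fun Z : E => fderiv ℝ (chartAct E H o)
      (chartOne E H, extChartAt 𝓘(ℝ, V) o o) (Z, 0)) (lie_eq_mulSecond X' (T.embW j w))
  have h5 := T.gradedProj_eq_of_proj_eq h1
  have hw : T.embW j w ∈ T.gr (-1) := T.embV_mem _
  rw [gradedProj_of_mem T.graded.internal (show T.embW j (b w) ∈ T.gr (-1) from T.embV_mem _)] at h5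
  rw [← h5]
  conv_lhs => rw [sum_gradedProj T.graded X', hp, zero_add]
  have h6 : ⁅gradedProj T.graded.internal 0 X', T.embW j w⁆ ∈ T.gr (-1) :=
    T.graded.bracket_mem 0 (-1) _ _ (gradedProj_mem T.graded.internal 0 X') hw
  rw [add_lie, map_add, gradedProj_of_mem T.graded.internal h6,
    gradedProj_of_mem_ne T.graded.internal (by norm_num)
      (T.graded.bracket_mem 1 (-1) _ _ (gradedProj_mem T.graded.internal 1 X') hw), add_zero]

/-- The logarithmic derivative of a curve in the group of upper left blocks takes values in the
image of `gr 0`. Elements of the isotropy group over the curve need not depend continuously on the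
parameter, but their graph over any interval has an accumulation point, as the group is second
countable. -/
theorem mem_inner_of_curve [ConnectedSpace H] [Nontrivial W] (hj : Function.Injective j)
    (h11 : Subsingleton (T.Coh j 1 1)) (h21 : Subsingleton (T.Coh j 2 1))
    {c : ℝ → W ≃L[ℝ] W} {c' : ℝ → W →L[ℝ] W} {ε : ℝ} (hε : 0 < ε)
    (hmem : ∀ t ∈ Set.Ioo (-ε) ε, c t ∈ T.inducedGroup j)
    (hd : ∀ t ∈ Set.Ioo (-ε) ε, HasDerivAt (fun t => (c t : W →L[ℝ] W)) (c' t) t)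
    (hc' : ContinuousAt c' 0) :
    ∃ r ∈ (T.spencerData j hj h11 h21).inner, c' 0 = (c 0 : W →L[ℝ] W) * r := by
  have hsc := secondCountable_of_connected (E := E) (H := H)
  have htg : IsTopologicalGroup H := topologicalGroup_of_lieGroup 𝓘(ℝ, E) ∞
  have hcW : CompleteSpace W := FiniteDimensional.complete ℝ W
  have h0 : (0 : ℝ) ∈ Set.Ioo (-ε) ε := ⟨by linarith, hε⟩
  have hch : ∀ t, ∃ g : H, ∃ A : V ≃L[ℝ] V, t ∈ Set.Ioo (-ε) ε →
      T.IsIsotropy g A ∧ IsUpperLeft j A (c t) := by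
    intro t
    by_cases ht : t ∈ Set.Ioo (-ε) ε
    · obtain ⟨A, ⟨⟨g, hg⟩, -⟩, hA⟩ := hmem t ht
      exact ⟨g, A, fun _ => ⟨hg, hA⟩⟩
    · exact ⟨1, 1, fun h => absurd h ht⟩
  choose G A hGA using hch
  have hinv : ∀ t, Ring.inverse (c t : W →L[ℝ] W) = ((c t).symm : W →L[ℝ] W) := fun t =>
    Ring.inverse_unit (ContinuousLinearEquiv.toUnit (c t))
  -- the claim holds at accumulation points of the graph of the arbitrary lift `G`, and such points
  -- exist in every interval around `0`
  have step : ∀ δ > 0, δ ≤ ε → ∃ t ∈ Set.Ioo (-δ) δ,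
      Ring.inverse (c t : W →L[ℝ] W) * c' t ∈ (T.spencerData j hj h11 h21).inner := by
    intro δ hδ hδε
    have hsub : Set.Ioo (-δ) δ ⊆ Set.Ioo (-ε) ε := Set.Ioo_subset_Ioo (by linarith) hδε
    have hunc : ¬ (Set.Ioo (-δ) δ).Countable := by
      intro hcount
      have h1 := hcount.le_aleph0
      rw [Cardinal.mk_Ioo_real (by linarith)] at h1
      exact absurd h1 (not_le.2 Cardinal.aleph0_lt_continuum)
    obtain ⟨t, ht, hne⟩ := exists_accumulation G hunc
    refine ⟨t, ht, ?_⟩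
    have hG : Tendsto (fun s => (s, G s))
        (comap (fun s => (s, G s)) (𝓝 (t, G t)) ⊓ 𝓟 (Set.Ioo (-δ) δ \ {t})) (𝓝 (t, G t)) :=
      tendsto_comap.mono_left inf_le_left
    have hin : ∀ᶠ s in comap (fun s => (s, G s)) (𝓝 (t, G t)) ⊓ 𝓟 (Set.Ioo (-δ) δ \ {t}),
        s ∈ Set.Ioo (-δ) δ \ {t} := eventually_inf_principal.2 (Eventually.of_forall fun s hs => hs)
    have hs : Tendsto (fun s : ℝ => s)
        (comap (fun s => (s, G s)) (𝓝 (t, G t)) ⊓ 𝓟 (Set.Ioo (-δ) δ \ {t})) (𝓝[≠] t) :=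
      tendsto_nhdsWithin_iff.2 ⟨(continuous_fst.tendsto (t, G t)).comp hG, hin.mono fun s h => h.2⟩
    have hκ : Tendsto (fun s => (G t)⁻¹ * G s)
        (comap (fun s => (s, G s)) (𝓝 (t, G t)) ⊓ 𝓟 (Set.Ioo (-δ) δ \ {t})) (𝓝 1) := by
      have h2 : Tendsto (fun s => G s)
        (comap (fun s => (s, G s)) (𝓝 (t, G t)) ⊓ 𝓟 (Set.Ioo (-δ) δ \ {t})) (𝓝 (G t)) :=
        (continuous_snd.tendsto (t, G t)).comp hG
      have h3 := h2.const_mul (G t)⁻¹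
      rwa [inv_mul_cancel] at h3
    have hq := (hasDerivAt_iff_tendsto_slope.1 (hd t (hsub ht))).comp hs
    have hb : Tendsto (fun s => (s - t)⁻¹ • ((((c t)⁻¹ * c s : W ≃L[ℝ] W) : W →L[ℝ] W) - 1))
        (comap (fun s => (s, G s)) (𝓝 (t, G t)) ⊓ 𝓟 (Set.Ioo (-δ) δ \ {t}))
        (𝓝 (((c t).symm : W →L[ℝ] W) * c' t)) := by
      refine (hq.const_mul ((c t).symm : W →L[ℝ] W)).congr fun s => ?_
      ext w
      simp only [Function.comp_apply, slope, vsub_eq_sub, mul_apply_eq_comp,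
        _root_.smul_apply, _root_.sub_apply, map_smul, map_sub, ContinuousLinearEquiv.coe_coe,
        ContinuousLinearEquiv.symm_apply_apply]
      rfl
    obtain ⟨X, hX, hXw⟩ := T.exists_bracket_of_tendsto hκ
      (A := fun s => (A t)⁻¹ * A s) (C := fun s => (c t)⁻¹ * c s)
      (hin.mono fun s h => (hGA t (hsub ht)).1.inv.mul (hGA s (hsub h.1)).1)
      (hin.mono fun s h => (hGA t (hsub ht)).2.inv.mul (hGA s (hsub h.1)).2) hb
    rw [hinv]
    exact ⟨X, hX, hXw⟩
  -- the points at which the claim is known tend to `0`, and the subspace `ad (gr 0)|_W` is closed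
  have hlim : Tendsto (fun t => Ring.inverse (c t : W →L[ℝ] W) * c' t) (𝓝 0)
      (𝓝 (Ring.inverse (c 0 : W →L[ℝ] W) * c' 0)) := by
    have h1 : ContinuousAt (Ring.inverse : (W →L[ℝ] W) → W →L[ℝ] W) (c 0 : W →L[ℝ] W) :=
      NormedRing.inverse_continuousAt (ContinuousLinearEquiv.toUnit (c 0))
    exact (ContinuousAt.comp (g := Ring.inverse) (f := fun t => (c t : W →L[ℝ] W)) h1
      (hd 0 h0).continuousAt).mul hc'
  have hfreq : ∃ᶠ t in 𝓝 (0 : ℝ),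
      Ring.inverse (c t : W →L[ℝ] W) * c' t ∈ (T.spencerData j hj h11 h21).inner := by
    rw [Filter.frequently_iff]
    intro U hU
    obtain ⟨δ, hδ, hδU⟩ := Metric.mem_nhds_iff.1 hU
    obtain ⟨t, ht, htm⟩ := step (min δ ε) (lt_min hδ hε) (min_le_right _ _)
    refine ⟨t, hδU ?_, htm⟩
    rw [Metric.mem_ball, Real.dist_eq, sub_zero, abs_lt]
    exact ⟨by linarith [ht.1, min_le_left δ ε], by linarith [ht.2, min_le_left δ ε]⟩
  have hclosed : IsClosed ((T.spencerData j hj h11 h21).inner : Set (W →L[ℝ] W)) :=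
    Submodule.closed_of_finiteDimensional _
  refine ⟨_, hclosed.mem_of_frequently_of_tendsto hfreq hlim, ?_⟩
  rw [hinv]
  ext w
  simp

end FlatReductive

/-! ### Forms and frames in charts -/

section ChartForms

variable {W : Type*} [NormedAddCommGroup W] [NormedSpace ℝ W]
  {M : Type*} [TopologicalSpace M] [ChartedSpace W M]
  {F : Type*} [NormedAddCommGroup F] [NormedSpace ℝ F]

/-- The differential at `z` of the chart around `x`, as an endomorphism of the model space. -/
def chartDiff (x z : M) : W →L[ℝ] W := mfderiv 𝓘(ℝ, W) 𝓘(ℝ, W) (extChartAt 𝓘(ℝ, W) x) z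

/-- The differential at `y` of the inverse of the chart around `x`, as an endomorphism of the model
space. -/
def chartSymmDiff (x : M) (y : W) : W →L[ℝ] W :=
  mfderiv 𝓘(ℝ, W) 𝓘(ℝ, W) (extChartAt 𝓘(ℝ, W) x).symm y

variable [IsManifold 𝓘(ℝ, W) ∞ M]

theorem chartDiff_chartSymmDiff {x z : M} (hz : z ∈ (chartAt W x).source) (v : W) :
    chartDiff x z (chartSymmDiff x (extChartAt 𝓘(ℝ, W) x z) v) = v := by
  have : IsManifold 𝓘(ℝ, W) 1 M := IsManifold.of_le (n := ∞) (by simp)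
  have h := mfderiv_extChartAt_comp_mfderivWithin_extChartAt_symm' (I := 𝓘(ℝ, W)) (x := x) (y := z)
    (by simpa using hz)
  rw [show Set.range 𝓘(ℝ, W) = Set.univ by simp, mfderivWithin_univ] at h
  exact congrArg (fun L : W →L[ℝ] W => L v) h

theorem chartSymmDiff_chartDiff {x z : M} (hz : z ∈ (chartAt W x).source) (v : W) :
    chartSymmDiff x (extChartAt 𝓘(ℝ, W) x z) (chartDiff x z v) = v := by
  have : IsManifold 𝓘(ℝ, W) 1 M := IsManifold.of_le (n := ∞) (by simp)
  have h := mfderivWithin_extChartAt_symm_comp_mfderiv_extChartAt' (I := 𝓘(ℝ, W)) (x := x) (y := z)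
    (by simpa using hz)
  rw [show Set.range 𝓘(ℝ, W) = Set.univ by simp, mfderivWithin_univ] at h
  exact congrArg (fun L : W →L[ℝ] W => L v) h

omit [IsManifold 𝓘(ℝ, W) ∞ M] in
theorem coordForm_apply (θ : ∀ x : M, TangentSpace 𝓘(ℝ, W) x →L[ℝ] F) {x z : M}
    (hz : z ∈ (chartAt W x).source) (v : W) :
    coordForm θ x (extChartAt 𝓘(ℝ, W) x z) v
      = θ z (chartSymmDiff x (extChartAt 𝓘(ℝ, W) x z) v : W) := by
  have h1 : (extChartAt 𝓘(ℝ, W) x).symm (extChartAt 𝓘(ℝ, W) x z) = z :=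
    (extChartAt 𝓘(ℝ, W) x).left_inv (by simpa using hz)
  have key : ∀ z', z' = z → ∀ w : W, (θ z' w : F) = θ z w := by
    rintro z' rfl w
    rfl
  exact key _ h1 _

theorem coordForm_chartDiff (θ : ∀ x : M, TangentSpace 𝓘(ℝ, W) x →L[ℝ] F) {x z : M}
    (hz : z ∈ (chartAt W x).source) (v : W) :
    coordForm θ x (extChartAt 𝓘(ℝ, W) x z) (chartDiff x z v) = θ z v := by
  rw [coordForm_apply θ hz, chartSymmDiff_chartDiff hz]

/-- Smoothness of a one-form, as a section of a vector bundle, may be checked on its expression in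
any chart. -/
theorem contMDiffAt_form_iff (θ : ∀ x : M, TangentSpace 𝓘(ℝ, W) x →L[ℝ] F) {x z : M}
    (hz : z ∈ (chartAt W x).source) :
    ContMDiffAt 𝓘(ℝ, W) (𝓘(ℝ, W).prod 𝓘(ℝ, W →L[ℝ] F)) ∞
      (fun x => (⟨x, θ x⟩ : Bundle.TotalSpace (W →L[ℝ] F)
        (fun x : M => TangentSpace 𝓘(ℝ, W) x →L[ℝ] Bundle.Trivial M F x))) z
      ↔ ContDiffAt ℝ ∞ (coordForm θ x) (extChartAt 𝓘(ℝ, W) x z) := by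
  have : IsManifold 𝓘(ℝ, W) 1 M := IsManifold.of_le (n := ∞) (by simp)
  have hz' : z ∈ (extChartAt 𝓘(ℝ, W) x).source := by simpa using hz
  set e := trivializationAt (W →L[ℝ] F)
    (fun x : M => TangentSpace 𝓘(ℝ, W) x →L[ℝ] Bundle.Trivial M F x) x
  have hev : ∀ᶠ z' in 𝓝 z, z' ∈ (chartAt W x).source := (chartAt W x).open_source.mem_nhds hz
  have hcoord : ∀ z' ∈ (chartAt W x).source,
      (e ⟨z', θ z'⟩).2 = coordForm θ x (extChartAt 𝓘(ℝ, W) x z') := by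
    intro z' hz'
    ext v
    rw [coordForm_apply θ hz']
    change (ContinuousLinearMap.inCoordinates W (TangentSpace 𝓘(ℝ, W)) F (Bundle.Trivial M F)
      x z' x z' (θ z')) v = _
    simp only [ContinuousLinearMap.inCoordinates, ContinuousLinearMap.comp_apply]
    rw [TangentBundle.symmL_trivializationAt hz']
    rw [show Set.range 𝓘(ℝ, W) = Set.univ by simp, mfderivWithin_univ]
    simp
    rfl
  have he : (⟨z, θ z⟩ : Bundle.TotalSpace (W →L[ℝ] F)
      (fun x : M => TangentSpace 𝓘(ℝ, W) x →L[ℝ] Bundle.Trivial M F x)) ∈ e.source := by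
    simp [e, hz]
  refine (Bundle.Trivialization.contMDiffAt_iff (IM := 𝓘(ℝ, W)) (IB := 𝓘(ℝ, W)) (n := ∞) (e := e)
    (f := fun x => ⟨x, θ x⟩) he).trans ?_
  constructor
  · rintro ⟨-, h⟩
    have hs : ContMDiffAt 𝓘(ℝ, W) 𝓘(ℝ, W) ∞ (extChartAt 𝓘(ℝ, W) x).symm
        (extChartAt 𝓘(ℝ, W) x z) :=
      (contMDiffOn_extChartAt_symm x).contMDiffAt
        ((isOpen_extChartAt_target x).mem_nhds ((extChartAt 𝓘(ℝ, W) x).map_source hz'))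
    have h2 : ContMDiffAt 𝓘(ℝ, W) 𝓘(ℝ, W →L[ℝ] F) ∞
        ((fun z' => (e ⟨z', θ z'⟩).2) ∘ (extChartAt 𝓘(ℝ, W) x).symm) (extChartAt 𝓘(ℝ, W) x z) := by
      refine ContMDiffAt.comp _ ?_ hs
      rw [(extChartAt 𝓘(ℝ, W) x).left_inv hz']
      exact h
    refine (contMDiffAt_iff_contDiffAt.1 h2).congr_of_eventuallyEq ?_
    filter_upwards [(isOpen_extChartAt_target x).mem_nhds
      ((extChartAt 𝓘(ℝ, W) x).map_source hz')] with y hy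
    have hy' : (extChartAt 𝓘(ℝ, W) x).symm y ∈ (chartAt W x).source := by
      simpa using (extChartAt 𝓘(ℝ, W) x).map_target hy
    rw [Function.comp_apply, hcoord _ hy', (extChartAt 𝓘(ℝ, W) x).right_inv hy]
  · intro h
    refine ⟨contMDiffAt_id, ?_⟩
    have h2 := (contMDiffAt_iff_contDiffAt.2 h).comp z
      (contMDiffAt_extChartAt' (I := 𝓘(ℝ, W)) (n := ∞) hz)
    refine h2.congr_of_eventuallyEq ?_
    filter_upwards [hev] with z' hz'
    exact hcoord z' hz'

omit [IsManifold 𝓘(ℝ, W) ∞ M] in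
/-- Properties of the points near `z` become properties of their coordinates. -/
theorem eventually_chart {x z : M} (hz : z ∈ (chartAt W x).source) {p : M → Prop}
    (h : ∀ᶠ z' in 𝓝 z, p z') :
    ∀ᶠ y in 𝓝 (extChartAt 𝓘(ℝ, W) x z), ∃ z' ∈ (chartAt W x).source,
      p z' ∧ y = extChartAt 𝓘(ℝ, W) x z' := by
  have hz' : z ∈ (extChartAt 𝓘(ℝ, W) x).source := by simpa using hz
  have hc : ContinuousAt (extChartAt 𝓘(ℝ, W) x).symm (extChartAt 𝓘(ℝ, W) x z) :=
    continuousAt_extChartAt_symm'' ((extChartAt 𝓘(ℝ, W) x).map_source hz')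
  have h2 : ∀ᶠ y in 𝓝 (extChartAt 𝓘(ℝ, W) x z), p ((extChartAt 𝓘(ℝ, W) x).symm y) := by
    refine hc.eventually ?_
    rwa [(extChartAt 𝓘(ℝ, W) x).left_inv hz']
  filter_upwards [h2, (isOpen_extChartAt_target x).mem_nhds
    ((extChartAt 𝓘(ℝ, W) x).map_source hz')] with y h3 hy
  exact ⟨_, by simpa using (extChartAt 𝓘(ℝ, W) x).map_target hy, h3,
    ((extChartAt 𝓘(ℝ, W) x).right_inv hy).symm⟩

theorem IsSmoothForm.smoothNear {U : Set M} {θ : ∀ x : M, TangentSpace 𝓘(ℝ, W) x →L[ℝ] F}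
    (h : IsSmoothForm U θ) (hU : IsOpen U) {x z : M} (hz : z ∈ (chartAt W x).source) (hzU : z ∈ U) :
    SmoothNear (coordForm θ x) (extChartAt 𝓘(ℝ, W) x z) := by
  filter_upwards [eventually_chart hz (hU.mem_nhds hzU)]
  rintro _ ⟨z', hz', hU', rfl⟩
  exact (contMDiffAt_form_iff θ hz').1 (h.contMDiffAt (hU.mem_nhds hU'))

/-- The exterior derivative may be computed in any chart: under a transition function `ψ` the
expression of the form changes by `dψ`, and the terms which contain `d²ψ` cancel by symmetry. -/
theorem extDer_apply {θ : ∀ x : M, TangentSpace 𝓘(ℝ, W) x →L[ℝ] F} {x z : M}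
    (hz : z ∈ (chartAt W x).source)
    (hθ : DifferentiableAt ℝ (coordForm θ x) (extChartAt 𝓘(ℝ, W) x z))
    (v : Fin 2 → W) :
    extDer θ z v
      = fderiv ℝ (coordForm θ x) (extChartAt 𝓘(ℝ, W) x z) (chartDiff x z (v 0))
          (chartDiff x z (v 1))
        - fderiv ℝ (coordForm θ x) (extChartAt 𝓘(ℝ, W) x z) (chartDiff x z (v 1))
          (chartDiff x z (v 0)) := by
  set φ := extChartAt 𝓘(ℝ, W) x
  set φ' := extChartAt 𝓘(ℝ, W) z
  -- the transition function between the chart used in the definition and the given one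
  set ψ : W → W := fun y => φ (φ'.symm y)
  set a := φ' z
  have hzz : z ∈ (chartAt W z).source := mem_chart_source W z
  have hψa : ψ a = φ z := by
    simp only [ψ, a]
    rw [φ'.left_inv (by simp [φ'])]
  have hψ : SmoothNear ψ a := by
    refine smoothNear_extChartAt (eventually_contMDiffAt_extChartAt_symm z) ?_
    rw [φ'.left_inv (by simp [φ'])]
    exact hz
  have hmψ : ∀ z' ∈ (chartAt W z).source, z' ∈ (chartAt W x).source → ∀ w : W,
      fderiv ℝ ψ (φ' z') w = chartDiff x z' (chartSymmDiff z (φ' z') w) := by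
    intro z' h1 h2 w
    have h1' : z' ∈ φ'.source := by simpa [φ'] using h1
    have hs : MDifferentiableAt 𝓘(ℝ, W) 𝓘(ℝ, W) φ'.symm (φ' z') :=
      ((contMDiffOn_extChartAt_symm (n := ∞) z).contMDiffAt
        ((isOpen_extChartAt_target z).mem_nhds (φ'.map_source h1'))).mdifferentiableAt (by simp)
    have hφ : MDifferentiableAt 𝓘(ℝ, W) 𝓘(ℝ, W) φ (φ'.symm (φ' z')) := by
      rw [φ'.left_inv h1']
      exact (contMDiffAt_extChartAt' (I := 𝓘(ℝ, W)) (n := ∞) h2).mdifferentiableAt (by simp)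
    have h3 := mfderiv_comp (φ' z') hφ hs
    have key : ∀ z'', z'' = z' → ∀ w : W,
        (mfderiv 𝓘(ℝ, W) 𝓘(ℝ, W) φ z'' w : W) = chartDiff x z' w := by
      rintro z'' rfl w
      rfl
    have h4 : fderiv ℝ ψ (φ' z') = mfderiv 𝓘(ℝ, W) 𝓘(ℝ, W) (φ ∘ φ'.symm) (φ' z') :=
      mfderiv_eq_fderiv.symm
    rw [h4]
    refine (congrArg (fun L : W →L[ℝ] W => L w) h3).trans ?_
    exact key _ (φ'.left_inv h1') _
  have hco : ∀ᶠ y in 𝓝 a, coordForm θ z y = (coordForm θ x (ψ y)).comp (fderiv ℝ ψ y) := by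
    filter_upwards [eventually_chart hzz ((chartAt W x).open_source.mem_nhds hz)]
    rintro _ ⟨z', h1, h2, rfl⟩
    have h1' : z' ∈ φ'.source := by simpa [φ'] using h1
    ext w
    have h5 : ψ (φ' z') = φ z' := by
      simp only [ψ]
      rw [φ'.left_inv h1']
    rw [ContinuousLinearMap.comp_apply, hmψ z' h1 h2, h5, coordForm_chartDiff θ h2,
      coordForm_apply θ h1]
  have hd : DifferentiableAt ℝ (fun y => coordForm θ x (ψ y)) a := by
    have h7 : DifferentiableAt ℝ (coordForm θ x) (ψ a) := by rwa [hψa]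
    exact h7.comp a hψ.differentiableAt
  have hder : ∀ u w : W, fderiv ℝ (coordForm θ z) a u w
      = fderiv ℝ (coordForm θ x) (φ z) (fderiv ℝ ψ a u) (fderiv ℝ ψ a w)
        + coordForm θ x (φ z) (fderiv ℝ (fderiv ℝ ψ) a u w) := by
    intro u w
    rw [Filter.EventuallyEq.fderiv_eq (𝕜 := ℝ) hco]
    rw [fderiv_clm_comp hd hψ.fderiv.differentiableAt]
    have h6 : fderiv ℝ (fun y => coordForm θ x (ψ y)) a
        = (fderiv ℝ (coordForm θ x) (φ z)).comp (fderiv ℝ ψ a) := by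
      have h7 : DifferentiableAt ℝ (coordForm θ x) (ψ a) := by rwa [hψa]
      have := fderiv_comp a h7 hψ.differentiableAt
      rw [hψa] at this
      exact this
    rw [h6]
    simp [hψa, add_comm]
  have hψd : ∀ w : W, fderiv ℝ ψ a (chartDiff z z w) = chartDiff x z w := by
    intro w
    rw [hmψ z hzz hz, chartSymmDiff_chartDiff hzz]
  have hsym : ∀ u w : W, fderiv ℝ (fderiv ℝ ψ) a u w = fderiv ℝ (fderiv ℝ ψ) a w u :=
    fun u w => fderiv_fderiv_comm hψ.contDiffAt u w
  have h0 : extDer θ z v = fderiv ℝ (coordForm θ z) a (chartDiff z z (v 0)) (chartDiff z z (v 1))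
      - fderiv ℝ (coordForm θ z) a (chartDiff z z (v 1)) (chartDiff z z (v 0)) := by
    exact skew_apply (ContinuousLinearMap.coeLM ℝ ∘ₗ
      (fderiv ℝ (coordForm θ z) (extChartAt 𝓘(ℝ, W) z z)).toLinearMap) _
  rw [h0, hder, hder, hψd, hψd, hsym (chartDiff z z (v 0))]
  abel

end ChartForms

/-! ### Frame fields and `𝔥`-valued forms in charts -/

section SmoothMaps

variable {X W Y : Type*} [NormedAddCommGroup X] [NormedSpace ℝ X] [NormedAddCommGroup W]
  [NormedSpace ℝ W] [NormedAddCommGroup Y] [NormedSpace ℝ Y]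

theorem smoothNear_of_clm_apply [FiniteDimensional ℝ W] {f : X → W →L[ℝ] Y} {x : X}
    (h : ∀ w, SmoothNear (fun y => f y w) x) : SmoothNear f x := by
  let b := Module.finBasis ℝ W
  have hf : f = fun y =>
      ∑ i, (LinearMap.toContinuousLinearMap (b.coord i)).smulRight (f y (b i)) := by
    funext y
    refine ContinuousLinearMap.coe_injective (b.ext fun k => ?_)
    simp [Finsupp.single_apply]
  have h1 : ∀ᶠ y in 𝓝 x, ∀ i, ContDiffAt ℝ ∞ (fun y => f y (b i)) y :=
    eventually_all.2 fun i => h (b i)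
  filter_upwards [h1] with y hy
  rw [hf]
  exact ContDiffAt.sum fun i _ => contDiffAt_const.smulRight (hy i)

theorem smoothNear_inverse [CompleteSpace W] {a b : X → W →L[ℝ] W} {x : X} (ha : SmoothNear a x)
    (hab : ∀ᶠ y in 𝓝 x, ∀ w, a y (b y w) = w ∧ b y (a y w) = w) : SmoothNear b x := by
  have h : SmoothNear (fun y => ContinuousLinearMap.inverse (a y)) x := by
    filter_upwards [ha, hab] with y hy hy'
    let e : W ≃L[ℝ] W := ContinuousLinearEquiv.equivOfInverse (a y) (b y) (fun w => (hy' w).2)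
      fun w => (hy' w).1
    exact (contDiffAt_map_inverse (𝕜 := ℝ) e).comp y hy
  refine h.congr ?_
  filter_upwards [hab] with y hy'
  let e : W ≃L[ℝ] W := ContinuousLinearEquiv.equivOfInverse (a y) (b y) (fun w => (hy' w).2)
    fun w => (hy' w).1
  exact (ContinuousLinearMap.inverse_equiv e).symm

end SmoothMaps

section ChartFrames

variable {W : Type*} [NormedAddCommGroup W] [NormedSpace ℝ W]
  {M : Type*} [TopologicalSpace M] [ChartedSpace W M]

/-- The expression of a frame field in the chart around `x`. -/
def coordFrame (s : ∀ x : M, Frame W x) (x : M) (y : W) : W →L[ℝ] W :=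
  (chartDiff (W := W) x ((extChartAt 𝓘(ℝ, W) x).symm y)).comp
    (s ((extChartAt 𝓘(ℝ, W) x).symm y)).toContinuousLinearMap

/-- The inverse of the expression of a frame field in the chart around `x`. -/
def coordFrameInv (s : ∀ x : M, Frame W x) (x : M) (y : W) : W →L[ℝ] W :=
  (s ((extChartAt 𝓘(ℝ, W) x).symm y)).symm.toContinuousLinearMap.comp (chartSymmDiff x y)

theorem coordFrame_apply (s : ∀ x : M, Frame W x) {x z : M} (hz : z ∈ (chartAt W x).source)
    (w : W) : coordFrame s x (extChartAt 𝓘(ℝ, W) x z) w = chartDiff (W := W) x z (s z w) := by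
  have h1 : (extChartAt 𝓘(ℝ, W) x).symm (extChartAt 𝓘(ℝ, W) x z) = z :=
    (extChartAt 𝓘(ℝ, W) x).left_inv (by simpa using hz)
  have key : ∀ z', z' = z → chartDiff (W := W) x z' (s z' w) = chartDiff (W := W) x z (s z w) := by
    rintro z' rfl
    rfl
  exact key _ h1

theorem coordFrameInv_apply (s : ∀ x : M, Frame W x) {x z : M} (hz : z ∈ (chartAt W x).source)
    (v : W) : coordFrameInv s x (extChartAt 𝓘(ℝ, W) x z) v
      = (s z).symm (chartSymmDiff x (extChartAt 𝓘(ℝ, W) x z) v : W) := by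
  have h1 : (extChartAt 𝓘(ℝ, W) x).symm (extChartAt 𝓘(ℝ, W) x z) = z :=
    (extChartAt 𝓘(ℝ, W) x).left_inv (by simpa using hz)
  have key : ∀ z', z' = z → ∀ v : W, (s z').symm v = (s z).symm v := by
    rintro z' rfl v
    rfl
  exact key _ h1 _

variable [IsManifold 𝓘(ℝ, W) ∞ M]

theorem coordFrameInv_chartDiff (s : ∀ x : M, Frame W x) {x z : M}
    (hz : z ∈ (chartAt W x).source) (v : W) :
    coordFrameInv s x (extChartAt 𝓘(ℝ, W) x z) (chartDiff x z v) = (s z).symm v := by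
  rw [coordFrameInv_apply s hz, chartSymmDiff_chartDiff hz]

theorem coordFrame_coordFrameInv (s : ∀ x : M, Frame W x) {x z : M}
    (hz : z ∈ (chartAt W x).source) (v : W) :
    coordFrame s x (extChartAt 𝓘(ℝ, W) x z) (coordFrameInv s x (extChartAt 𝓘(ℝ, W) x z) v) = v := by
  rw [coordFrameInv_apply s hz, coordFrame_apply s hz]
  refine (congrArg (chartDiff (W := W) x z) ((s z).apply_symm_apply _)).trans ?_
  exact chartDiff_chartSymmDiff hz v

theorem coordFrameInv_coordFrame (s : ∀ x : M, Frame W x) {x z : M}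
    (hz : z ∈ (chartAt W x).source) (w : W) :
    coordFrameInv s x (extChartAt 𝓘(ℝ, W) x z) (coordFrame s x (extChartAt 𝓘(ℝ, W) x z) w) = w := by
  rw [coordFrame_apply s hz]
  refine (coordFrameInv_chartDiff s hz _).trans ?_
  exact (s z).symm_apply_apply w

theorem IsFrameField.smoothNear_coordFrame [FiniteDimensional ℝ W] {U : Set M}
    {s : ∀ x : M, Frame W x} (h : IsFrameField U s) {x z : M} (hz : z ∈ (chartAt W x).source)
    (hzU : z ∈ U) : SmoothNear (coordFrame s x) (extChartAt 𝓘(ℝ, W) x z) := by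
  have : IsManifold 𝓘(ℝ, W) 1 M := IsManifold.of_le (n := ∞) (by simp)
  refine smoothNear_of_clm_apply fun w => ?_
  filter_upwards [eventually_chart hz (h.isOpen.mem_nhds hzU)]
  rintro _ ⟨z₁, hz₁, hU, rfl⟩
  have hz' : z₁ ∈ (extChartAt 𝓘(ℝ, W) x).source := by simpa using hz₁
  have h1 := (h.smooth w).contMDiffAt (h.isOpen.mem_nhds hU)
  set e := trivializationAt W (TangentSpace 𝓘(ℝ, W) : M → Type _) x
  have he : (⟨z₁, s z₁ w⟩ : TangentBundle 𝓘(ℝ, W) M) ∈ e.source := by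
    simp [e, hz₁]
  have h2 := ((Bundle.Trivialization.contMDiffAt_iff (IM := 𝓘(ℝ, W)) (IB := 𝓘(ℝ, W)) (n := ∞)
    (e := e) (f := fun x => ⟨x, s x w⟩) he).1 h1).2
  have hs : ContMDiffAt 𝓘(ℝ, W) 𝓘(ℝ, W) ∞ (extChartAt 𝓘(ℝ, W) x).symm
      (extChartAt 𝓘(ℝ, W) x z₁) :=
    (contMDiffOn_extChartAt_symm x).contMDiffAt
      ((isOpen_extChartAt_target x).mem_nhds ((extChartAt 𝓘(ℝ, W) x).map_source hz'))
  have h3 : ContMDiffAt 𝓘(ℝ, W) 𝓘(ℝ, W) ∞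
      ((fun z' => (e ⟨z', s z' w⟩).2) ∘ (extChartAt 𝓘(ℝ, W) x).symm)
      (extChartAt 𝓘(ℝ, W) x z₁) := by
    refine ContMDiffAt.comp _ ?_ hs
    rw [(extChartAt 𝓘(ℝ, W) x).left_inv hz']
    exact h2
  refine (contMDiffAt_iff_contDiffAt.1 h3).congr_of_eventuallyEq ?_
  filter_upwards [eventually_chart hz₁ (p := fun _ => True) (by simp)]
  rintro _ ⟨z₂, hz₂, -, rfl⟩
  rw [coordFrame_apply s hz₂, Function.comp_apply,
    (extChartAt 𝓘(ℝ, W) x).left_inv (by simpa using hz₂)]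
  have h4 := TangentBundle.continuousLinearMapAt_trivializationAt (𝕜 := ℝ) (I := 𝓘(ℝ, W)) hz₂
  have h5 : e.continuousLinearMapAt ℝ z₂ (s z₂ w) = (e ⟨z₂, s z₂ w⟩).2 := by
    rw [Bundle.Trivialization.continuousLinearMapAt_apply,
      Bundle.Trivialization.coe_linearMapAt_of_mem _ (by simp [e, hz₂])]
  rw [← h5]
  exact (congrArg (fun L : W →L[ℝ] W => L (s z₂ w)) h4).symm

theorem IsFrameField.smoothNear_coordFrameInv [FiniteDimensional ℝ W] {U : Set M}
    {s : ∀ x : M, Frame W x} (h : IsFrameField U s) {x z : M} (hz : z ∈ (chartAt W x).source)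
    (hzU : z ∈ U) : SmoothNear (coordFrameInv s x) (extChartAt 𝓘(ℝ, W) x z) := by
  have : CompleteSpace W := FiniteDimensional.complete ℝ W
  refine smoothNear_inverse (h.smoothNear_coordFrame hz hzU) ?_
  filter_upwards [eventually_chart hz (p := fun _ => True) (by simp)]
  rintro _ ⟨z₂, hz₂, -, rfl⟩ w
  exact ⟨coordFrame_coordFrameInv s hz₂ w, coordFrameInv_coordFrame s hz₂ w⟩

end ChartFrames

section ChartLForms

variable {E : Type*} [NormedAddCommGroup E] [NormedSpace ℝ E]
  {W : Type*} [NormedAddCommGroup W] [NormedSpace ℝ W]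
  {H : Type*} [TopologicalSpace H] [ChartedSpace E H] [Group H]
  {M : Type*} [TopologicalSpace M] [ChartedSpace W M]

/-- The expression of an `𝔥`-valued form in the chart around `x`, with `𝔥` regarded as the model
space of `H`. -/
def LForm.coord (θ : LForm E W H M) (x : M) : W → W →L[ℝ] E :=
  coordForm (fun z => (LieAlg.toModel E H).toContinuousLinearMap.comp (θ z)) x

theorem LForm.bracket_apply [CompleteSpace E] [LieGroup 𝓘(ℝ, E) ∞ H] (θ θ' : LForm E W H M) (x : M)
    (v : Fin 2 → TangentSpace 𝓘(ℝ, W) x) :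
    θ.bracket θ' x v = ⁅θ x (v 0), θ' x (v 1)⁆ - ⁅θ x (v 1), θ' x (v 0)⁆ :=
  skewBracket_apply _ _ v

theorem LForm.coord_apply (θ : LForm E W H M) {x z : M} (hz : z ∈ (chartAt W x).source)
    (v : W) : θ.coord x (extChartAt 𝓘(ℝ, W) x z) v
      = (θ z (chartSymmDiff x (extChartAt 𝓘(ℝ, W) x z) v : W) : E) :=
  coordForm_apply _ hz v

variable [IsManifold 𝓘(ℝ, W) ∞ M]

theorem LForm.coord_chartDiff (θ : LForm E W H M) {x z : M} (hz : z ∈ (chartAt W x).source)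
    (v : W) : θ.coord x (extChartAt 𝓘(ℝ, W) x z) (chartDiff x z v) = (θ z v : E) :=
  coordForm_chartDiff _ hz v

theorem LForm.coord_coordFrame (θ : LForm E W H M) (s : ∀ x : M, Frame W x) {x z : M}
    (hz : z ∈ (chartAt W x).source) (w : W) :
    θ.coord x (extChartAt 𝓘(ℝ, W) x z) (coordFrame s x (extChartAt 𝓘(ℝ, W) x z) w)
      = (θ z (s z w) : E) := by
  rw [coordFrame_apply s hz]
  exact θ.coord_chartDiff hz _

theorem LForm.IsSmoothOn.smoothNear {θ : LForm E W H M} {U : Set M} (h : θ.IsSmoothOn U)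
    (hU : IsOpen U) {x z : M} (hz : z ∈ (chartAt W x).source) (hzU : z ∈ U) :
    SmoothNear (θ.coord x) (extChartAt 𝓘(ℝ, W) x z) :=
  IsSmoothForm.smoothNear h hU hz hzU

theorem LForm.isSmoothOn {θ : LForm E W H M} {U : Set M}
    (h : ∀ z ∈ U, ContDiffAt ℝ ∞ (θ.coord z) (extChartAt 𝓘(ℝ, W) z z)) : θ.IsSmoothOn U :=
  fun z hz => ((contMDiffAt_form_iff _ (mem_chart_source W z)).2 (h z hz)).contMDiffWithinAt

theorem LForm.d_apply {θ : LForm E W H M} {x z : M} (hz : z ∈ (chartAt W x).source)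
    (hθ : DifferentiableAt ℝ (θ.coord x) (extChartAt 𝓘(ℝ, W) x z)) (v : Fin 2 → W) :
    (θ.d z v : E)
      = fderiv ℝ (θ.coord x) (extChartAt 𝓘(ℝ, W) x z) (chartDiff x z (v 0)) (chartDiff x z (v 1))
        - fderiv ℝ (θ.coord x) (extChartAt 𝓘(ℝ, W) x z) (chartDiff x z (v 1))
          (chartDiff x z (v 0)) :=
  extDer_apply hz hθ v

end ChartLForms

/-! ### The total form of a tuple and its curvature -/

namespace SpencerData

variable {E W : Type*} [NormedAddCommGroup E] [NormedSpace ℝ E]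
    [NormedAddCommGroup W] [NormedSpace ℝ W] (S : SpencerData E W)

/-- The derivative of a form with values in `gr k` takes values in `gr k`. -/
theorem fderiv_apply_mem {a : W → W →L[ℝ] E} {y : W} {k : ℤ} (ha : DifferentiableAt ℝ a y)
    (h : ∀ᶠ z in 𝓝 y, ∀ v, a z v ∈ S.gr k) (u v : W) : fderiv ℝ a y u v ∈ S.gr k := by
  let L : (W →L[ℝ] E) →L[ℝ] E :=
    (S.pr k - ContinuousLinearMap.id ℝ E).comp (ContinuousLinearMap.apply ℝ E v)
  have h1 := clm_fderiv_eq_zero L ha (by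
    filter_upwards [h] with z hz
    simp [L, S.pr_of_mem k _ (hz v)]) u
  have h2 : S.pr k (fderiv ℝ a y u v) = fderiv ℝ a y u v := by
    simpa [L, sub_eq_zero] using h1
  rw [← h2]
  exact S.pr_mem k _

/-- The components of the curvature of the sum of forms `a`, `b`, `c` of degrees `-1`, `0`, `1`. -/
theorem pr_curv_add {a b c : W → W →L[ℝ] E} {y : W} (ha : DifferentiableAt ℝ a y)
    (hb : DifferentiableAt ℝ b y) (hc : DifferentiableAt ℝ c y)
    (ha' : ∀ᶠ z in 𝓝 y, ∀ v, a z v ∈ S.gr (-1)) (hb' : ∀ᶠ z in 𝓝 y, ∀ v, b z v ∈ S.gr 0)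
    (hc' : ∀ᶠ z in 𝓝 y, ∀ v, c z v ∈ S.gr 1) (v w : W) :
    S.pr (-1) (S.curv (fun z => a z + b z + c z) y v w) = fderiv ℝ a y v w - fderiv ℝ a y w v
      + (S.br (a y v) (b y w) + S.br (b y v) (a y w)) ∧
    S.pr 0 (S.curv (fun z => a z + b z + c z) y v w) = fderiv ℝ b y v w - fderiv ℝ b y w v
      + (S.br (a y v) (c y w) + S.br (b y v) (b y w) + S.br (c y v) (a y w)) ∧
    S.pr 1 (S.curv (fun z => a z + b z + c z) y v w) = fderiv ℝ c y v w - fderiv ℝ c y w v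
      + (S.br (b y v) (c y w) + S.br (c y v) (b y w)) := by
  have hd : fderiv ℝ (fun z => a z + b z + c z) y = fderiv ℝ a y + fderiv ℝ b y + fderiv ℝ c y :=
    ((ha.hasFDerivAt.add hb.hasFDerivAt).add hc.hasFDerivAt).fderiv
  have ka := S.fderiv_apply_mem ha ha'
  have kb := S.fderiv_apply_mem hb hb'
  have kc := S.fderiv_apply_mem hc hc'
  have la := ha'.self_of_nhds
  have lb := hb'.self_of_nhds
  have lc := hc'.self_of_nhds
  have pa : ∀ x ∈ S.gr (-1), S.pr (-1) x = x ∧ S.pr 0 x = 0 ∧ S.pr 1 x = 0 := fun x hx =>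
    ⟨S.pr_of_mem _ _ hx, S.pr_of_mem_ne _ _ _ (by norm_num) hx,
      S.pr_of_mem_ne _ _ _ (by norm_num) hx⟩
  have pb : ∀ x ∈ S.gr 0, S.pr (-1) x = 0 ∧ S.pr 0 x = x ∧ S.pr 1 x = 0 := fun x hx =>
    ⟨S.pr_of_mem_ne _ _ _ (by norm_num) hx, S.pr_of_mem _ _ hx,
      S.pr_of_mem_ne _ _ _ (by norm_num) hx⟩
  have pc : ∀ x ∈ S.gr 1, S.pr (-1) x = 0 ∧ S.pr 0 x = 0 ∧ S.pr 1 x = x := fun x hx =>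
    ⟨S.pr_of_mem_ne _ _ _ (by norm_num) hx, S.pr_of_mem_ne _ _ _ (by norm_num) hx,
      S.pr_of_mem _ _ hx⟩
  simp only [curv, hd]
  refine ⟨?_, ?_, ?_⟩
  · rw [map_add, S.pr_br_neg]
    simp [fun u w => pa _ (ka u w), fun u w => pb _ (kb u w), fun u w => pc _ (kc u w),
      fun w => pa _ (la w), fun w => pb _ (lb w), fun w => pc _ (lc w)]
  · rw [map_add, S.pr_br_zero]
    simp [fun u w => pa _ (ka u w), fun u w => pb _ (kb u w), fun u w => pc _ (kc u w),
      fun w => pa _ (la w), fun w => pb _ (lb w), fun w => pc _ (lc w)]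
  · rw [map_add, S.pr_br_one]
    simp [fun u w => pa _ (ka u w), fun u w => pb _ (kb u w), fun u w => pc _ (kc u w),
      fun w => pa _ (la w), fun w => pb _ (lb w), fun w => pc _ (lc w)]

end SpencerData

namespace FlatReductive

variable {E : Type*} [NormedAddCommGroup E] [NormedSpace ℝ E] [CompleteSpace E]
  {V : Type*} [NormedAddCommGroup V] [NormedSpace ℝ V]
  {W : Type*} [NormedAddCommGroup W] [NormedSpace ℝ W] [FiniteDimensional ℝ W]
  {H : Type*} [TopologicalSpace H] [ChartedSpace E H] [Group H]
  [LieGroup 𝓘(ℝ, E) ∞ H]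
  {Mt : Type*} [TopologicalSpace Mt] [ChartedSpace V Mt] [MulAction H Mt]
  {M : Type*} [TopologicalSpace M] [ChartedSpace W M]

section

variable {k : ℕ} (T : FlatReductive E V H Mt k) (j : W →ₗ[ℝ] V)

omit [FiniteDimensional ℝ W] in
theorem embW_mem (w : W) : T.embW j w ∈ T.gr (-1) := Subtype.property _

theorem soldering_apply (s : ∀ x : M, Frame W x) (x : M) (v : TangentSpace 𝓘(ℝ, W) x) :
    T.soldering j s x v = T.embW j ((s x).symm v) := rfl

theorem soldering_frame (s : ∀ x : M, Frame W x) (x : M) (w : W) :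
    T.soldering j s x (s x w) = T.embW j w := by
  rw [soldering_apply, (s x).symm_apply_apply]

/-- `[ω^{-1}, ω^{-1}] = 0`, as there is no component of degree `-2`. -/
theorem bracket_soldering (s : ∀ x : M, Frame W x) (x : M) :
    (T.soldering j s).bracket (T.soldering j s) x = 0 := by
  ext v
  have h : ∀ w w' : W, ⁅T.embW j w, T.embW j w'⁆ = 0 := fun w w' => by
    have := T.graded.bracket_mem (-1) (-1) _ _ (T.embW_mem j w) (T.embW_mem j w')
    rwa [T.graded.eq_bot _ (by norm_num), Submodule.mem_bot] at this
  rw [LForm.bracket_apply]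
  simp only [soldering_apply, h, sub_zero]
  rfl

theorem curvature_apply (s : ∀ x : M, Frame W x) (η : ℕ → LForm E W H M) (p : ℕ) (x : M)
    (v : Fin 2 → TangentSpace 𝓘(ℝ, W) x) :
    T.curvature j s η p x v = (T.form j s η p).d x v
      + (1 / 2 : ℝ) • ∑ r ∈ Finset.range p, (η r).bracket (η (p - 1 - r)) x v := by
  rw [curvature, bracket_soldering]
  have hsum : ∀ (t : Finset ℕ) (f : ℕ → TangentSpace 𝓘(ℝ, W) x [⋀^Fin 2]→ₗ[ℝ] LieAlg E H),
      (∑ r ∈ t, f r) v = ∑ r ∈ t, f r v := by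
    intro t f
    induction t using Finset.cons_induction with
    | empty => simp
    | cons a t ha ih => rw [Finset.sum_cons, Finset.sum_cons, AlternatingMap.add_apply, ih]
  simp [hsum]

theorem curvature_congr (s : ∀ x : M, Frame W x) {η η' : ℕ → LForm E W H M} {p : ℕ}
    (h : ∀ r < p, η r = η' r) (x : M) : T.curvature j s η p x = T.curvature j s η' p x := by
  ext v
  rw [curvature_apply, curvature_apply]
  have h1 : T.form j s η p = T.form j s η' p := by
    cases p with
    | zero => rfl
    | succ p => exact h p (Nat.lt_succ_self p)
  rw [h1]
  congr 2
  refine Finset.sum_congr rfl fun r hr => ?_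
  have := Finset.mem_range.1 hr
  rw [h r this, h (p - 1 - r) (by omega)]

end

/-- A frame field on `U` together with forms `ω^r` on `U` with values in `gr r`, for all `r`. -/
structure IsFormTuple [IsManifold 𝓘(ℝ, W) ∞ M] {k : ℕ} (T : FlatReductive E V H Mt k) (U : Set M)
    (s : ∀ x : M, Frame W x) (η : ℕ → LForm E W H M) : Prop where
  frameField : IsFrameField U s
  smooth : ∀ r, (η r).IsSmoothOn U
  mem_gr : ∀ r : ℕ, ∀ x ∈ U, ∀ v, η r x v ∈ T.gr r

/-- The total form `ω^{-1} + ω^0 + ω^1`. In a `2`-reductive structure there are no other degrees. -/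
def totalForm {k : ℕ} (T : FlatReductive E V H Mt k) (j : W →ₗ[ℝ] V) (s : ∀ x : M, Frame W x)
    (η : ℕ → LForm E W H M) : LForm E W H M :=
  fun x => T.soldering j s x + η 0 x + η 1 x

section

variable (T : FlatReductive E V H Mt 2) {j : W →ₗ[ℝ] V} [IsManifold 𝓘(ℝ, W) ∞ M]

omit [IsManifold 𝓘(ℝ, W) ∞ M] in
theorem totalForm_coord (s : ∀ x : M, Frame W x) (η : ℕ → LForm E W H M) (x : M) :
    (T.totalForm j s η).coord x = fun y => (T.soldering j s).coord x y + (η 0).coord x y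
      + (η 1).coord x y := rfl

variable [FiniteDimensional ℝ E] (hj : Function.Injective j) (h11 : Subsingleton (T.Coh j 1 1))
  (h21 : Subsingleton (T.Coh j 2 1))

omit [IsManifold 𝓘(ℝ, W) ∞ M] in
theorem soldering_coord (s : ∀ x : M, Frame W x) {x z : M} (hz : z ∈ (chartAt W x).source) :
    (T.soldering j s).coord x (extChartAt 𝓘(ℝ, W) x z)
      = (T.spencerData j hj h11 h21).j.comp (coordFrameInv s x (extChartAt 𝓘(ℝ, W) x z)) := by
  ext v
  rw [LForm.coord_apply _ hz, ContinuousLinearMap.comp_apply, coordFrameInv_apply s hz]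
  rfl

include hj h11 h21 in
theorem smoothNear_soldering_coord {U : Set M} {s : ∀ x : M, Frame W x} (h : IsFrameField U s)
    {x z : M} (hz : z ∈ (chartAt W x).source) (hzU : z ∈ U) :
    SmoothNear ((T.soldering j s).coord x) (extChartAt 𝓘(ℝ, W) x z) := by
  refine SmoothNear.congr ((smoothNear_const (T.spencerData j hj h11 h21).j).clm_comp
    (h.smoothNear_coordFrameInv hz hzU)) ?_
  filter_upwards [eventually_chart hz (p := fun _ => True) (by simp)]
  rintro _ ⟨z₂, hz₂, -, rfl⟩
  exact T.soldering_coord hj h11 h21 s hz₂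

include hj h11 h21

namespace IsFormTuple

variable {T} {U : Set M} {s : ∀ x : M, Frame W x} {η : ℕ → LForm E W H M}
  (h : T.IsFormTuple U s η) {x z : M} (hz : z ∈ (chartAt W x).source) (hzU : z ∈ U)

include h hz hzU

theorem smoothNear_totalForm :
    SmoothNear ((T.totalForm j s η).coord x) (extChartAt 𝓘(ℝ, W) x z) :=
  ((T.smoothNear_soldering_coord hj h11 h21 h.frameField hz hzU).add
    ((h.smooth 0).smoothNear h.frameField.isOpen hz hzU)).add
    ((h.smooth 1).smoothNear h.frameField.isOpen hz hzU)

/-- The component of degree `-1` of the total form is dual to the frame field. -/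
theorem pr_totalForm :
    ∀ᶠ y in 𝓝 (extChartAt 𝓘(ℝ, W) x z), ∀ w, (T.spencerData j hj h11 h21).pr (-1)
      ((T.totalForm j s η).coord x y (coordFrame s x y w)) = (T.spencerData j hj h11 h21).j w := by
  set S := T.spencerData j hj h11 h21
  filter_upwards [eventually_chart hz (h.frameField.isOpen.mem_nhds hzU)]
  rintro _ ⟨z₂, hz₂, hU, rfl⟩ w
  rw [LForm.coord_coordFrame _ s hz₂]
  have h0 : S.pr (-1) (η 0 z₂ (s z₂ w) : E) = 0 :=
    S.pr_of_mem_ne (-1) 0 _ (by norm_num) (h.mem_gr 0 z₂ hU _)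
  have h1 : S.pr (-1) (η 1 z₂ (s z₂ w) : E) = 0 :=
    S.pr_of_mem_ne (-1) 1 _ (by norm_num) (h.mem_gr 1 z₂ hU _)
  have h2 : T.totalForm j s η z₂ (s z₂ w)
      = T.embW j w + η 0 z₂ (s z₂ w) + η 1 z₂ (s z₂ w) := by
    rw [← T.soldering_frame j s z₂ w]
    rfl
  have h3 : ∀ A B : E, S.pr (-1) A = 0 → S.pr (-1) B = 0 →
      S.pr (-1) (S.j w + A + B) = S.j w := fun A B hA hB => by
    rw [map_add, map_add, hA, hB, add_zero, add_zero, S.pr_of_mem _ _ (S.j_mem w)]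
  exact (congrArg (S.pr (-1)) h2).trans (h3 _ _ h0 h1)

/-- The components of degrees `-1` and `0` of the curvature of the total form are
`Ω^{-1} + [ω^{-1}, ω^0]` and `Ω^0 + [ω^{-1}, ω^1]`, whose vanishing is the condition of
admissibility; that of degree `1` is `Ω^1`. -/
theorem pr_curv (v w : W) :
    (T.spencerData j hj h11 h21).pr (-1) ((T.spencerData j hj h11 h21).curv
        ((T.totalForm j s η).coord x) (extChartAt 𝓘(ℝ, W) x z) (chartDiff x z v) (chartDiff x z w))
      = ((T.curvature j s η 0 z + (T.soldering j s).bracket (η 0) z) ![v, w] : LieAlg E H) ∧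
    (T.spencerData j hj h11 h21).pr 0 ((T.spencerData j hj h11 h21).curv
        ((T.totalForm j s η).coord x) (extChartAt 𝓘(ℝ, W) x z) (chartDiff x z v) (chartDiff x z w))
      = ((T.curvature j s η 1 z + (T.soldering j s).bracket (η 1) z) ![v, w] : LieAlg E H) ∧
    (T.spencerData j hj h11 h21).pr 1 ((T.spencerData j hj h11 h21).curv
        ((T.totalForm j s η).coord x) (extChartAt 𝓘(ℝ, W) x z) (chartDiff x z v) (chartDiff x z w))
      = (T.curvature j s η 2 z ![v, w] : LieAlg E H) := by
  set S := T.spencerData j hj h11 h21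
  set y := extChartAt 𝓘(ℝ, W) x z
  have ha := (T.smoothNear_soldering_coord hj h11 h21 h.frameField hz hzU).differentiableAt
  have hb := ((h.smooth 0).smoothNear h.frameField.isOpen hz hzU).differentiableAt
  have hc := ((h.smooth 1).smoothNear h.frameField.isOpen hz hzU).differentiableAt
  have hmem : ∀ (θ : LForm E W H M) (i : ℤ), (∀ z ∈ U, ∀ v, θ z v ∈ T.gr i) →
      ∀ᶠ y' in 𝓝 y, ∀ v, θ.coord x y' v ∈ S.gr i := by
    intro θ i hθ
    filter_upwards [eventually_chart hz (h.frameField.isOpen.mem_nhds hzU)]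
    rintro _ ⟨z₂, hz₂, hU, rfl⟩ v
    rw [LForm.coord_apply _ hz₂]
    exact hθ z₂ hU _
  have key := S.pr_curv_add ha hb hc (hmem _ (-1) fun z _ v => T.embW_mem j _)
    (hmem _ 0 (h.mem_gr 0)) (hmem _ 1 (h.mem_gr 1)) (chartDiff x z v) (chartDiff x z w)
  have hbr : ∀ X Y : LieAlg E H, S.br X Y = ⁅X, Y⁆ := fun X Y => rfl
  have hcd : ∀ (θ : LForm E W H M) (u : W), θ.coord x y (chartDiff x z u) = (θ z u : LieAlg E H) :=
    fun θ u => θ.coord_chartDiff hz u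
  have da := LForm.d_apply hz ha ![v, w]
  have db := LForm.d_apply hz hb ![v, w]
  have dc := LForm.d_apply hz hc ![v, w]
  have hsk : ∀ X Y : LieAlg E H, ⁅X, Y⁆ = -⁅Y, X⁆ := fun X Y => (lie_skew X Y).symm
  rw [totalForm_coord]
  refine ⟨key.1.trans ?_, key.2.1.trans ?_, key.2.2.trans ?_⟩
  · refine (congrArg₂ (fun X Y : E => X + Y) da.symm (by rw [hcd, hcd, hcd, hcd])).trans ?_
    rw [AlternatingMap.add_apply, curvature_apply, LForm.bracket_apply]
    change ((T.soldering j s).d z ![v, w]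
      + (⁅T.soldering j s z v, η 0 z w⁆ + ⁅η 0 z v, T.soldering j s z w⁆) : LieAlg E H)
      = (T.soldering j s).d z ![v, w] + _
        + (⁅T.soldering j s z v, η 0 z w⁆ - ⁅T.soldering j s z w, η 0 z v⁆)
    rw [hsk (η 0 z v)]
    simp [sub_eq_add_neg]
  · refine (congrArg₂ (fun X Y : E => X + Y) db.symm
      (by rw [hcd, hcd, hcd, hcd, hcd, hcd])).trans ?_
    rw [AlternatingMap.add_apply, curvature_apply, LForm.bracket_apply]
    simp only [Finset.sum_range_one, LForm.bracket_apply]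
    change ((η 0).d z ![v, w]
      + (⁅T.soldering j s z v, η 1 z w⁆ + ⁅η 0 z v, η 0 z w⁆ + ⁅η 1 z v, T.soldering j s z w⁆)
        : LieAlg E H)
      = (η 0).d z ![v, w] + (1 / 2 : ℝ) • (⁅η 0 z v, η 0 z w⁆ - ⁅η 0 z w, η 0 z v⁆)
        + (⁅T.soldering j s z v, η 1 z w⁆ - ⁅T.soldering j s z w, η 1 z v⁆)
    rw [hsk (η 1 z v), hsk (η 0 z w)]
    module
  · refine (congrArg₂ (fun X Y : E => X + Y) dc.symm (by rw [hcd, hcd, hcd, hcd])).trans ?_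
    rw [curvature_apply]
    simp only [Finset.sum_range_succ, Finset.sum_range_zero, LForm.bracket_apply]
    change ((η 1).d z ![v, w] + (⁅η 0 z v, η 1 z w⁆ + ⁅η 1 z v, η 0 z w⁆) : LieAlg E H)
      = (η 1).d z ![v, w] + (1 / 2 : ℝ) • (0 + (⁅η 0 z v, η 1 z w⁆ - ⁅η 0 z w, η 1 z v⁆)
        + (⁅η 1 z v, η 0 z w⁆ - ⁅η 1 z w, η 0 z v⁆))
    rw [hsk (η 0 z w), hsk (η 1 z w)]
    module

end IsFormTuple

end

end FlatReductive

/-! ### The curvature cocycle of an admissible tuple -/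

theorem alternating_swap {W L : Type*} [AddCommGroup W] [Module ℝ W] [AddCommGroup L] [Module ℝ L]
    (c : W [⋀^Fin 2]→ₗ[ℝ] L) (v w : W) : c ![v, w] = -c ![w, v] := by
  have h := c.map_swap ![w, v] (i := 0) (j := 1) (by decide)
  rw [← h]
  congr 1
  ext i
  fin_cases i <;> rfl

namespace FlatReductive

variable {E : Type*} [NormedAddCommGroup E] [NormedSpace ℝ E] [CompleteSpace E]
  {V : Type*} [NormedAddCommGroup V] [NormedSpace ℝ V]
  {W : Type*} [NormedAddCommGroup W] [NormedSpace ℝ W] [FiniteDimensional ℝ W]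
  {H : Type*} [TopologicalSpace H] [ChartedSpace E H] [Group H]
  [LieGroup 𝓘(ℝ, E) ∞ H]
  {Mt : Type*} [TopologicalSpace Mt] [ChartedSpace V Mt] [MulAction H Mt]
  {M : Type*} [TopologicalSpace M] [ChartedSpace W M] [IsManifold 𝓘(ℝ, W) ∞ M]

/-- The tuple `(ω^0, …, ω^{p-1}, 0, 0, …)`. An admissible tuple of order `p` involves arbitrary
`ω^r` for `r ≥ p`, which need not be smooth; they play no role, and are replaced by `0`. -/
def truncForms (p : ℕ) (η : ℕ → LForm E W H M) (r : ℕ) : LForm E W H M :=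
  if r < p then η r else 0

omit [CompleteSpace E] [FiniteDimensional ℝ W] [LieGroup 𝓘(ℝ, E) ∞ H] in
theorem isSmoothOn_zero (U : Set M) : (0 : LForm E W H M).IsSmoothOn U := by
  refine LForm.isSmoothOn fun z hz => ?_
  have h : (0 : LForm E W H M).coord z = fun _ => 0 := by
    funext y
    ext v
    exact (LieAlg.toModel E H).map_zero
  rw [h]
  exact contDiffAt_const

section

variable {k : ℕ} {T : FlatReductive E V H Mt k} {j : W →ₗ[ℝ] V}
  {G : Subgroup (W ≃L[ℝ] W)} {P : GStructure G M} {p : ℕ} {U : Set M} {s : ∀ x : M, Frame W x}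
  {η : ℕ → LForm E W H M}

omit [IsManifold 𝓘(ℝ, W) ∞ M] in
theorem curvature_truncForms (x : M) {q : ℕ} (hq : q ≤ p) :
    T.curvature j s (truncForms p η) q x = T.curvature j s η q x :=
  T.curvature_congr j s (fun _ hr => if_pos (hr.trans_le hq)) x

theorem IsAdmissible.isFormTuple (h : T.IsAdmissible j P p U s η) :
    T.IsFormTuple U s (truncForms p η) := by
  refine ⟨h.frameField, fun r => ?_, fun r x hx v => ?_⟩
  · by_cases hr : r < p
    · rw [truncForms, if_pos hr]
      exact h.smooth r hr
    · rw [truncForms, if_neg hr]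
      exact isSmoothOn_zero U
  · by_cases hr : r < p
    · rw [truncForms, if_pos hr]
      exact h.mem_gr r hr x hx v
    · rw [truncForms, if_neg hr]
      exact (T.gr r).zero_mem

theorem IsAdmissible.of_le {q : ℕ} (h : T.IsAdmissible j P p U s η) (hq : q ≤ p) :
    T.IsAdmissible j P q U s η :=
  ⟨h.frameField, h.mem, fun r hr => h.smooth r (hr.trans_le hq),
    fun r hr => h.mem_gr r (hr.trans_le hq), fun r hr => h.eqn r (hr.trans_le hq)⟩

end

variable {T : FlatReductive E V H Mt 2} {j : W →ₗ[ℝ] V}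
  [FiniteDimensional ℝ E] (hj : Function.Injective j) (h11 : Subsingleton (T.Coh j 1 1))
  (h21 : Subsingleton (T.Coh j 2 1))
  {G : Subgroup (W ≃L[ℝ] W)} {P : GStructure G M} {p : ℕ} {U : Set M} {s : ∀ x : M, Frame W x}
  {η : ℕ → LForm E W H M}

include hj h11 h21

namespace IsAdmissible

/-- The curvature of the total form of an admissible tuple vanishes in degrees `< p - 1`. -/
theorem pr_curv_eq_zero (h : T.IsAdmissible j P p U s η) (hp : p ≤ 2) {x z : M}
    (hz : z ∈ (chartAt W x).source) (hzU : z ∈ U) {i : ℕ} (hi : i < p) :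
    ∀ᶠ y in 𝓝 (extChartAt 𝓘(ℝ, W) x z), ∀ v w, (T.spencerData j hj h11 h21).pr ((i : ℤ) - 1)
      ((T.spencerData j hj h11 h21).curv ((T.totalForm j s (truncForms p η)).coord x) y v w)
        = 0 := by
  filter_upwards [eventually_chart hz (h.frameField.isOpen.mem_nhds hzU)]
  rintro _ ⟨z₂, hz₂, hU, rfl⟩ v w
  obtain ⟨v, rfl⟩ : ∃ v', chartDiff x z₂ v' = v := ⟨_, chartDiff_chartSymmDiff hz₂ v⟩
  obtain ⟨w, rfl⟩ : ∃ w', chartDiff x z₂ w' = w := ⟨_, chartDiff_chartSymmDiff hz₂ w⟩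
  have key := h.isFormTuple.pr_curv hj h11 h21 hz₂ hU v w
  have h0 : T.curvature j s (truncForms p η) i z₂
      + (T.soldering j s).bracket (truncForms p η i) z₂ = 0 := by
    rw [curvature_truncForms _ hi.le, truncForms, if_pos hi, h.eqn i hi z₂ hU, neg_add_cancel]
  obtain rfl | rfl : i = 0 ∨ i = 1 := by omega
  · refine key.1.trans ?_
    rw [h0]
    rfl
  · refine key.2.1.trans ?_
    rw [h0]
    rfl

/-- The lowest component of the curvature of the total form of an admissible tuple, evaluated on the
frame field, is `Ω^{p-1}`. -/
theorem pr_curv_eq (h : T.IsAdmissible j P p U s η) (hp : p ≤ 2) {x z : M}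
    (hz : z ∈ (chartAt W x).source) (hzU : z ∈ U) (v w : W) :
    (T.spencerData j hj h11 h21).pr ((p : ℤ) - 1)
      ((T.spencerData j hj h11 h21).curv ((T.totalForm j s (truncForms p η)).coord x)
        (extChartAt 𝓘(ℝ, W) x z) (coordFrame s x (extChartAt 𝓘(ℝ, W) x z) v)
        (coordFrame s x (extChartAt 𝓘(ℝ, W) x z) w))
      = (T.curvatureW j s η p z ![v, w] : LieAlg E H) := by
  rw [coordFrame_apply s hz, coordFrame_apply s hz]
  have key := h.isFormTuple.pr_curv hj h11 h21 hz hzU (s z v) (s z w)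
  have h0 : (T.soldering j s).bracket (truncForms p η p) z = 0 := by
    ext v
    rw [truncForms, if_neg (lt_irrefl p), LForm.bracket_apply]
    change ⁅T.soldering j s z (v 0), (0 : LieAlg E H)⁆ - ⁅T.soldering j s z (v 1), 0⁆ = 0
    simp
  have h1 : T.curvatureW j s η p z ![v, w]
      = T.curvature j s (truncForms p η) p z ![s z v, s z w] := by
    rw [curvature_truncForms _ le_rfl, curvatureW, AlternatingMap.compLinearMap_apply]
    congr 1
    ext i
    fin_cases i <;> rfl
  rw [h1]
  obtain rfl | rfl | rfl : p = 0 ∨ p = 1 ∨ p = 2 := by omega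
  · refine key.1.trans ?_
    rw [h0, add_zero]
  · refine key.2.1.trans ?_
    rw [h0, add_zero]
  · exact key.2.2

/-- The curvature of an admissible tuple is a cocycle, by the Bianchi identity. -/
theorem curvatureW_mem_cocycles (h : T.IsAdmissible j P p U s η) (hp : p ≤ 2) {z : M}
    (hzU : z ∈ U) : T.curvatureW j s η p z ∈ cocycles (T.embW j) T.gr p 2 := by
  set S := T.spencerData j hj h11 h21
  have hz : z ∈ (chartAt W z).source := mem_chart_source W z
  have hW := fun v w => h.pr_curv_eq hj h11 h21 hp hz hzU v w
  have hform := h.isFormTuple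
  have hηs := hform.smoothNear_totalForm hj h11 h21 hz hzU
  have hpr := (hform.pr_totalForm hj h11 h21 hz hzU).self_of_nhds
  have hzero := fun i (hi : i < p) => h.pr_curv_eq_zero hj h11 h21 hp hz hzU hi
  set y := extChartAt 𝓘(ℝ, W) z z
  set η' := (T.totalForm j s (truncForms p η)).coord z
  set τ := coordFrame s z y
  refine ⟨fun w => ?_, LinearMap.mem_ker.2 ?_⟩
  · have h1 : w = ![w 0, w 1] := by
      ext i
      fin_cases i <;> rfl
    rw [h1]
    have := S.pr_mem ((p : ℤ) - 1) (S.curv η' y (τ (w 0)) (τ (w 1)))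
    rw [hW] at this
    exact this
  · -- in the component of degree `p - 2` of the Bianchi identity, the derivatives do not contribute
    have h1 : ∀ u v w : W, S.pr ((p : ℤ) - 2) (fderiv ℝ (fun z => S.curv η' z v w) y u) = 0 := by
      intro u v w
      by_cases h0 : p = 0
      · subst h0
        have := S.pr_mem (((0 : ℕ) : ℤ) - 2) (fderiv ℝ (fun z => S.curv η' z v w) y u)
        rwa [S.gr_eq_bot _ (by norm_num), Submodule.mem_bot] at this
      · refine clm_fderiv_eq_zero _ (S.smoothNear_curv hηs v w).differentiableAt ?_ u
        filter_upwards [hzero (p - 1) (by omega)] with y' hy'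
        rw [← hy' v w]
        congr 2
        omega
    have h2 : ∀ u v w : W, S.pr ((p : ℤ) - 2) (S.br (η' y (τ u)) (S.curv η' y (τ v) (τ w)))
        = S.br (S.j u) (S.pr ((p : ℤ) - 1) (S.curv η' y (τ v) (τ w))) := by
      intro u v w
      obtain rfl | rfl | rfl : p = 0 ∨ p = 1 ∨ p = 2 := by omega
      · have h3 := S.pr_mem (((0 : ℕ) : ℤ) - 2) (S.br (η' y (τ u)) (S.curv η' y (τ v) (τ w)))
        rw [S.gr_eq_bot _ (by norm_num), Submodule.mem_bot] at h3
        rw [h3, S.br_eq_zero (by norm_num) (S.j_mem u) (S.pr_mem _ _)]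
      · have h4 : S.pr (-1) (S.curv η' y (τ v) (τ w)) = 0 :=
          (hzero 0 (by omega)).self_of_nhds (τ v) (τ w)
        have h5 := S.pr_br_neg (η' y (τ u)) (S.curv η' y (τ v) (τ w))
        rw [h4, hpr, map_zero, add_zero] at h5
        exact h5
      · have h4 : S.pr (-1) (S.curv η' y (τ v) (τ w)) = 0 :=
          (hzero 0 (by omega)).self_of_nhds (τ v) (τ w)
        have h6 : S.pr 0 (S.curv η' y (τ v) (τ w)) = 0 :=
          (hzero 1 (by omega)).self_of_nhds (τ v) (τ w)
        have h5 := S.pr_br_zero (η' y (τ u)) (S.curv η' y (τ v) (τ w))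
        rw [h4, h6, hpr, map_zero, map_zero, add_zero, add_zero] at h5
        exact h5
    ext w
    have h3 := congrArg (S.pr ((p : ℤ) - 2)) (S.bianchi hηs (τ (w 0)) (τ (w 1)) (τ (w 2)))
    simp only [map_add, h1, h2, zero_add, map_zero] at h3
    have h4 : ∀ u v w : W, S.br (S.j u) (S.pr ((p : ℤ) - 1) (S.curv η' y (τ v) (τ w)))
        = (⁅T.embW j u, T.curvatureW j s η p z ![v, w]⁆ : LieAlg E H) :=
      fun u v w => congrArg (S.br (S.j u)) (hW v w)
    rw [h4, h4, h4] at h3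
    rw [spencer_two_apply, alternating_swap _ (w 0) (w 2), neg_lie, ← lie_skew,
      ← lie_skew (T.curvatureW j s η p z ![w 2, w 0]),
      ← lie_skew (T.curvatureW j s η p z ![w 0, w 1])]
    simp only [neg_neg, sub_neg_eq_add]
    exact h3

end IsAdmissible

section

variable [ContMDiffSMul 𝓘(ℝ, E) 𝓘(ℝ, V) ∞ H Mt] [FiniteDimensional ℝ V] [IsManifold 𝓘(ℝ, V) ∞ Mt]
  [ConnectedSpace H] [Nontrivial W] {P : GStructure (T.inducedGroup j) M} {U' : Set M}
  {s' : ∀ x : M, Frame W x} {η' : ℕ → LForm E W H M}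

/-- The logarithmic derivative of the transition function between two frame fields of `P` takes
values in `ad (gr 0)|_W`; it is computed along the curves `t ↦ y + t v`. -/
theorem fderiv_transition_mem (hs : IsFrameField U s) (hsP : ∀ x ∈ U, s x ∈ P.frames x)
    (hs' : IsFrameField U' s') (hsP' : ∀ x ∈ U', s' x ∈ P.frames x) {z : M} (hzU : z ∈ U)
    (hzU' : z ∈ U') :
    ∀ᶠ y in 𝓝 (extChartAt 𝓘(ℝ, W) z z), ∀ v, ∃ r ∈ (T.spencerData j hj h11 h21).inner,
      fderiv ℝ (fun y => coordFrameInv s z y * coordFrame s' z y) y v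
        = coordFrameInv s z y * coordFrame s' z y * r := by
  have hz : z ∈ (chartAt W z).source := mem_chart_source W z
  set φ := extChartAt 𝓘(ℝ, W) z
  set B : W → W →L[ℝ] W := fun y => coordFrameInv s z y * coordFrame s' z y
  have hB : SmoothNear B (φ z) :=
    (hs.smoothNear_coordFrameInv hz hzU).clm_comp (hs'.smoothNear_coordFrame hz hzU')
  let b : M → W ≃L[ℝ] W := fun z' => (s' z').trans (s z').symm
  have hb : ∀ z' ∈ U, z' ∈ U' → b z' ∈ T.inducedGroup j := by
    intro z' h1 h2
    obtain ⟨g, hg, hgs⟩ := (P.mem_iff z' (s z') (s' z') (hsP z' h1)).1 (hsP' z' h2)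
    have : b z' = g := by
      ext w
      simp [b, hgs]
    rwa [this]
  have hbB : ∀ z' ∈ (chartAt W z).source, (b z' : W →L[ℝ] W) = B (φ z') := by
    intro z' hz'
    ext w
    simp only [B, mul_apply_eq_comp]
    rw [coordFrame_apply s' hz']
    exact (coordFrameInv_chartDiff s hz' _).symm
  have hQ : ∀ᶠ y in 𝓝 (φ z), ContDiffAt ℝ ∞ B y ∧ φ.symm y ∈ U ∧ φ.symm y ∈ U' ∧
      (b (φ.symm y) : W →L[ℝ] W) = B y := by
    filter_upwards [hB, eventually_chart hz (hs.isOpen.mem_nhds hzU),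
      eventually_chart hz (hs'.isOpen.mem_nhds hzU')]
    rintro y hy ⟨z₁, hz₁, hU, rfl⟩ ⟨z₂, hz₂, hU', h12⟩
    have h1 : φ.symm (φ z₁) = z₁ := φ.left_inv (by simpa [φ] using hz₁)
    have h2 : φ.symm (φ z₂) = z₂ := φ.left_inv (by simpa [φ] using hz₂)
    refine ⟨hy, by rwa [h1], ?_, ?_⟩
    · rw [h12]
      exact h2.symm ▸ hU'
    · rw [h1]
      exact hbB z₁ hz₁
  filter_upwards [eventually_eventually_nhds.2 hQ] with y hy v
  have hline : Continuous fun t : ℝ => y + t • v := by fun_prop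
  have h0 : y + (0 : ℝ) • v = y := by simp
  have h1 : ∀ᶠ t in 𝓝 (0 : ℝ), ∀ᶠ y' in 𝓝 (y + t • v), ContDiffAt ℝ ∞ B y' ∧ φ.symm y' ∈ U ∧
      φ.symm y' ∈ U' ∧ (b (φ.symm y') : W →L[ℝ] W) = B y' := by
    have h3 : Tendsto (fun t : ℝ => y + t • v) (𝓝 0) (𝓝 y) := by
      have := hline.tendsto 0
      rwa [h0] at this
    exact h3.eventually (eventually_eventually_nhds.2 hy)
  obtain ⟨ε, hε, h2⟩ := Metric.eventually_nhds_iff_ball.1 h1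
  rw [Real.ball_eq_Ioo, zero_sub, zero_add] at h2
  have hBd : ContinuousAt (fun t : ℝ => fderiv ℝ B (y + t • v) v) 0 := by
    have h3 : ContinuousAt (fderiv ℝ B) y :=
      (hy.self_of_nhds.1.fderiv_right (m := 0) (by simp)).continuousAt
    exact (ContinuousAt.comp_of_eq h3 hline.continuousAt h0).clm_apply continuousAt_const
  obtain ⟨r, hr, hrB⟩ := T.mem_inner_of_curve hj h11 h21 (c := fun t => b (φ.symm (y + t • v)))
    (c' := fun t => fderiv ℝ B (y + t • v) v) hε
    (fun t ht => hb _ (h2 t ht).self_of_nhds.2.1 (h2 t ht).self_of_nhds.2.2.1)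
    (fun t ht => by
      have h3 := ((h2 t ht).self_of_nhds.1.differentiableAt (by simp)).hasFDerivAt
      have h4 : HasDerivAt (fun t : ℝ => y + t • v) v t := by
        simpa using ((hasDerivAt_id t).smul_const v).const_add y
      refine (h3.comp_hasDerivAt t h4).congr_of_eventuallyEq ?_
      filter_upwards [hline.continuousAt.eventually (h2 t ht)] with t' ht'
      exact ht'.2.2.2) hBd
  refine ⟨r, hr, ?_⟩
  simp only [h0] at hrB
  rw [hrB, hy.self_of_nhds.2.2.2]

/-- The class of the curvature of an admissible tuple depends only on the frame. -/
theorem IsAdmissible.curvatureW_sub_mem (h : T.IsAdmissible j P p U s η) (hp : p ≤ 2)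
    (h' : T.IsAdmissible j P p U' s' η') {z : M} (hzU : z ∈ U) (hzU' : z ∈ U')
    (hss : s z = s' z) :
    T.curvatureW j s' η' p z - T.curvatureW j s η p z ∈ coboundaries (T.embW j) T.gr p 2 := by
  have : CompleteSpace W := FiniteDimensional.complete ℝ W
  set S := T.spencerData j hj h11 h21
  have hz : z ∈ (chartAt W z).source := mem_chart_source W z
  have hW := fun v w => h.pr_curv_eq hj h11 h21 hp hz hzU v w
  have hW' := fun v w => h'.pr_curv_eq hj h11 h21 hp hz hzU' v w
  have hηs := h.isFormTuple.smoothNear_totalForm hj h11 h21 hz hzU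
  have hηs' := h'.isFormTuple.smoothNear_totalForm hj h11 h21 hz hzU'
  have hpr := h.isFormTuple.pr_totalForm hj h11 h21 hz hzU
  have hpr' := h'.isFormTuple.pr_totalForm hj h11 h21 hz hzU'
  have hzero := fun i (hi : i < p) => h.pr_curv_eq_zero hj h11 h21 hp hz hzU hi
  have hzero' := fun i (hi : i < p) => h'.pr_curv_eq_zero hj h11 h21 hp hz hzU' hi
  have hd := fderiv_transition_mem hj h11 h21 h.frameField h.mem h'.frameField h'.mem hzU hzU'
  have hB : SmoothNear (fun y => coordFrameInv s z y * coordFrame s' z y)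
      (extChartAt 𝓘(ℝ, W) z z) :=
    (h.frameField.smoothNear_coordFrameInv hz hzU).clm_comp
      (h'.frameField.smoothNear_coordFrame hz hzU')
  have hτ' := h'.frameField.smoothNear_coordFrame hz hzU'
  have hev := eventually_chart hz (p := fun _ => True) (by simp)
  have hsurj : ∀ᶠ y in 𝓝 (extChartAt 𝓘(ℝ, W) z z), Function.Surjective (coordFrame s' z y) := by
    filter_upwards [hev]
    rintro _ ⟨z₂, hz₂, -, rfl⟩ v
    exact ⟨_, coordFrame_coordFrameInv s' hz₂ v⟩
  have hττ : ∀ᶠ y in 𝓝 (extChartAt 𝓘(ℝ, W) z z), ∀ w,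
      coordFrame s' z y w = coordFrame s z y ((coordFrameInv s z y * coordFrame s' z y) w) := by
    filter_upwards [hev]
    rintro _ ⟨z₂, hz₂, -, rfl⟩ w
    exact (coordFrame_coordFrameInv s hz₂ _).symm
  have hττ0 : coordFrame s' z (extChartAt 𝓘(ℝ, W) z z)
      = coordFrame s z (extChartAt 𝓘(ℝ, W) z z) := by
    ext w
    rw [coordFrame_apply s hz, coordFrame_apply s' hz, hss]
  have h1 : coordFrameInv s z (extChartAt 𝓘(ℝ, W) z z) * coordFrame s' z (extChartAt 𝓘(ℝ, W) z z)
      = 1 := by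
    ext w
    rw [hττ0]
    exact coordFrameInv_coordFrame s hz w
  set y := extChartAt 𝓘(ℝ, W) z z
  -- a `1`-cochain which accounts for the difference of the two curvatures
  have key : ∃ c : W →L[ℝ] E, (∀ w, c w ∈ S.gr p) ∧ ∀ v w,
      S.pr ((p : ℤ) - 1) (S.curv ((T.totalForm j s' (truncForms p η')).coord z) y
        (coordFrame s' z y v) (coordFrame s' z y w))
      - S.pr ((p : ℤ) - 1) (S.curv ((T.totalForm j s (truncForms p η)).coord z) y
        (coordFrame s' z y v) (coordFrame s' z y w))
      = S.br (c v) (S.j w) - S.br (c w) (S.j v) := by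
    obtain rfl | rfl | rfl : p = 0 ∨ p = 1 ∨ p = 2 := by omega
    · exact S.curv_class_zero hB h1 hd hηs hηs' hpr hpr' hsurj hττ
    · exact S.curv_class_one hB h1 hd hηs hηs' hτ' hpr hpr' hsurj hττ (hzero 0 (by omega))
        (hzero' 0 (by omega))
    · refine ⟨0, fun w => (S.gr _).zero_mem, fun v w => ?_⟩
      rw [S.curv_class_two hB h1 hd hηs hηs' hτ' hpr hpr' hsurj hττ (hzero 0 (by omega))
        (hzero' 0 (by omega)) (hzero 1 (by omega)) (hzero' 1 (by omega))]
      simp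
  obtain ⟨c, hc, hcc⟩ := key
  let c1 : W [⋀^Fin 1]→ₗ[ℝ] LieAlg E H :=
    AlternatingMap.ofSubsingleton ℝ W (LieAlg E H) (0 : Fin 1)
      ((LieAlg.toModel E H).symm.toLinearEquiv.toLinearMap ∘ₗ c.toLinearMap)
  refine ⟨c1, fun w => ?_, ?_⟩
  · rw [add_sub_cancel_right]
    exact hc (w 0)
  · ext w
    rw [spencer_one_apply, AlternatingMap.sub_apply]
    have h2 : w = ![w 0, w 1] := by
      ext i
      fin_cases i <;> rfl
    rw [h2]
    have h3 := hcc (w 0) (w 1)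
    have h4 := hW (w 0) (w 1)
    rw [← hττ0] at h4
    exact h3.symm.trans (congrArg₂ (fun X Y : E => X - Y) (hW' (w 0) (w 1)) h4)

end

end FlatReductive

/-! ### Change of frame, and the equivariance of the Spencer complex -/

section

variable {E : Type*} [NormedAddCommGroup E] [NormedSpace ℝ E]
  {W : Type*} [NormedAddCommGroup W] [NormedSpace ℝ W]
  {H : Type*} [TopologicalSpace H] [ChartedSpace E H] [Group H]
  {M : Type*} [TopologicalSpace M] [ChartedSpace W M]

/-- The composition of an `𝔥`-valued form with an endomorphism of `𝔥`. -/
def LForm.map [FiniteDimensional ℝ E] (L : LieAlg E H →ₗ[ℝ] LieAlg E H) (θ : LForm E W H M) :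
    LForm E W H M :=
  fun x => ((LieAlg.toModel E H).symm.toContinuousLinearMap.comp
    (LinearMap.toContinuousLinearMap ((LieAlg.toModel E H).toLinearEquiv.toLinearMap ∘ₗ L ∘ₗ
      (LieAlg.toModel E H).symm.toLinearEquiv.toLinearMap))).comp
        ((LieAlg.toModel E H).toContinuousLinearMap.comp (θ x))

variable [FiniteDimensional ℝ E] (L : LieAlg E H →ₗ[ℝ] LieAlg E H) {θ : LForm E W H M}

theorem LForm.map_apply (x : M) (v : TangentSpace 𝓘(ℝ, W) x) : θ.map L x v = L (θ x v) := rfl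

theorem LForm.map_coord (x : M) : (θ.map L).coord x = fun y =>
    (LinearMap.toContinuousLinearMap ((LieAlg.toModel E H).toLinearEquiv.toLinearMap ∘ₗ L ∘ₗ
      (LieAlg.toModel E H).symm.toLinearEquiv.toLinearMap)).comp (θ.coord x y) := rfl

variable [IsManifold 𝓘(ℝ, W) ∞ M]

theorem LForm.IsSmoothOn.map {U : Set M} (h : θ.IsSmoothOn U) (hU : IsOpen U) :
    (θ.map L).IsSmoothOn U := by
  refine LForm.isSmoothOn fun z hz => ?_
  rw [LForm.map_coord]
  exact contDiffAt_const.clm_comp (h.smoothNear hU (mem_chart_source W z) hz).contDiffAt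

theorem LForm.map_d {z : M}
    (hθ : DifferentiableAt ℝ (θ.coord z) (extChartAt 𝓘(ℝ, W) z z)) :
    (θ.map L).d z = L.compAlternatingMap (θ.d z) := by
  ext v
  have hz : z ∈ (chartAt W z).source := mem_chart_source W z
  let L' : E →L[ℝ] E := LinearMap.toContinuousLinearMap
    ((LieAlg.toModel E H).toLinearEquiv.toLinearMap ∘ₗ L ∘ₗ
      (LieAlg.toModel E H).symm.toLinearEquiv.toLinearMap)
  have h1 : HasFDerivAt ((θ.map L).coord z)
      ((ContinuousLinearMap.compL ℝ W E E L').comp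
        (fderiv ℝ (θ.coord z) (extChartAt 𝓘(ℝ, W) z z))) (extChartAt 𝓘(ℝ, W) z z) :=
    (ContinuousLinearMap.compL ℝ W E E L').hasFDerivAt.comp _ hθ.hasFDerivAt
  refine (LForm.d_apply hz h1.differentiableAt v).trans ?_
  rw [h1.fderiv]
  have h2 := congrArg L' (LForm.d_apply hz hθ v)
  rw [map_sub] at h2
  exact h2.symm

end

namespace FlatReductive

variable {E : Type*} [NormedAddCommGroup E] [NormedSpace ℝ E] [CompleteSpace E]
  {V : Type*} [NormedAddCommGroup V] [NormedSpace ℝ V]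
  {W : Type*} [NormedAddCommGroup W] [NormedSpace ℝ W] [FiniteDimensional ℝ W]
  {H : Type*} [TopologicalSpace H] [ChartedSpace E H] [Group H]
  [LieGroup 𝓘(ℝ, E) ∞ H]
  {Mt : Type*} [TopologicalSpace Mt] [ChartedSpace V Mt] [MulAction H Mt]
  {M : Type*} [TopologicalSpace M] [ChartedSpace W M] [IsManifold 𝓘(ℝ, W) ∞ M]
  {T : FlatReductive E V H Mt 2} {j : W →ₗ[ℝ] V} [ContMDiffSMul 𝓘(ℝ, E) 𝓘(ℝ, V) ∞ H Mt]
  [FiniteDimensional ℝ E] [Nontrivial W] (hj : Function.Injective j)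
  (h11 : Subsingleton (T.Coh j 1 1)) (h21 : Subsingleton (T.Coh j 2 1))
  {g : H} {A : V ≃L[ℝ] V} {B : W ≃L[ℝ] W} (hg : T.IsIsotropy g A) (hB : IsUpperLeft j A B)

include hj h11 h21 hg hB

omit [IsManifold 𝓘(ℝ, W) ∞ M] [TopologicalSpace M] [ChartedSpace W M] in
theorem spencer_actCochain {q : ℕ} (c : W [⋀^Fin q]→ₗ[ℝ] LieAlg E H) :
    spencer (T.embW j) q (T.actCochain g B c) = T.actCochain g B (spencer (T.embW j) q c) := by
  ext w
  simp only [actCochain, AlternatingMap.compLinearMap_apply, LinearMap.compAlternatingMap_apply,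
    spencer_apply, map_sum, map_zsmul]
  refine Finset.sum_congr rfl fun i _ => ?_
  rw [T.gradedAd_lie hj h11 h21 hg]
  congr 2
  refine (congrArg (T.embW j) (B.apply_symm_apply (w i)).symm).trans ?_
  exact (T.gradedAd_embW hg hB _).symm

omit [IsManifold 𝓘(ℝ, W) ∞ M] [TopologicalSpace M] [ChartedSpace W M] [Nontrivial W]
  [FiniteDimensional ℝ W] [FiniteDimensional ℝ E] [ContMDiffSMul 𝓘(ℝ, E) 𝓘(ℝ, V) ∞ H Mt]
  hj h11 h21 hg hB in
theorem actCochain_mem {p : ℤ} {q : ℕ} {c : W [⋀^Fin q]→ₗ[ℝ] LieAlg E H}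
    (hc : c ∈ cochains T.gr p q) : T.actCochain g B c ∈ cochains T.gr p q :=
  fun w => T.gradedAd_mem g _ (hc fun i => B.symm (w i))

omit [IsManifold 𝓘(ℝ, W) ∞ M] [TopologicalSpace M] [ChartedSpace W M] in
theorem actCochain_mem_cocycles {p : ℤ} {q : ℕ} {c : W [⋀^Fin q]→ₗ[ℝ] LieAlg E H}
    (hc : c ∈ cocycles (T.embW j) T.gr p q) :
    T.actCochain g B c ∈ cocycles (T.embW j) T.gr p q := by
  refine ⟨actCochain_mem hc.1, LinearMap.mem_ker.2 ?_⟩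
  rw [spencer_actCochain hj h11 h21 hg hB, LinearMap.mem_ker.1 hc.2]
  ext w
  exact (T.gradedAd g).map_zero

omit [IsManifold 𝓘(ℝ, W) ∞ M] [TopologicalSpace M] [ChartedSpace W M] in
theorem actCochain_mem_coboundaries {p : ℤ} {c : W [⋀^Fin 2]→ₗ[ℝ] LieAlg E H}
    (hc : c ∈ coboundaries (T.embW j) T.gr p 2) :
    T.actCochain g B c ∈ coboundaries (T.embW j) T.gr p 2 := by
  obtain ⟨b, hb, rfl⟩ := hc
  exact ⟨_, actCochain_mem hb, spencer_actCochain hj h11 h21 hg hB b⟩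

variable {U : Set M} {s : ∀ x : M, Frame W x} {η : ℕ → LForm E W H M} {p : ℕ}

omit [Nontrivial W] [IsManifold 𝓘(ℝ, W) ∞ M] hj h11 h21 in
/-- The change of the frame field by `B⁻¹` transforms `ω^{-1}` by the action of `g` on `𝔥`. -/
theorem soldering_trans : T.soldering j (fun x => B⁻¹.trans (s x))
    = (T.soldering j s).map (T.gradedAd g) := by
  funext x
  ext v
  exact (T.gradedAd_embW hg hB _).symm

/-- Together, the change of the frame field by `B⁻¹` and of the forms `ω^r` by the action of `g` on
`𝔥` transform the curvature by the action of `g`. -/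
theorem curvature_trans {x : M} (hd : DifferentiableAt ℝ ((T.form j s η p).coord x)
      (extChartAt 𝓘(ℝ, W) x x)) :
    T.curvature j (fun x => B⁻¹.trans (s x)) (fun r => (η r).map (T.gradedAd g)) p x
      = (T.gradedAd g).compAlternatingMap (T.curvature j s η p x) := by
  ext v
  have hf : T.form j (fun x => B⁻¹.trans (s x)) (fun r => (η r).map (T.gradedAd g)) p
      = (T.form j s η p).map (T.gradedAd g) := by
    cases p with
    | zero => exact soldering_trans hg hB
    | succ p => rfl
  rw [LinearMap.compAlternatingMap_apply, curvature_apply, curvature_apply, hf,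
    LForm.map_d _ hd, map_add, map_smul, map_sum]
  congr 2
  refine Finset.sum_congr rfl fun r _ => ?_
  simp only [LForm.bracket_apply, LForm.map_apply, map_sub, T.gradedAd_lie hj h11 h21 hg]

theorem curvatureW_trans {x : M} (hd : DifferentiableAt ℝ ((T.form j s η p).coord x)
      (extChartAt 𝓘(ℝ, W) x x)) :
    T.curvatureW j (fun x => B⁻¹.trans (s x)) (fun r => (η r).map (T.gradedAd g)) p x
      = T.actCochain g B (T.curvatureW j s η p x) := by
  rw [curvatureW, curvature_trans hj h11 h21 hg hB hd]
  rfl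

omit [Nontrivial W] [ContMDiffSMul 𝓘(ℝ, E) 𝓘(ℝ, V) ∞ H Mt] hg hB in
theorem IsAdmissible.differentiableAt_form {G : Subgroup (W ≃L[ℝ] W)} {P : GStructure G M}
    (h : T.IsAdmissible j P p U s η) {q : ℕ} (hq : q ≤ p) {x : M} (hx : x ∈ U) :
    DifferentiableAt ℝ ((T.form j s η q).coord x) (extChartAt 𝓘(ℝ, W) x x) := by
  have hz : x ∈ (chartAt W x).source := mem_chart_source W x
  cases q with
  | zero => exact (T.smoothNear_soldering_coord hj h11 h21 h.frameField hz hx).differentiableAt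
  | succ q => exact ((h.smooth q hq).smoothNear h.frameField.isOpen hz hx).differentiableAt

/-- Isotropic elements act on admissible tuples. -/
theorem IsAdmissible.trans {G : Subgroup (W ≃L[ℝ] W)} {P : GStructure G M}
    (h : T.IsAdmissible j P p U s η) (hBG : B ∈ G) :
    T.IsAdmissible j P p U (fun x => B⁻¹.trans (s x)) (fun r => (η r).map (T.gradedAd g)) := by
  refine ⟨⟨h.frameField.isOpen, fun v => h.frameField.smooth (B⁻¹ v)⟩, fun x hx => ?_,
    fun r hr => (h.smooth r hr).map _ h.frameField.isOpen,
    fun r hr x hx v => T.gradedAd_mem g r (h.mem_gr r hr x hx v), fun r hr x hx => ?_⟩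
  · exact (P.mem_iff x _ _ (h.mem x hx)).2 ⟨B⁻¹, inv_mem hBG, rfl⟩
  · rw [curvature_trans hj h11 h21 hg hB (h.differentiableAt_form hj h11 h21 hr.le hx),
      h.eqn r hr x hx, soldering_trans hg hB]
    ext v
    simp only [LinearMap.compAlternatingMap_apply, AlternatingMap.neg_apply, LForm.bracket_apply,
      LForm.map_apply, map_sub, map_neg, T.gradedAd_lie hj h11 h21 hg]

omit hg hB in
/-- Every frame of `P` is the value of an admissible tuple. -/
theorem exists_isAdmissible {P : GStructure (T.inducedGroup j) M}
    (hP : T.ImmersibleToOrder j P p) {x : M} {u : Frame W x} (hu : u ∈ P.frames x) :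
    ∃ U s η, x ∈ U ∧ T.IsAdmissible j P p U s η ∧ s x = u := by
  obtain ⟨U, s, η, hx, h⟩ := hP x
  obtain ⟨B, hB, rfl⟩ := (P.mem_iff x _ _ (h.mem x hx)).1 hu
  -- a tuple exists at another frame `u · B⁻¹` over `x`; the element acting by `B⁻¹` moves it to `u`
  obtain ⟨A, ⟨⟨g, hg⟩, -⟩, hAB⟩ := inv_mem hB
  refine ⟨U, _, _, hx, h.trans hj h11 h21 hg hAB (inv_mem hB), ?_⟩
  rw [inv_inv]

end FlatReductive

/-! ### The essential curvature as an obstruction -/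

/-- A linear map has a linear section over its range, extended to the whole space. -/
theorem exists_generalized_inverse {K X Y : Type*} [Field K] [AddCommGroup X] [Module K X]
    [AddCommGroup Y] [Module K Y] (D : X →ₗ[K] Y) : ∃ σ : Y →ₗ[K] X, ∀ x, D (σ (D x)) = D x := by
  obtain ⟨σ₀, hσ₀⟩ := D.rangeRestrict.exists_rightInverse_of_surjective D.range_rangeRestrict
  obtain ⟨σ, hσ⟩ := LinearMap.exists_extend σ₀
  refine ⟨σ, fun x => ?_⟩
  have h1 : σ (D x) = σ₀ (D.rangeRestrict x) := DFunLike.congr_fun hσ (D.rangeRestrict x)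
  rw [h1]
  exact congrArg Subtype.val (DFunLike.congr_fun hσ₀ (D.rangeRestrict x))

namespace FlatReductive

variable {E : Type*} [NormedAddCommGroup E] [NormedSpace ℝ E] [CompleteSpace E]
  {V : Type*} [NormedAddCommGroup V] [NormedSpace ℝ V]
  {W : Type*} [NormedAddCommGroup W] [NormedSpace ℝ W] [FiniteDimensional ℝ W]
  {H : Type*} [TopologicalSpace H] [ChartedSpace E H] [Group H]
  [LieGroup 𝓘(ℝ, E) ∞ H]
  {Mt : Type*} [TopologicalSpace Mt] [ChartedSpace V Mt] [MulAction H Mt]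
  {M : Type*} [TopologicalSpace M] [ChartedSpace W M] [IsManifold 𝓘(ℝ, W) ∞ M]
  {T : FlatReductive E V H Mt 2} {j : W →ₗ[ℝ] V}
  {G : Subgroup (W ≃L[ℝ] W)} {P : GStructure G M} {p : ℕ} {U : Set M} {s : ∀ x : M, Frame W x}
  {η : ℕ → LForm E W H M}

omit [IsManifold 𝓘(ℝ, W) ∞ M] in
theorem curvatureW_frame_symm (x : M) (v w : TangentSpace 𝓘(ℝ, W) x) :
    T.curvatureW j s η p x ![(s x).symm v, (s x).symm w] = T.curvature j s η p x ![v, w] := by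
  rw [curvatureW, AlternatingMap.compLinearMap_apply]
  congr 1
  ext i
  fin_cases i
  · exact (s x).apply_symm_apply v
  · exact (s x).apply_symm_apply w

/-- If an admissible tuple is extended by `ω^p`, then `Ω^{p-1} = -[ω^{-1}, ω^p]` is the coboundary
of `-ω^p`. -/
theorem curvatureW_mem_coboundaries (h : T.IsAdmissible j P (p + 1) U s η) {x : M} (hx : x ∈ U) :
    T.curvatureW j s η p x ∈ coboundaries (T.embW j) T.gr p 2 := by
  let c : W [⋀^Fin 1]→ₗ[ℝ] LieAlg E H :=
    AlternatingMap.ofSubsingleton ℝ W (LieAlg E H) (0 : Fin 1)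
      (-((η p x).toLinearMap ∘ₗ (s x).toLinearEquiv.toLinearMap))
  refine ⟨c, fun w => ?_, ?_⟩
  · rw [add_sub_cancel_right]
    exact neg_mem (h.mem_gr p (Nat.lt_succ_self p) x hx _)
  · ext w
    rw [spencer_one_apply, curvatureW, AlternatingMap.compLinearMap_apply,
      h.eqn p (Nat.lt_succ_self p) x hx, AlternatingMap.neg_apply, LForm.bracket_apply]
    change ⁅-(η p x (s x (w 0))), T.embW j (w 1)⁆ - ⁅-(η p x (s x (w 1))), T.embW j (w 0)⁆
      = -(⁅T.soldering j s x (s x (w 0)), η p x (s x (w 1))⁆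
        - ⁅T.soldering j s x (s x (w 1)), η p x (s x (w 0))⁆)
    rw [soldering_frame, soldering_frame, neg_lie, neg_lie, lie_skew, lie_skew]
    abel

variable [FiniteDimensional ℝ E] (hj : Function.Injective j)
  (h11 : Subsingleton (T.Coh j 1 1)) (h21 : Subsingleton (T.Coh j 2 1))

/-- The curvature of a tuple as a bilinear map. -/
def curvatureBilin (T : FlatReductive E V H Mt 2) (j : W →ₗ[ℝ] V) (s : ∀ x : M, Frame W x)
    (η : ℕ → LForm E W H M) (p : ℕ) (x : M) : W →L[ℝ] W →L[ℝ] E :=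
  LinearMap.toContinuousLinearMap
    ((LinearMap.toContinuousLinearMap : (W →ₗ[ℝ] E) ≃ₗ[ℝ] (W →L[ℝ] E)).toLinearMap ∘ₗ
      LinearMap.mk₂ ℝ (fun v w => LieAlg.toModel E H (T.curvatureW j s η p x ![v, w]))
        (fun v v' w => by
          rw [← map_add]
          congr 1
          exact (T.curvatureW j s η p x).map_vecCons_add ![w] v v')
        (fun a v w => by
          rw [← map_smul]
          congr 1
          exact (T.curvatureW j s η p x).map_vecCons_smul ![w] a v)
        (fun v w w' => by
          rw [← map_add]
          congr 1
          rw [alternating_swap, alternating_swap _ v w, alternating_swap _ v w', ← neg_add]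
          exact congrArg Neg.neg ((T.curvatureW j s η p x).map_vecCons_add ![v] w w'))
        (fun a v w => by
          rw [← map_smul]
          congr 1
          rw [alternating_swap, alternating_swap _ v w, smul_neg]
          exact congrArg Neg.neg ((T.curvatureW j s η p x).map_vecCons_smul ![v] a w)))

include hj h11 h21

theorem IsAdmissible.smoothNear_curvatureBilin (h : T.IsAdmissible j P p U s η) (hp : p ≤ 2)
    {x z : M} (hz : z ∈ (chartAt W x).source) (hzU : z ∈ U) :
    SmoothNear (fun y => T.curvatureBilin j s η p ((extChartAt 𝓘(ℝ, W) x).symm y))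
      (extChartAt 𝓘(ℝ, W) x z) := by
  set S := T.spencerData j hj h11 h21
  refine smoothNear_of_clm_apply fun v => smoothNear_of_clm_apply fun w => ?_
  have hηs := h.isFormTuple.smoothNear_totalForm hj h11 h21 hz hzU
  have hτ := h.frameField.smoothNear_coordFrame hz hzU
  set η' := (T.totalForm j s (truncForms p η)).coord x
  have hv := hτ.clm_apply (smoothNear_const v)
  have hw := hτ.clm_apply (smoothNear_const w)
  have h1 : SmoothNear (fun y => S.pr ((p : ℤ) - 1)
      (S.curv η' y (coordFrame s x y v) (coordFrame s x y w))) (extChartAt 𝓘(ℝ, W) x z) :=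
    SmoothNear.clm _ ((((hηs.fderiv.clm_apply hv).clm_apply hw).sub
      ((hηs.fderiv.clm_apply hw).clm_apply hv)).add
        (((hηs.clm_apply hv).clm S.br).clm_apply (hηs.clm_apply hw)))
  refine h1.congr ?_
  filter_upwards [eventually_chart hz (h.frameField.isOpen.mem_nhds hzU)]
  rintro _ ⟨z₂, hz₂, hU, rfl⟩
  rw [(extChartAt 𝓘(ℝ, W) x).left_inv (by simpa using hz₂)]
  exact (h.pr_curv_eq hj h11 h21 hp hz₂ hU v w).symm

omit h11 h21 hj [CompleteSpace E] [FiniteDimensional ℝ W] [FiniteDimensional ℝ E] in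
/-- The Spencer operator on `1`-cochains of degree `p` has a linear section over its range, so that
a coboundary which depends smoothly on parameters is the coboundary of a cochain which depends
smoothly on them. -/
theorem exists_linear_primitive [FiniteDimensional ℝ W] [FiniteDimensional ℝ E]
    (S : SpencerData E W) (p : ℤ) :
    ∃ σ : (W →L[ℝ] W →L[ℝ] E) →L[ℝ] (W →L[ℝ] E), (∀ b w, σ b w ∈ S.gr p) ∧
      ∀ b : W →L[ℝ] W →L[ℝ] E, (∃ c : W →L[ℝ] E, (∀ w, c w ∈ S.gr p) ∧
        ∀ v w, b v w = S.br (c v) (S.j w) - S.br (c w) (S.j v)) →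
        ∀ v w, b v w = S.br (σ b v) (S.j w) - S.br (σ b w) (S.j v) := by
  let K : Submodule ℝ (W →L[ℝ] E) :=
    { carrier := {c | ∀ w, c w ∈ S.gr p}
      add_mem' := fun hc hd w => (S.gr p).add_mem (hc w) (hd w)
      zero_mem' := fun _ => (S.gr p).zero_mem
      smul_mem' := fun a _ hc w => (S.gr p).smul_mem a (hc w) }
  let D0 : (W →L[ℝ] E) →L[ℝ] (W →L[ℝ] W →L[ℝ] E) :=
    (ContinuousLinearMap.compL ℝ W E (W →L[ℝ] E)
      (((ContinuousLinearMap.compL ℝ W E E).flip S.j).comp S.br))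
  let D : K →ₗ[ℝ] (W →L[ℝ] W →L[ℝ] E) :=
    { toFun := fun c => D0 c - (D0 c).flip
      map_add' := fun c d => by
        ext v w
        simp
        abel
      map_smul' := fun a c => by
        ext v w
        simp [smul_sub] }
  have hD : ∀ (c : K) (v w : W), D c v w = S.br (c.1 v) (S.j w) - S.br (c.1 w) (S.j v) :=
    fun c v w => rfl
  obtain ⟨σ, hσ⟩ := exists_generalized_inverse D
  refine ⟨LinearMap.toContinuousLinearMap (K.subtype ∘ₗ σ), fun b w => (σ b).2 w, ?_⟩
  rintro b ⟨c, hc, hcb⟩ v w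
  have hb : D ⟨c, hc⟩ = b := by
    ext v w
    rw [hcb, hD]
  have h1 := hσ ⟨c, hc⟩
  rw [hb] at h1
  have h3 := hD (σ b) v w
  rw [h1] at h3
  exact h3

omit hj h11 h21 [CompleteSpace E] [LieGroup 𝓘(ℝ, E) ∞ H] [FiniteDimensional ℝ E] in
/-- Smoothness of a form whose components in a frame field are smooth. -/
theorem contDiffAt_coord_of_frame (hs : IsFrameField U s) {f : M → W →L[ℝ] E} {θ : LForm E W H M}
    (hθ : ∀ x v, θ x v = (f x ((s x).symm v) : E)) {z : M} (hz : z ∈ U)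
    (hf : SmoothNear (fun y => f ((extChartAt 𝓘(ℝ, W) z).symm y)) (extChartAt 𝓘(ℝ, W) z z)) :
    ContDiffAt ℝ ∞ (θ.coord z) (extChartAt 𝓘(ℝ, W) z z) := by
  have hzz : z ∈ (chartAt W z).source := mem_chart_source W z
  refine ((hf.clm_comp (hs.smoothNear_coordFrameInv hzz hz)).congr ?_).contDiffAt
  filter_upwards [eventually_chart hzz (p := fun _ => True) (by simp)]
  rintro _ ⟨z₂, hz₂, -, rfl⟩
  ext v
  rw [LForm.coord_apply _ hz₂, ContinuousLinearMap.comp_apply, coordFrameInv_apply s hz₂,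
    (extChartAt 𝓘(ℝ, W) z).left_inv (by simpa using hz₂)]
  exact hθ _ _

/-- If the curvature of an admissible tuple is a coboundary at each point, then the tuple can be
extended by one more form. -/
theorem IsAdmissible.exists_succ (h : T.IsAdmissible j P p U s η) (hp : p ≤ 2)
    (hc : ∀ x ∈ U, T.curvatureW j s η p x ∈ coboundaries (T.embW j) T.gr p 2) :
    ∃ η', T.IsAdmissible j P (p + 1) U s η' := by
  set S := T.spencerData j hj h11 h21
  obtain ⟨σ, hσ, hσb⟩ := exists_linear_primitive S p
  let μ : LForm E W H M := fun x => -((LieAlg.toModel E H).symm.toContinuousLinearMap.comp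
    ((σ (T.curvatureBilin j s η p x)).comp (s x).symm.toContinuousLinearMap))
  have hμ : ∀ x v, μ x v = -(σ (T.curvatureBilin j s η p x) ((s x).symm v) : E) :=
    fun x v => rfl
  have hprim : ∀ x ∈ U, ∀ v w : W, T.curvatureBilin j s η p x v w
      = S.br (σ (T.curvatureBilin j s η p x) v) (S.j w)
        - S.br (σ (T.curvatureBilin j s η p x) w) (S.j v) := by
    intro x hx
    refine hσb _ ?_
    obtain ⟨c, hc1, hc2⟩ := hc x hx
    refine ⟨LinearMap.toContinuousLinearMap ((LieAlg.toModel E H).toLinearEquiv.toLinearMap ∘ₗ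
      (AlternatingMap.ofSubsingleton ℝ W (LieAlg E H) (0 : Fin 1)).symm c), fun w => ?_,
      fun v w => ?_⟩
    · have := hc1 (fun _ => w)
      rwa [add_sub_cancel_right] at this
    · have h2 : T.curvatureW j s η p x ![v, w] = _ := (congrArg (fun f => f ![v, w]) hc2).symm
      rw [spencer_one_apply] at h2
      have hv : ∀ v : W, c ![v] = c fun _ => v := fun v => by
        congr 1
        ext i
        fin_cases i
        rfl
      change _ = ⁅c ![v], T.embW j w⁆ - ⁅c ![w], T.embW j v⁆ at h2
      rw [hv, hv] at h2
      exact h2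
  refine ⟨Function.update η p μ, h.frameField, h.mem, fun r hr => ?_, fun r hr x hx v => ?_,
    fun r hr x hx => ?_⟩
  · by_cases hrp : r = p
    · subst hrp
      rw [Function.update_self]
      refine LForm.isSmoothOn fun z hz => contDiffAt_coord_of_frame h.frameField
        (f := fun x => -σ (T.curvatureBilin j s η r x)) hμ hz ?_
      exact ((h.smoothNear_curvatureBilin hj h11 h21 hp (mem_chart_source W z) hz).clm σ).neg
    · rw [Function.update_of_ne hrp]
      exact h.smooth r (by omega)
  · by_cases hrp : r = p
    · subst hrp
      rw [Function.update_self, hμ]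
      exact neg_mem (hσ _ _)
    · rw [Function.update_of_ne hrp]
      exact h.mem_gr r (by omega) x hx v
  · have h1 : T.curvature j s (Function.update η p μ) r x = T.curvature j s η r x :=
      T.curvature_congr j s (fun r' hr' => by
        have hne : r' ≠ p := by omega
        rw [Function.update_of_ne hne]) x
    rw [h1]
    by_cases hrp : r = p
    · subst hrp
      rw [Function.update_self]
      ext v
      have hv : v = ![v 0, v 1] := by
        ext i
        fin_cases i <;> rfl
      rw [AlternatingMap.neg_apply, LForm.bracket_apply]
      conv_lhs => rw [hv]
      rw [← curvatureW_frame_symm]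
      have h2 := hprim x hx ((s x).symm (v 0)) ((s x).symm (v 1))
      have h3 : T.curvatureW j s η r x ![(s x).symm (v 0), (s x).symm (v 1)]
          = ⁅-μ x (v 0), T.embW j ((s x).symm (v 1))⁆
            - ⁅-μ x (v 1), T.embW j ((s x).symm (v 0))⁆ := by
        have hμ' : ∀ v, -μ x v = (σ (T.curvatureBilin j s η r x) ((s x).symm v) : E) :=
          fun v => neg_neg (σ (T.curvatureBilin j s η r x) ((s x).symm v) : E)
        rw [hμ', hμ']
        exact h2
      rw [h3, soldering_apply, soldering_apply, neg_lie, neg_lie, lie_skew, lie_skew]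
      abel
    · rw [Function.update_of_ne hrp]
      exact h.eqn r (by omega) x hx

end FlatReductive

/-! ### The essential curvature -/

namespace FlatReductive

variable {E : Type*} [NormedAddCommGroup E] [NormedSpace ℝ E] [CompleteSpace E]
  {V : Type*} [NormedAddCommGroup V] [NormedSpace ℝ V]
  {W : Type*} [NormedAddCommGroup W] [NormedSpace ℝ W] [FiniteDimensional ℝ W]
  {H : Type*} [TopologicalSpace H] [ChartedSpace E H] [Group H]
  [LieGroup 𝓘(ℝ, E) ∞ H]
  {Mt : Type*} [TopologicalSpace Mt] [ChartedSpace V Mt] [MulAction H Mt]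
  {M : Type*} [TopologicalSpace M] [ChartedSpace W M] [IsManifold 𝓘(ℝ, W) ∞ M]
  {T : FlatReductive E V H Mt 2} {j : W →ₗ[ℝ] V}
  [ContMDiffSMul 𝓘(ℝ, E) 𝓘(ℝ, V) ∞ H Mt]
  {P : GStructure (T.inducedGroup j) M} {p : ℕ}

omit [FiniteDimensional ℝ W] [ContMDiffSMul 𝓘(ℝ, E) 𝓘(ℝ, V) ∞ H Mt] in
theorem isClass_iff {p : ℤ} {c c' : W [⋀^Fin 2]→ₗ[ℝ] LieAlg E H}
    (hc : c ∈ cocycles (T.embW j) T.gr p 2) :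
    IsClass (Submodule.Quotient.mk ⟨c, hc⟩ : T.Coh j p 2) c' ↔
      c' ∈ cocycles (T.embW j) T.gr p 2 ∧ c' - c ∈ coboundaries (T.embW j) T.gr p 2 := by
  constructor
  · rintro ⟨hc', h⟩
    exact ⟨hc', (Submodule.Quotient.eq
      ((coboundaries (T.embW j) T.gr p 2).submoduleOf (cocycles (T.embW j) T.gr p 2))).1 h⟩
  · rintro ⟨hc', h⟩
    exact ⟨hc', (Submodule.Quotient.eq _).2 h⟩

/-- The properties of the essential curvature, for a model of positive dimension. -/
theorem exists_essentialCurvature_of_nontrivial [Nontrivial W] [FiniteDimensional ℝ E]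
    [FiniteDimensional ℝ V] [IsManifold 𝓘(ℝ, V) ∞ Mt] [ConnectedSpace H]
    (hj : Function.Injective j) (h11 : Subsingleton (T.Coh j 1 1))
    (h21 : Subsingleton (T.Coh j 2 1)) (hp : p ≤ 2) (hP : T.ImmersibleToOrder j P p) :
    ∃ R : ∀ x : M, P.frames x → T.Coh j p 2,
      (∀ U s η (h : T.IsAdmissible j P p U s η) (x : M) (hx : x ∈ U),
        IsClass (R x ⟨s x, h.mem x hx⟩) (T.curvatureW j s η p x)) ∧
      (∀ (A : V ≃L[ℝ] V) (B : T.inducedGroup j) (g : H), A ∈ T.sharpGroup j →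
        IsUpperLeft j A B → T.IsIsotropy g A → ∀ (x : M) (u : P.frames x)
          (c : W [⋀^Fin 2]→ₗ[ℝ] LieAlg E H), IsClass (R x u) c →
          IsClass (R x (P.act u B⁻¹)) (T.actCochain g B c)) ∧
      ((∀ (x : M) (u : P.frames x), R x u = 0) ↔ T.ImmersibleToOrder j P (p + 1)) := by
  -- `R` is defined by a chosen tuple at each frame
  choose U s η hx h hs using fun (x : M) (u : P.frames x) =>
    exists_isAdmissible hj h11 h21 hP u.2
  let R : ∀ x : M, P.frames x → T.Coh j p 2 := fun x u => Submodule.Quotient.mk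
    ⟨T.curvatureW j (s x u) (η x u) p x, (h x u).curvatureW_mem_cocycles hj h11 h21 hp (hx x u)⟩
  have hR : ∀ U s η (h : T.IsAdmissible j P p U s η) (x : M) (hx : x ∈ U),
      IsClass (R x ⟨s x, h.mem x hx⟩) (T.curvatureW j s η p x) := by
    intro U' s' η' h' x hx'
    exact (isClass_iff _).2 ⟨h'.curvatureW_mem_cocycles hj h11 h21 hp hx',
      (h x _).curvatureW_sub_mem hj h11 h21 hp h' (hx x _) hx' (hs x _)⟩
  refine ⟨R, hR, ?_, ?_, ?_⟩
  · intro A B g _ hAB hg x u c hc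
    obtain ⟨hc1, hc2⟩ := (isClass_iff _).1 hc
    have h1 := (h x u).trans hj h11 h21 hg hAB B.2
    have h2 := hR _ _ _ h1 x (hx x u)
    rw [curvatureW_trans hj h11 h21 hg hAB
      ((h x u).differentiableAt_form hj h11 h21 le_rfl (hx x u))] at h2
    have hu : (⟨_, h1.mem x (hx x u)⟩ : P.frames x) = P.act u B⁻¹ :=
      Subtype.ext (congrArg (fun f : Frame W x => (B⁻¹ : W ≃L[ℝ] W).trans f) (hs x u))
    rw [hu] at h2
    obtain ⟨h3, h4⟩ := (isClass_iff _).1 h2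
    refine (isClass_iff _).2 ⟨actCochain_mem_cocycles hj h11 h21 hg hAB hc1, ?_⟩
    have h5 := add_mem (actCochain_mem_coboundaries hj h11 h21 hg hAB hc2) h4
    have h6 : T.actCochain g B (c - T.curvatureW j (s x u) (η x u) p x)
        = T.actCochain g B c - T.actCochain g B (T.curvatureW j (s x u) (η x u) p x) := by
      ext w
      exact (T.gradedAd g).map_sub _ _
    rwa [h6, sub_add_sub_cancel] at h5
  · intro hR0 x
    obtain ⟨U', s', η', hx', h'⟩ := hP x
    obtain ⟨μ, hμ⟩ := h'.exists_succ hj h11 h21 hp fun z hz => by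
      obtain ⟨hc, h1⟩ := hR _ _ _ h' z hz
      rw [hR0] at h1
      exact (Submodule.Quotient.mk_eq_zero
        ((coboundaries (T.embW j) T.gr p 2).submoduleOf (cocycles (T.embW j) T.gr p 2))).1 h1
    exact ⟨U', s', μ, hx', hμ⟩
  · intro hP' x u
    obtain ⟨U', s', η', hx', h', hs'⟩ := exists_isAdmissible hj h11 h21 hP' u.2
    obtain ⟨hc, h1⟩ := hR _ _ _ (h'.of_le (Nat.le_succ p)) x hx'
    have hu : (⟨s' x, (h'.of_le (Nat.le_succ p)).mem x hx'⟩ : P.frames x) = u := Subtype.ext hs'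
    rw [hu] at h1
    rw [← h1]
    exact (Submodule.Quotient.mk_eq_zero _).2 (curvatureW_mem_coboundaries h' hx')

/-- If the model is a point, then immersibility to all orders is automatic, as there are no nonzero
`2`-forms; the missing forms may be taken to be `0`. -/
theorem immersibleToOrder_succ_of_subsingleton [Subsingleton W] (hP : T.ImmersibleToOrder j P p) :
    T.ImmersibleToOrder j P (p + 1) := by
  intro x
  obtain ⟨U, s, η, hx, h⟩ := hP x
  have h2 : ∀ (x : M) (a b : TangentSpace 𝓘(ℝ, W) x [⋀^Fin 2]→ₗ[ℝ] LieAlg E H), a = b := by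
    intro x a b
    have hs : Subsingleton (TangentSpace 𝓘(ℝ, W) x) := inferInstanceAs (Subsingleton W)
    ext v
    rw [a.map_coord_zero 0 (Subsingleton.elim _ _), b.map_coord_zero 0 (Subsingleton.elim _ _)]
  refine ⟨U, s, truncForms p η, hx, h.frameField, h.mem, fun r _ => h.isFormTuple.smooth r,
    fun r _ => h.isFormTuple.mem_gr r, fun r _ x _ => h2 x _ _⟩

/-- The properties of the essential curvature if the model is a point, so that it vanishes. -/
theorem exists_essentialCurvature_of_subsingleton [Subsingleton W]
    (hP : T.ImmersibleToOrder j P p) :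
    ∃ R : ∀ x : M, P.frames x → T.Coh j p 2,
      (∀ U s η (h : T.IsAdmissible j P p U s η) (x : M) (hx : x ∈ U),
        IsClass (R x ⟨s x, h.mem x hx⟩) (T.curvatureW j s η p x)) ∧
      (∀ (A : V ≃L[ℝ] V) (B : T.inducedGroup j) (g : H), A ∈ T.sharpGroup j →
        IsUpperLeft j A B → T.IsIsotropy g A → ∀ (x : M) (u : P.frames x)
          (c : W [⋀^Fin 2]→ₗ[ℝ] LieAlg E H), IsClass (R x u) c →
          IsClass (R x (P.act u B⁻¹)) (T.actCochain g B c)) ∧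
      ((∀ (x : M) (u : P.frames x), R x u = 0) ↔ T.ImmersibleToOrder j P (p + 1)) := by
  have h2 : ∀ c : W [⋀^Fin 2]→ₗ[ℝ] LieAlg E H, c = 0 := fun c => by
    ext v
    exact c.map_coord_zero 0 (Subsingleton.elim _ _)
  have h3 : ∀ c : W [⋀^Fin 2]→ₗ[ℝ] LieAlg E H, IsClass (0 : T.Coh j p 2) c := fun c => by
    obtain rfl := h2 c
    exact ⟨zero_mem _, (Submodule.Quotient.mk_eq_zero _).2 (zero_mem _)⟩
  exact ⟨fun _ _ => 0, fun _ _ _ _ _ _ => h3 _, fun _ _ _ _ _ _ _ _ _ _ => h3 _,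
    fun _ => immersibleToOrder_succ_of_subsingleton hP, fun _ _ _ => rfl⟩

end FlatReductive

theorem inclW_injective (n m : ℕ) : Function.Injective (inclW n m) := by
  intro v w h
  ext i
  have := congrArg (fun f : Euc (n + m) => f (Fin.castAdd m i)) h
  simpa [inclW] using this

end Immersible

end

theorem theorem4p3 {N n m : ℕ}
    -- the connected Lie group `H`, acting smoothly, transitively and effectively on `Mt`
    {H : Type*} [TopologicalSpace H] [ChartedSpace (Immersible.Euc N) H] [Group H]
    [LieGroup (𝓡 N) ∞ H] [ConnectedSpace H]
    {Mt : Type*} [TopologicalSpace Mt] [ChartedSpace (Immersible.Euc (n + m)) Mt]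
    [IsManifold (𝓡 (n + m)) ∞ Mt] [MulAction H Mt] [ContMDiffSMul (𝓡 N) (𝓡 (n + m)) ∞ H Mt]
    [MulAction.IsPretransitive H Mt] [FaithfulSMul H Mt]
    -- the flat `2`-reductive structure
    (T : Immersible.FlatReductive (Immersible.Euc N) (Immersible.Euc (n + m)) H Mt 2)
    -- the `G`-structure
    {M : Type*} [TopologicalSpace M] [ChartedSpace (Immersible.Euc n) M] [IsManifold (𝓡 n) ∞ M]
    (P : Immersible.GStructure (T.inducedGroup (Immersible.inclW n m)) M)
    (h11 : Subsingleton (T.Coh (Immersible.inclW n m) 1 1)) (h21 : Subsingleton (T.Coh (Immersible.inclW n m) 2 1))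
    (p : ℕ) (hp : p ≤ 2) (hP : T.ImmersibleToOrder (Immersible.inclW n m) P p) :
    -- every frame of `P` is the value of some admissible tuple
    (∀ (x : M) (u : P.frames x), ∃ U s η, x ∈ U ∧ T.IsAdmissible (Immersible.inclW n m) P p U s η ∧ s x = u) ∧
    ∃ R : ∀ x : M, P.frames x → T.Coh (Immersible.inclW n m) p 2,
      -- `R` is given by the class of the total curvature of any admissible tuple
      (∀ U s η (h : T.IsAdmissible (Immersible.inclW n m) P p U s η) (x : M) (hx : x ∈ U),
        Immersible.IsClass (R x ⟨s x, h.mem x hx⟩) (T.curvatureW (Immersible.inclW n m) s η p x)) ∧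
      -- `R (u · B⁻¹) = A · R u` for `A ∈ G_♯` with upper left block `B`; the action of `A` on `𝔥` is
      -- that of any element `g` of the isotropy group lying over `A`
      (∀ (A : Immersible.Euc (n + m) ≃L[ℝ] Immersible.Euc (n + m)) (B : T.inducedGroup (Immersible.inclW n m)) (g : H),
        A ∈ T.sharpGroup (Immersible.inclW n m) → Immersible.IsUpperLeft (Immersible.inclW n m) A B → T.IsIsotropy g A →
        ∀ (x : M) (u : P.frames x) (c : Immersible.Euc n [⋀^Fin 2]→ₗ[ℝ] Immersible.LieAlg (Immersible.Euc N) H),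
          Immersible.IsClass (R x u) c →
          Immersible.IsClass (R x (P.act u B⁻¹)) (T.actCochain g B c)) ∧
      -- `R` is the obstruction to immersibility to the next order
      ((∀ (x : M) (u : P.frames x), R x u = 0) ↔ T.ImmersibleToOrder (Immersible.inclW n m) P (p + 1)) := by
  have hj := Immersible.inclW_injective n m
  rcases subsingleton_or_nontrivial (Immersible.Euc n) with hW | hW
  · refine ⟨fun x u => ?_, Immersible.FlatReductive.exists_essentialCurvature_of_subsingleton hP⟩
    obtain ⟨U, s, η, hx, h⟩ := hP x
    exact ⟨U, s, η, hx, h, ContinuousLinearEquiv.ext (funext fun w => by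
      rw [Subsingleton.elim w 0, map_zero, map_zero])⟩
  · exact ⟨fun x u => Immersible.FlatReductive.exists_isAdmissible hj h11 h21 hP u.2,
      Immersible.FlatReductive.exists_essentialCurvature_of_nontrivial hj h11 h21 hp hP⟩
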